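/- Let $\mathbb D$ be the open unit disc, $\mathbb T$ the unit circle with normalized Haar measure $m$. Let $\Psi\colon[0,\infty)\to[0,\infty)$ be an Orlicz function, i.e. $\Psi$ is non-decreasing, strictly convex, continuous at $0$, $\Psi(0)=0$ and $\Psi(x)/x\to\infty$ as $x\to\infty$; put $\Psi(\infty)=\infty$, so that $\Psi$ has an inverse $\Psi^{-1}\colon[0,\infty]\to[0,\infty]$, and put $\chi_A(x)=\Psi(A\,\Psi^{-1}(x))$ for $A>0$. For measurable $f$ on $\mathbb T$ let $\|f\|_\Psi=\inf\{C>0:\int_{\mathbb T}\Psi(|f|/C)\,dm\le 1\}$, and let $M^\Psi(\mathbb T)$ be the space of measurable $f$ with $\int_{\mathbb T}\Psi(|f|/C)\,dm<\infty$ for every $C>0$. The Hardy--Orlicz space $H^\Psi$ is the space of analytic $f\colon\mathbb D\to\mathbb C$ with $\|f\|_\Psi:=\sup_{0\le r<1}\|f_r\|_\Psi<\infty$, where $f_r(e^{it})=f(re^{it})$; write $f^*(e^{it})=\lim_{r\to1^-}f(re^{it})$ for the boundary values, which exist $m$-a.e. For $a\in\mathbb T$ and $0\le r<1$ let $u_{a,r}(z)=\big(\frac{1-r}{1-\bar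 a r z}\big)^2$, $z\in\mathbb D$. Suppose that $\Psi$ satisfies the $\Delta^2$-condition: there is $\alpha>1$ such that $\Psi(x)^2\le\Psi(\alpha x)$ for all sufficiently large $x$. Let $\phi\colon\mathbb D\to\mathbb D$ be analytic. Then $C_\phi(f)=f\circ\phi$ defines a bounded operator $C_\phi\colon H^\Psi\to H^\Psi$, and the following assertions are equivalent: 1. $C_\phi$ is order bounded into $M^\Psi(\mathbb T)$: there is $g\in M^\Psi(\mathbb T)$ such that, for every $f\in H^\Psi$ with $\|f\|_\Psi\le1$, $|(C_\phi f)^*|\le g$ $m$-a.e.; 2. $C_\phi$ is compact; 3. $C_\phi$ is weakly compact; 4. $\Psi^{-1}\big(\frac{1}{1-|\phi^*|}\big)\in M^\Psi(\mathbb T)$; that is, $\chi_B\big(\frac1{1-|\phi^*|}\big)\in L^1(\mathbb T)$ for every $B>0$ (with $1/0=\infty$); 5. for every $A>0$, $m(1-|\phi^*|<\lambda)=O\big(1/\chi_A(1/\lambda)\big)$ as $\lambda\to0^+$; 6. $\sup_{a\in\mathbb T}\|C_\phi(u_{a,r})\|_\Psi=o\Big(\dfrac{1}{\Psi^{-1}\big(\frac1{1-r}\big)}\Big)$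 as $r\to1^-$. -/

import Mathlib

open Set Filter Topology MeasureTheory Asymptotics
open scoped ENNReal NNReal

noncomputable section

/-- A (finite-valued) Orlicz function `Ψ : [0, ∞) → [0, ∞)`: `Ψ 0 = 0`, non-decreasing, strictly
convex, continuous at `0`, with `Ψ x / x → ∞`. Only the values on `[0, ∞)` matter. -/
structure OrliczFunction where
  toFun : ℝ → ℝ
  map_zero : toFun 0 = 0
  monotoneOn : MonotoneOn toFun (Ici 0)
  strictConvexOn : StrictConvexOn ℝ (Ici 0) toFun
  continuousAt_zero : ContinuousWithinAt toFun (Ici 0) 0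
  tendsto_div : Tendsto (fun x => toFun x / x) atTop atTop

namespace OrliczFunction

variable (Ψ : OrliczFunction)

/-- The function `Ψ : [0, ∞] → [0, ∞]`, with `Ψ ∞ = ∞`. -/
def eval (x : ℝ≥0∞) : ℝ≥0∞ := if x = ⊤ then ⊤ else ENNReal.ofReal (Ψ.toFun x.toReal)

/-- The inverse `Ψ⁻¹ : [0, ∞] → [0, ∞]`; see `eval_inv` and `inv_eval`. -/
def inv (y : ℝ≥0∞) : ℝ≥0∞ := sSup {x | Ψ.eval x ≤ y}

/-- `χ_K(x) = Ψ(K Ψ⁻¹(x))`. -/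
def chi (K x : ℝ≥0∞) : ℝ≥0∞ := Ψ.eval (K * Ψ.inv x)

/-- The fast growth condition `Δ²`: for some `α > 1`, `Ψ(x)² ≤ Ψ(α x)` for `x` large enough. -/
def SatisfiesDelta2 : Prop := ∃ α : ℝ, 1 < α ∧ ∀ᶠ x in atTop, Ψ.toFun x ^ 2 ≤ Ψ.toFun (α * x)

theorem nonneg {x : ℝ} (hx : 0 ≤ x) : 0 ≤ Ψ.toFun x := by
  have := Ψ.monotoneOn (mem_Ici.2 le_rfl) (mem_Ici.2 hx) hx
  rwa [Ψ.map_zero] at this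

theorem strictMonoOn : StrictMonoOn Ψ.toFun (Ici 0) := by
  intro x hx y hy hxy
  refine lt_of_le_of_ne (Ψ.monotoneOn hx hy hxy.le) fun h => ?_
  obtain ⟨-, hc⟩ := Ψ.strictConvexOn
  have h1 := hc hx hy hxy.ne (a := 1 / 2) (b := 1 / 2) (by norm_num) (by norm_num) (by norm_num)
  simp only [smul_eq_mul] at h1
  have hx' : (0 : ℝ) ≤ x := hx
  have h2 := Ψ.monotoneOn hx (mem_Ici.2 (by linarith : (0 : ℝ) ≤ 1 / 2 * x + 1 / 2 * y))
    (by linarith)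
  linarith

theorem eval_zero : Ψ.eval 0 = 0 := by simp [eval, Ψ.map_zero]

theorem eval_strictMono : StrictMono Ψ.eval := by
  intro x y hxy
  have hx : x ≠ ⊤ := hxy.ne_top
  by_cases hy : y = ⊤
  · simp [eval, hx, hy]
  · simp only [eval, hx, hy, if_false]
    have hlt : x.toReal < y.toReal := (ENNReal.toReal_lt_toReal hx hy).2 hxy
    have h := Ψ.strictMonoOn (mem_Ici.2 ENNReal.toReal_nonneg)
      (mem_Ici.2 ENNReal.toReal_nonneg) hlt
    exact (ENNReal.ofReal_lt_ofReal_iff ((Ψ.nonneg ENNReal.toReal_nonneg).trans_lt h)).2 h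

theorem inv_eval (x : ℝ≥0∞) : Ψ.inv (Ψ.eval x) = x := by
  have : {x' | Ψ.eval x' ≤ Ψ.eval x} = Iic x := by
    ext x'; simp [Ψ.eval_strictMono.le_iff_le]
  rw [inv, this, csSup_Iic]

theorem continuousOn : ContinuousOn Ψ.toFun (Ici 0) := by
  intro x hx
  rcases eq_or_lt_of_le (mem_Ici.1 hx) with h | h
  · subst h; exact Ψ.continuousAt_zero
  · have h1 : ContinuousOn Ψ.toFun (interior (Ici 0)) :=
      Ψ.strictConvexOn.convexOn.continuousOn_interior
    rw [interior_Ici] at h1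
    exact (h1.continuousAt (Ioi_mem_nhds h)).continuousWithinAt

theorem tendsto_atTop : Tendsto Ψ.toFun atTop atTop := by
  have h := Ψ.tendsto_div.atTop_mul_atTop₀ tendsto_id
  refine h.congr' ?_
  filter_upwards [eventually_gt_atTop (0 : ℝ)] with x hx
  simp [hx.ne']

theorem eval_inv (y : ℝ≥0∞) : Ψ.eval (Ψ.inv y) = y := by
  obtain ⟨x, rfl⟩ : ∃ x, Ψ.eval x = y := by
    by_cases hy : y = ⊤
    · exact ⟨⊤, by simp [eval, hy]⟩
    obtain ⟨b, hb0, hb⟩ := ((eventually_ge_atTop (0 : ℝ)).and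
      (Ψ.tendsto_atTop.eventually_ge_atTop y.toReal)).exists
    obtain ⟨c, hc, hcy⟩ := intermediate_value_Icc hb0
      (Ψ.continuousOn.mono Icc_subset_Ici_self)
      ⟨by rw [Ψ.map_zero]; exact ENNReal.toReal_nonneg, hb⟩
    refine ⟨ENNReal.ofReal c, ?_⟩
    simp [eval, ENNReal.toReal_ofReal hc.1, hcy, ENNReal.ofReal_toReal hy]
  rw [Ψ.inv_eval]

theorem eval_convex {a b x y : ℝ≥0∞} (hab : a + b = 1) :
    Ψ.eval (a * x + b * y) ≤ a * Ψ.eval x + b * Ψ.eval y := by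
  by_cases ha : a = 0
  · simp only [ha, zero_add] at hab; simp [ha, hab]
  by_cases hb : b = 0
  · simp only [hb, add_zero] at hab; simp [hb, hab]
  by_cases hx : x = ⊤
  · simp [eval, hx, ENNReal.mul_top ha]
  by_cases hy : y = ⊤
  · simp [eval, hy, ENNReal.mul_top hb]
  have ha' : a ≠ ⊤ := ne_top_of_le_ne_top ENNReal.one_ne_top (hab ▸ le_self_add)
  have hb' : b ≠ ⊤ := ne_top_of_le_ne_top ENNReal.one_ne_top (hab ▸ le_add_self)
  have hax := ENNReal.mul_ne_top ha' hx
  have hby := ENNReal.mul_ne_top hb' hy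
  obtain ⟨-, hc⟩ := Ψ.strictConvexOn.convexOn
  have h := hc (x := x.toReal) (y := y.toReal)
    (mem_Ici.2 ENNReal.toReal_nonneg) (mem_Ici.2 ENNReal.toReal_nonneg)
    (a := a.toReal) (b := b.toReal) ENNReal.toReal_nonneg ENNReal.toReal_nonneg
    (by rw [← ENNReal.toReal_add ha' hb', hab]; simp)
  simp only [smul_eq_mul] at h
  have hne : a * x + b * y ≠ ⊤ := ENNReal.add_ne_top.2 ⟨hax, hby⟩
  simp only [eval, hx, hy, hne, if_false]
  rw [ENNReal.toReal_add hax hby, ENNReal.toReal_mul, ENNReal.toReal_mul]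
  refine (ENNReal.ofReal_le_ofReal h).trans ?_
  rw [ENNReal.ofReal_add
    (mul_nonneg ENNReal.toReal_nonneg (Ψ.nonneg ENNReal.toReal_nonneg))
    (mul_nonneg ENNReal.toReal_nonneg (Ψ.nonneg ENNReal.toReal_nonneg)),
    ENNReal.ofReal_mul ENNReal.toReal_nonneg, ENNReal.ofReal_mul ENNReal.toReal_nonneg,
    ENNReal.ofReal_toReal ha', ENNReal.ofReal_toReal hb']

end OrliczFunction

/-- The normalized Haar measure `m` of the unit circle, in the angular coordinate:
`dt / 2π` on `(0, 2π]`. Functions on the circle are functions of the angle `t`. -/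
def circleMeasure : Measure ℝ :=
  (ENNReal.ofReal (2 * Real.pi))⁻¹ • volume.restrict (Ioc 0 (2 * Real.pi))

/-- The Luxemburg norm `‖f‖_Ψ = inf {C > 0 | ∫ Ψ(|f| / C) dm ≤ 1}`. -/
def luxemburgNorm (Ψ : OrliczFunction) {ε : Type*} [ENorm ε] (f : ℝ → ε) : ℝ≥0∞ :=
  sInf {C | 0 < C ∧ ∫⁻ t, Ψ.eval (‖f t‖ₑ / C) ∂circleMeasure ≤ 1}

/-- Membership in the Morse–Transue space `M^Ψ(𝕋)`: measurable functions with
`∫ Ψ(|f| / C) dm < ∞` for all `C > 0`. As `Ψ ∞ = ∞`, a `[0, ∞]`-valued member is a.e. finite. -/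
def MemMorseTransue (Ψ : OrliczFunction) {ε : Type*} [TopologicalSpace ε] [ContinuousENorm ε]
    (f : ℝ → ε) : Prop :=
  AEStronglyMeasurable f circleMeasure ∧
    ∀ C : ℝ≥0, 0 < C → ∫⁻ t, Ψ.eval (‖f t‖ₑ / C) ∂circleMeasure < ⊤

/-- The boundary function `f*(t) = lim_{r → 1⁻} f(r e^{it})` (arbitrary where there is no limit). -/
def boundaryValue (f : ℂ → ℂ) (t : ℝ) : ℂ :=
  limUnder (𝓝[<] (1 : ℝ)) fun r => f (circleMap 0 r t)

/-- `sup_{0 ≤ r < 1} ‖f_r‖_Ψ`, where `f_r(t) = f(r e^{it})`. -/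
def hardyOrliczENorm (Ψ : OrliczFunction) (f : ℂ → ℂ) : ℝ≥0∞ :=
  ⨆ r ∈ Ico (0 : ℝ) 1, luxemburgNorm Ψ fun t => f (circleMap 0 r t)

section Luxemburg

variable (Ψ : OrliczFunction)

instance : IsProbabilityMeasure circleMeasure := by
  constructor
  have h : ENNReal.ofReal (2 * Real.pi) ≠ 0 := by
    simpa using Real.pi_pos
  simp only [circleMeasure, Measure.smul_apply, Measure.restrict_apply MeasurableSet.univ,
    univ_inter, Real.volume_Ioc, sub_zero, smul_eq_mul]
  exact ENNReal.inv_mul_cancel h ENNReal.ofReal_ne_top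

theorem luxemburgNorm_zero : luxemburgNorm Ψ (fun _ : ℝ => (0 : ℂ)) = 0 := by
  refine le_antisymm (le_of_forall_gt fun C hC => ?_) bot_le
  obtain ⟨D, hD, hDC⟩ := exists_between hC
  have hmem : luxemburgNorm Ψ (fun _ : ℝ => (0 : ℂ)) ≤ D := sInf_le ⟨hD, by simp [Ψ.eval_zero]⟩
  exact hmem.trans_lt hDC

theorem luxemburgNorm_add_le {f g : ℝ → ℂ} (hf : Measurable f) :
    luxemburgNorm Ψ (fun t => f t + g t) ≤ luxemburgNorm Ψ f + luxemburgNorm Ψ g := by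
  have key : ∀ C ∈ {C | 0 < C ∧ ∫⁻ t, Ψ.eval (‖f t‖ₑ / C) ∂circleMeasure ≤ 1},
      ∀ D ∈ {C | 0 < C ∧ ∫⁻ t, Ψ.eval (‖g t‖ₑ / C) ∂circleMeasure ≤ 1},
      luxemburgNorm Ψ (fun t => f t + g t) ≤ C + D := by
    rintro C ⟨hC, hCf⟩ D ⟨hD, hDg⟩
    by_cases hCt : C = ⊤
    · simp [hCt]
    by_cases hDt : D = ⊤
    · simp [hDt]
    have hS0 : C + D ≠ 0 := (hC.trans_le le_self_add).ne'
    have hSt : C + D ≠ ⊤ := ENNReal.add_ne_top.2 ⟨hCt, hDt⟩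
    have hab : C / (C + D) + D / (C + D) = 1 := by
      rw [← ENNReal.add_div, ENNReal.div_self hS0 hSt]
    refine sInf_le ⟨pos_iff_ne_zero.2 hS0, ?_⟩
    have hpt : ∀ t, Ψ.eval (‖f t + g t‖ₑ / (C + D)) ≤
        C / (C + D) * Ψ.eval (‖f t‖ₑ / C) + D / (C + D) * Ψ.eval (‖g t‖ₑ / D) := by
      intro t
      refine le_trans (Ψ.eval_strictMono.monotone ?_) (Ψ.eval_convex hab)
      have hcancel : ∀ {E x : ℝ≥0∞}, E ≠ 0 → E ≠ ⊤ → E / (C + D) * (x / E) = x / (C + D) := by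
        intro E x h0 ht
        calc E / (C + D) * (x / E) = E * E⁻¹ * (x * (C + D)⁻¹) := by
              simp only [div_eq_mul_inv]; ring
          _ = x / (C + D) := by rw [ENNReal.mul_inv_cancel h0 ht, one_mul, div_eq_mul_inv]
      rw [hcancel hC.ne' hCt, hcancel hD.ne' hDt, ← ENNReal.add_div]
      exact ENNReal.div_le_div_right (enorm_add_le _ _) _
    have hm : Measurable fun t => C / (C + D) * Ψ.eval (‖f t‖ₑ / C) :=
      (Ψ.eval_strictMono.monotone.measurable.comp (hf.enorm.div_const C)).const_mul _
    have hc1 : C / (C + D) ≠ ⊤ := ENNReal.div_ne_top hCt hS0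
    have hc2 : D / (C + D) ≠ ⊤ := ENNReal.div_ne_top hDt hS0
    calc ∫⁻ t, Ψ.eval (‖f t + g t‖ₑ / (C + D)) ∂circleMeasure
        ≤ ∫⁻ t, (C / (C + D) * Ψ.eval (‖f t‖ₑ / C) +
            D / (C + D) * Ψ.eval (‖g t‖ₑ / D)) ∂circleMeasure := lintegral_mono hpt
      _ = C / (C + D) * ∫⁻ t, Ψ.eval (‖f t‖ₑ / C) ∂circleMeasure +
            D / (C + D) * ∫⁻ t, Ψ.eval (‖g t‖ₑ / D) ∂circleMeasure := by
          rw [lintegral_add_left hm, lintegral_const_mul' _ _ hc1, lintegral_const_mul' _ _ hc2]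
      _ ≤ C / (C + D) * 1 + D / (C + D) * 1 := by gcongr
      _ = 1 := by rw [mul_one, mul_one, hab]
  conv_rhs => rw [luxemburgNorm, luxemburgNorm, ENNReal.sInf_add]
  refine le_iInf₂ fun C hC => ?_
  rw [add_comm, ENNReal.sInf_add]
  refine le_iInf₂ fun D hD => ?_
  rw [add_comm]
  exact key C hC D hD

theorem luxemburgNorm_smul_le (c : ℂ) (f : ℝ → ℂ) :
    luxemburgNorm Ψ (fun t => c * f t) ≤ ‖c‖ₑ * luxemburgNorm Ψ f := by
  by_cases hc : c = 0
  · simp [hc, luxemburgNorm_zero]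
  have hc0 : ‖c‖ₑ ≠ 0 := by simpa using hc
  have hct : ‖c‖ₑ ≠ ⊤ := enorm_ne_top
  rw [mul_comm, ← ENNReal.div_le_iff hc0 hct]
  refine le_sInf fun C ⟨hC, hCf⟩ => ?_
  rw [ENNReal.div_le_iff hc0 hct]
  refine sInf_le ⟨pos_iff_ne_zero.2 (mul_ne_zero hC.ne' hc0), ?_⟩
  refine le_trans (le_of_eq (lintegral_congr fun t => ?_)) hCf
  rw [enorm_mul, mul_comm C, ENNReal.mul_div_mul_left _ _ hc0 hct]

theorem luxemburgNorm_le_of_bound {f : ℝ → ℂ} {M : ℝ≥0∞} (hM : ∀ t, ‖f t‖ₑ ≤ M) (hMt : M ≠ ⊤) :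
    luxemburgNorm Ψ f ≤ M / Ψ.inv 1 := by
  have hi0 : Ψ.inv 1 ≠ 0 := fun h => by
    have := Ψ.eval_inv 1
    rw [h, Ψ.eval_zero] at this
    exact zero_ne_one this
  have hit : Ψ.inv 1 ≠ ⊤ := fun h => by
    have := Ψ.eval_inv 1
    rw [h] at this
    simp [OrliczFunction.eval] at this
  by_cases hM0 : M = 0
  · have : f = fun _ => 0 := by
      ext1 t
      simpa [hM0] using hM t
    rw [this, luxemburgNorm_zero]; exact bot_le
  refine sInf_le ⟨ENNReal.div_pos hM0 hit, ?_⟩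
  have : ∀ t, Ψ.eval (‖f t‖ₑ / (M / Ψ.inv 1)) ≤ 1 := by
    intro t
    rw [← Ψ.eval_inv 1]
    apply Ψ.eval_strictMono.monotone
    rw [Ψ.eval_inv 1]
    calc ‖f t‖ₑ / (M / Ψ.inv 1) ≤ M / (M / Ψ.inv 1) := ENNReal.div_le_div_right (hM t) _
      _ = Ψ.inv 1 := ENNReal.div_div_cancel hM0 hMt
  calc _ ≤ ∫⁻ _, 1 ∂circleMeasure := lintegral_mono this
    _ = 1 := by simp

theorem ae_eq_zero_of_luxemburgNorm {f : ℝ → ℂ} (hf : Measurable f)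
    (h : luxemburgNorm Ψ f = 0) : ∀ᵐ t ∂circleMeasure, f t = 0 := by
  -- `∫ Ψ(n |f|) dm ≤ 1` for every `n`, and `Ψ(n |f|) ≥ n Ψ(|f|)`
  have hn : ∀ n : ℕ, (n : ℝ≥0∞) * ∫⁻ t, Ψ.eval ‖f t‖ₑ ∂circleMeasure ≤ 1 := by
    intro n
    rcases Nat.eq_zero_or_pos n with h0 | h0
    · simp [h0]
    have hn0 : (n : ℝ≥0∞) ≠ 0 := by exact_mod_cast h0.ne'
    have hlt : luxemburgNorm Ψ f < (n : ℝ≥0∞)⁻¹ := by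
      rw [h]; simp
    obtain ⟨C, ⟨hC, hCf⟩, hCn⟩ := sInf_lt_iff.1 hlt
    refine le_trans ?_ hCf
    rw [← lintegral_const_mul' _ _ (ENNReal.natCast_ne_top n)]
    refine lintegral_mono fun t => ?_
    have hinv : (n : ℝ≥0∞)⁻¹ ≤ 1 := by
      rw [ENNReal.inv_le_one]; exact_mod_cast h0
    have h1 := Ψ.eval_convex (a := (n : ℝ≥0∞)⁻¹) (b := 1 - (n : ℝ≥0∞)⁻¹)
      (x := n * ‖f t‖ₑ) (y := 0) (add_tsub_cancel_of_le hinv)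
    rw [mul_zero, add_zero, Ψ.eval_zero, mul_zero, add_zero, ← mul_assoc,
      ENNReal.inv_mul_cancel hn0 (ENNReal.natCast_ne_top n), one_mul] at h1
    calc (n : ℝ≥0∞) * Ψ.eval ‖f t‖ₑ ≤ n * ((n : ℝ≥0∞)⁻¹ * Ψ.eval (n * ‖f t‖ₑ)) := by gcongr
      _ = Ψ.eval (n * ‖f t‖ₑ) := by
          rw [← mul_assoc, ENNReal.mul_inv_cancel hn0 (ENNReal.natCast_ne_top n), one_mul]
      _ ≤ Ψ.eval (‖f t‖ₑ / C) := by
          apply Ψ.eval_strictMono.monotone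
          rw [mul_comm, div_eq_mul_inv]
          gcongr
          rw [ENNReal.le_inv_iff_le_inv]
          exact hCn.le
  have hz : ∫⁻ t, Ψ.eval ‖f t‖ₑ ∂circleMeasure = 0 := by
    by_contra hne
    obtain ⟨n, hn'⟩ := ENNReal.exists_nat_mul_gt hne ENNReal.one_ne_top
    exact absurd (hn n) (not_le.2 hn')
  have hm : Measurable fun t => Ψ.eval ‖f t‖ₑ :=
    Ψ.eval_strictMono.monotone.measurable.comp hf.enorm
  rw [lintegral_eq_zero_iff hm] at hz
  filter_upwards [hz] with t ht
  have : ‖f t‖ₑ = 0 := Ψ.eval_strictMono.injective (by rw [Ψ.eval_zero]; exact ht)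
  simpa using this

theorem continuous_circle_slice {f : ℂ → ℂ} (hf : DifferentiableOn ℂ f (Metric.ball 0 1)) {r : ℝ}
    (hr : r ∈ Ico (0 : ℝ) 1) : Continuous fun t => f (circleMap 0 r t) := by
  refine hf.continuousOn.comp_continuous (continuous_circleMap 0 r) fun t => ?_
  simp [abs_of_nonneg hr.1, hr.2]

theorem hardyOrliczENorm_zero : hardyOrliczENorm Ψ 0 = 0 := by
  have := luxemburgNorm_zero Ψ
  simp [hardyOrliczENorm, this]

theorem hardyOrliczENorm_add_le {f g : ℂ → ℂ} (hf : DifferentiableOn ℂ f (Metric.ball 0 1)) :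
    hardyOrliczENorm Ψ (f + g) ≤ hardyOrliczENorm Ψ f + hardyOrliczENorm Ψ g :=
  iSup₂_le fun r hr => (luxemburgNorm_add_le Ψ (continuous_circle_slice hf hr).measurable).trans
    (add_le_add
      (le_iSup₂ (f := fun r (_ : r ∈ Ico (0 : ℝ) 1) =>
        luxemburgNorm Ψ fun t => f (circleMap 0 r t)) r hr)
      (le_iSup₂ (f := fun r (_ : r ∈ Ico (0 : ℝ) 1) =>
        luxemburgNorm Ψ fun t => g (circleMap 0 r t)) r hr))

theorem hardyOrliczENorm_smul_le (c : ℂ) (f : ℂ → ℂ) :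
    hardyOrliczENorm Ψ (c • f) ≤ ‖c‖ₑ * hardyOrliczENorm Ψ f :=
  iSup₂_le fun r hr => (luxemburgNorm_smul_le Ψ c _).trans
    (mul_le_mul_right (le_iSup₂ (f := fun r (_ : r ∈ Ico (0 : ℝ) 1) =>
        luxemburgNorm Ψ fun t => f (circleMap 0 r t)) r hr) _)

theorem eq_zero_of_hardyOrliczENorm {f : ℂ → ℂ} (hf : DifferentiableOn ℂ f (Metric.ball 0 1))
    (h : hardyOrliczENorm Ψ f = 0) {z : ℂ} (hz : z ∈ Metric.ball (0 : ℂ) 1) : f z = 0 := by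
  have hr : ‖z‖ ∈ Ico (0 : ℝ) 1 := ⟨norm_nonneg z, by simpa using hz⟩
  have h0 : luxemburgNorm Ψ (fun t => f (circleMap 0 ‖z‖ t)) = 0 := by
    refine le_antisymm ?_ bot_le
    rw [← h]
    exact le_iSup₂ (f := fun r (_ : r ∈ Ico (0 : ℝ) 1) =>
        luxemburgNorm Ψ fun t => f (circleMap 0 r t)) ‖z‖ hr
  have hc := continuous_circle_slice hf hr
  have hae := ae_eq_zero_of_luxemburgNorm Ψ hc.measurable h0
  have hae' : ∀ᵐ t ∂(volume.restrict (Ioc 0 (2 * Real.pi))), f (circleMap 0 ‖z‖ t) = 0 := by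
    rw [circleMeasure, ae_iff, Measure.smul_apply, smul_eq_mul, mul_eq_zero] at hae
    rcases hae with h | h
    · exact absurd h (ENNReal.inv_ne_zero.2 ENNReal.ofReal_ne_top)
    · exact ae_iff.2 h
  have hIoo : ∀ᵐ t ∂(volume.restrict (Ioo 0 (2 * Real.pi))), f (circleMap 0 ‖z‖ t) = 0 :=
    ae_restrict_of_ae_restrict_of_subset Ioo_subset_Ioc_self hae'
  have hEq : EqOn (fun t => f (circleMap 0 ‖z‖ t)) (fun _ => 0) (Ioo 0 (2 * Real.pi)) :=
    Measure.eqOn_open_of_ae_eq hIoo isOpen_Ioo hc.continuousOn continuousOn_const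
  have hcl := hEq.closure hc continuous_const
  rw [closure_Ioo Real.two_pi_pos.ne] at hcl
  obtain ⟨t, ht, htz⟩ : ∃ t ∈ Icc 0 (2 * Real.pi), circleMap 0 ‖z‖ t = z := by
    have hmem : z ∈ circleMap 0 ‖z‖ '' Ioc 0 (2 * Real.pi) := by
      rw [image_circleMap_Ioc]; simp
    obtain ⟨t, ht, htz⟩ := hmem
    exact ⟨t, Ioc_subset_Icc_self ht, htz⟩
  have := hcl ht
  simpa [htz] using this

/-- The underlying vector space of `H^Ψ`: analytic functions on the open unit disc with
`sup_{0 ≤ r < 1} ‖f_r‖_Ψ < ∞`. A function on the disc is represented by its extension by `0`. -/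
def hardyOrliczSubmodule : Submodule ℂ (ℂ → ℂ) where
  carrier := {f | DifferentiableOn ℂ f (Metric.ball 0 1) ∧ (∀ z ∉ Metric.ball (0 : ℂ) 1, f z = 0) ∧
    hardyOrliczENorm Ψ f < ⊤}
  zero_mem' := ⟨differentiableOn_const 0, fun _ _ => rfl, by simp [hardyOrliczENorm_zero]⟩
  add_mem' := fun {f g} hf hg => ⟨hf.1.add hg.1,
    fun z hz => by simp [hf.2.1 z hz, hg.2.1 z hz],
    (hardyOrliczENorm_add_le Ψ hf.1).trans_lt (ENNReal.add_lt_top.2 ⟨hf.2.2, hg.2.2⟩)⟩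
  smul_mem' := fun c f hf => ⟨hf.1.const_smul c, fun z hz => by simp [hf.2.1 z hz],
    (hardyOrliczENorm_smul_le Ψ c f).trans_lt (ENNReal.mul_lt_top enorm_lt_top hf.2.2)⟩

/-- The Hardy–Orlicz space `H^Ψ`, with the norm `‖f‖_Ψ = sup_{0 ≤ r < 1} ‖f_r‖_Ψ`. -/
def HardyOrlicz : Type := hardyOrliczSubmodule Ψ

end Luxemburg

namespace HardyOrlicz

variable {Ψ : OrliczFunction}

instance : AddCommGroup (HardyOrlicz Ψ) := inferInstanceAs (AddCommGroup (hardyOrliczSubmodule Ψ))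

instance : Module ℂ (HardyOrlicz Ψ) := inferInstanceAs (Module ℂ (hardyOrliczSubmodule Ψ))

instance : CoeFun (HardyOrlicz Ψ) fun _ => ℂ → ℂ := ⟨fun f => f.1⟩

/-- The norm of `H^Ψ`, with its axioms. -/
def addGroupNorm : AddGroupNorm (HardyOrlicz Ψ) where
  toFun f := (hardyOrliczENorm Ψ f).toReal
  map_zero' := by
    change (hardyOrliczENorm Ψ 0).toReal = 0
    simp [hardyOrliczENorm_zero]
  add_le' f g := by
    rw [← ENNReal.toReal_add f.2.2.2.ne g.2.2.2.ne]
    exact ENNReal.toReal_mono (ENNReal.add_ne_top.2 ⟨f.2.2.2.ne, g.2.2.2.ne⟩)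
      (hardyOrliczENorm_add_le Ψ f.2.1)
  neg' f := by
    have key : ∀ g : HardyOrlicz Ψ, hardyOrliczENorm Ψ (-g : HardyOrlicz Ψ) ≤
        hardyOrliczENorm Ψ g := fun g => by
      have h := hardyOrliczENorm_smul_le Ψ (-1) g
      rw [neg_one_smul] at h
      rw [enorm_neg, enorm_one, one_mul] at h
      exact h
    have h2 := key (-f)
    rw [neg_neg] at h2
    rw [le_antisymm (key f) h2]
  eq_zero_of_map_eq_zero' f hf := by
    have h0 : hardyOrliczENorm Ψ f = 0 := by
      rcases (ENNReal.toReal_eq_zero_iff _).1 hf with h | h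
      · exact h
      · exact absurd h f.2.2.2.ne
    apply Subtype.ext
    funext z
    by_cases hz : z ∈ Metric.ball (0 : ℂ) 1
    · exact eq_zero_of_hardyOrliczENorm Ψ f.2.1 h0 hz
    · exact f.2.2.1 z hz

instance : NormedAddCommGroup (HardyOrlicz Ψ) := addGroupNorm.toNormedAddCommGroup

theorem norm_def (f : HardyOrlicz Ψ) : ‖f‖ = (hardyOrliczENorm Ψ f).toReal := rfl

instance : NormedSpace ℂ (HardyOrlicz Ψ) where
  norm_smul_le c f := by
    rw [norm_def, norm_def, ← toReal_enorm, ← ENNReal.toReal_mul]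
    exact ENNReal.toReal_mono (ENNReal.mul_ne_top enorm_ne_top f.2.2.2.ne)
      (hardyOrliczENorm_smul_le Ψ c f)

/-- A bounded analytic function on the disc, as an element of `H^Ψ`. -/
def ofBounded (Ψ : OrliczFunction) (f : ℂ → ℂ) (hf : DifferentiableOn ℂ f (Metric.ball 0 1))
    (M : ℝ) (hM : ∀ z ∈ Metric.ball (0 : ℂ) 1, ‖f z‖ ≤ M) : HardyOrlicz Ψ :=
  ⟨(Metric.ball (0 : ℂ) 1).indicator f, hf.congr fun z hz => indicator_of_mem hz f,
    fun z hz => indicator_of_notMem hz f, by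
      have hb : hardyOrliczENorm Ψ ((Metric.ball (0 : ℂ) 1).indicator f) ≤
          ENNReal.ofReal M / Ψ.inv 1 := by
        refine iSup₂_le fun r hr => luxemburgNorm_le_of_bound Ψ (fun t => ?_) ENNReal.ofReal_ne_top
        have hmem : circleMap 0 r t ∈ Metric.ball (0 : ℂ) 1 := by
          simp [abs_of_nonneg hr.1, hr.2]
        rw [indicator_of_mem hmem, ← ofReal_norm]
        exact ENNReal.ofReal_le_ofReal (hM _ hmem)
      refine hb.trans_lt (ENNReal.div_lt_top ENNReal.ofReal_ne_top fun h => ?_)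
      have h1 := Ψ.eval_inv 1
      rw [h, Ψ.eval_zero] at h1
      exact zero_ne_one h1⟩

end HardyOrlicz

/-- `u_{a,r}(z) = ((1 - r) / (1 - \bar a r z))²`. -/
def uFun (a : Circle) (r : ℝ) (z : ℂ) : ℂ :=
  ((1 - r) / (1 - (starRingEnd ℂ) (a : ℂ) * r * z)) ^ 2

theorem uFun_denom {a : Circle} {r : ℝ} (hr : r ∈ Ico (0 : ℝ) 1) {z : ℂ}
    (hz : z ∈ Metric.ball (0 : ℂ) 1) : 1 - r ≤ ‖1 - (starRingEnd ℂ) (a : ℂ) * r * z‖ := by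
  have hz' : ‖z‖ ≤ 1 := by simpa using (mem_ball_zero_iff.1 hz).le
  have h1 : ‖(starRingEnd ℂ) (a : ℂ) * r * z‖ ≤ r := by
    simp only [norm_mul, RCLike.norm_conj, Circle.norm_coe, one_mul, Complex.norm_real,
      Real.norm_eq_abs, abs_of_nonneg hr.1]
    exact mul_le_of_le_one_right hr.1 hz'
  have h2 := norm_sub_norm_le (1 : ℂ) ((starRingEnd ℂ) (a : ℂ) * r * z)
  rw [norm_one] at h2
  linarith

open Classical in
/-- The function `u_{a,r}` as an element of `H^Ψ`, for `0 ≤ r < 1` (and `0` for other `r`). -/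
def uElem (Ψ : OrliczFunction) (a : Circle) (r : ℝ) : HardyOrlicz Ψ :=
  if hr : r ∈ Ico (0 : ℝ) 1 then
    HardyOrlicz.ofBounded Ψ (uFun a r)
      (by
        have hd : ∀ z ∈ Metric.ball (0 : ℂ) 1, 1 - (starRingEnd ℂ) (a : ℂ) * r * z ≠ 0 :=
          fun z hz h => by
            have h1 := uFun_denom (a := a) hr hz
            rw [h, norm_zero] at h1
            linarith [hr.2]
        exact DifferentiableOn.pow (DifferentiableOn.div (by fun_prop) (by fun_prop) hd) 2)
      1
      (by
        intro z hz
        have h1 := uFun_denom (a := a) hr hz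
        have h2 : ‖(1 - r : ℂ)‖ = 1 - r := by
          rw [← Complex.ofReal_one, ← Complex.ofReal_sub, Complex.norm_real, Real.norm_eq_abs,
            abs_of_pos (by linarith [hr.2])]
        rw [uFun, norm_pow, norm_div, h2]
        refine pow_le_one₀ (div_nonneg (by linarith [hr.2]) (norm_nonneg _)) ?_
        exact div_le_one_of_le₀ h1 (norm_nonneg _))
  else 0

/-- `T : H^Ψ → H^Ψ` is order bounded into `M^Ψ(𝕋)`: there is `g ∈ M^Ψ(𝕋)` such that `|T f| ≤ g`
a.e. on the circle for every `f` in the unit ball. -/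
def OrderBoundedIntoMorseTransue {Ψ : OrliczFunction} (T : HardyOrlicz Ψ →L[ℂ] HardyOrlicz Ψ) :
    Prop :=
  ∃ g : ℝ → ℝ, MemMorseTransue Ψ g ∧
    ∀ f : HardyOrlicz Ψ, ‖f‖ ≤ 1 → ∀ᵐ t ∂circleMeasure, ‖boundaryValue (T f) t‖ ≤ g t

/-- Weak compactness of an operator: the image of the unit ball is relatively weakly compact. -/
def IsWeaklyCompactOperator {E F : Type*} [NormedAddCommGroup E] [NormedSpace ℂ E]
    [NormedAddCommGroup F] [NormedSpace ℂ F] (T : E →L[ℂ] F) : Prop :=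
  IsCompact (closure (toWeakSpace ℂ F '' (T '' Metric.closedBall 0 1)))

end

/-!
Write `χ_B` for `x ↦ Ψ (B Ψ⁻¹ x)` and `R = 1 / (1 - |φ*|)`. Every assertion is compared with the
integrability of all the `χ_B ∘ R`.

By the Poisson integral and Jensen's inequality, a function of norm at most `1` is bounded at `z` by
a constant multiple of `Ψ⁻¹ (1 / (1 - |z|))`, and the functions `Ψ⁻¹ (1 / (1 - r)) u_{a,r}` attain
this growth up to a constant. This gives order boundedness, and its converse by letting `a` run
through a countable dense set; dominated convergence and Montel's theorem give compactness.

Conversely `Δ²` bounds `χ_B ^ 2` by `χ_{αB}`, so that Chebyshev bounds on the tails of `R` sum to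
integrability. Windows `|φ* - a| ≤ 2s`, of which `O(1 / s)` cover the tail, may be used in place of
the tail, since the loss `1 / s` is absorbed by the square. If the window estimate fails, a
sequence of fast-peaking bumps of nonnegative real part has bounded partial sums in `H^Ψ`, and each
bump, composed with `φ`, is large on a window. Under weak compactness the composed partial sums
cluster weakly at some `g`. By Mazur's theorem `g` lies in the norm closure of `H^∞`, hence has
finite modulars at every scale, while `Re g` dominates every composed bump: this contradicts the
size of the windows.
-/

noncomputable section

/-! ### Orlicz functions on `[0, ∞]` -/

namespace OrliczFunction

variable (Ψ : OrliczFunction)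

/-- `Ψ` as an order automorphism of `[0, ∞]`, with inverse `Ψ⁻¹`. -/
def evalOrderIso : ℝ≥0∞ ≃o ℝ≥0∞ where
  toFun := Ψ.eval
  invFun := Ψ.inv
  left_inv := Ψ.inv_eval
  right_inv := Ψ.eval_inv
  map_rel_iff' := Ψ.eval_strictMono.le_iff_le

theorem eval_mono : Monotone Ψ.eval := Ψ.eval_strictMono.monotone

theorem continuous_eval : Continuous Ψ.eval := Ψ.evalOrderIso.continuous

theorem measurable_eval : Measurable Ψ.eval := Ψ.eval_mono.measurable

theorem inv_strictMono : StrictMono Ψ.inv := Ψ.evalOrderIso.symm.strictMono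

theorem inv_mono : Monotone Ψ.inv := Ψ.inv_strictMono.monotone

theorem eval_le_iff_le_inv {x y : ℝ≥0∞} : Ψ.eval x ≤ y ↔ x ≤ Ψ.inv y :=
  Ψ.evalOrderIso.le_symm_apply.symm

theorem eval_top : Ψ.eval ⊤ = ⊤ := Ψ.evalOrderIso.map_top

theorem inv_zero : Ψ.inv 0 = 0 := Ψ.evalOrderIso.symm.map_bot

theorem inv_top : Ψ.inv ⊤ = ⊤ := Ψ.evalOrderIso.symm.map_top

theorem eval_ne_top {x : ℝ≥0∞} (hx : x ≠ ⊤) : Ψ.eval x ≠ ⊤ :=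
  Ψ.eval_top ▸ Ψ.eval_strictMono.injective.ne hx

theorem eval_ne_zero {x : ℝ≥0∞} (hx : x ≠ 0) : Ψ.eval x ≠ 0 :=
  Ψ.eval_zero ▸ Ψ.eval_strictMono.injective.ne hx

theorem inv_ne_top {x : ℝ≥0∞} (hx : x ≠ ⊤) : Ψ.inv x ≠ ⊤ :=
  Ψ.inv_top ▸ Ψ.inv_strictMono.injective.ne hx

theorem inv_ne_zero {x : ℝ≥0∞} (hx : x ≠ 0) : Ψ.inv x ≠ 0 :=
  Ψ.inv_zero ▸ Ψ.inv_strictMono.injective.ne hx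

theorem eval_ofReal {x : ℝ} (hx : 0 ≤ x) :
    Ψ.eval (ENNReal.ofReal x) = ENNReal.ofReal (Ψ.toFun x) := by
  simp [eval, ENNReal.toReal_ofReal hx]

theorem eval_mul_le {a : ℝ≥0∞} (ha : a ≤ 1) (x : ℝ≥0∞) : Ψ.eval (a * x) ≤ a * Ψ.eval x := by
  simpa [Ψ.eval_zero] using Ψ.eval_convex (x := x) (y := 0) (add_tsub_cancel_of_le ha)

theorem inv_mul_le {c : ℝ≥0∞} (hc : 1 ≤ c) (hc_top : c ≠ ⊤) (y : ℝ≥0∞) :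
    Ψ.inv (c * y) ≤ c * Ψ.inv y := by
  have hc0 : c ≠ 0 := (zero_lt_one.trans_le hc).ne'
  have h := Ψ.eval_mul_le (ENNReal.inv_le_one.2 hc) (c * Ψ.inv y)
  rw [ENNReal.inv_mul_cancel_left hc0 hc_top, Ψ.eval_inv] at h
  rw [← Ψ.eval_strictMono.le_iff_le, Ψ.eval_inv]
  calc c * y ≤ c * (c⁻¹ * Ψ.eval (c * Ψ.inv y)) := by gcongr
    _ = Ψ.eval (c * Ψ.inv y) := ENNReal.mul_inv_cancel_left hc0 hc_top

theorem eval_add_le (x y : ℝ≥0∞) : Ψ.eval (x + y) ≤ Ψ.eval (2 * x) + Ψ.eval (2 * y) := by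
  have h := Ψ.eval_convex (x := 2 * x) (y := 2 * y) ENNReal.inv_two_add_inv_two
  simp only [ENNReal.inv_mul_cancel_left two_ne_zero ENNReal.ofNat_ne_top] at h
  exact h.trans (add_le_add (mul_le_of_le_one_left' (by simp)) (mul_le_of_le_one_left' (by simp)))

theorem chi_mono (K : ℝ≥0∞) : Monotone (Ψ.chi K) := fun _ _ h =>
  Ψ.eval_mono (mul_le_mul_right (Ψ.inv_mono h) _)

theorem chi_mono_left (x : ℝ≥0∞) : Monotone fun K => Ψ.chi K x := fun _ _ h =>
  Ψ.eval_mono (mul_le_mul_left h _)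

theorem measurable_chi (K : ℝ≥0∞) : Measurable (Ψ.chi K) := (Ψ.chi_mono K).measurable

theorem chi_one (x : ℝ≥0∞) : Ψ.chi 1 x = x := by rw [chi, one_mul, Ψ.eval_inv]

theorem chi_ne_top {K x : ℝ≥0∞} (hK : K ≠ ⊤) (hx : x ≠ ⊤) : Ψ.chi K x ≠ ⊤ :=
  Ψ.eval_ne_top (ENNReal.mul_ne_top hK (Ψ.inv_ne_top hx))

theorem chi_ne_zero {K x : ℝ≥0∞} (hK : K ≠ 0) (hx : x ≠ 0) : Ψ.chi K x ≠ 0 :=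
  Ψ.eval_ne_zero (mul_ne_zero hK (Ψ.inv_ne_zero hx))

theorem chi_strictMono {K : ℝ≥0∞} (hK : K ≠ 0) (hK_top : K ≠ ⊤) : StrictMono (Ψ.chi K) :=
  fun _ _ h => Ψ.eval_strictMono ((ENNReal.mul_lt_mul_iff_right hK hK_top).2 (Ψ.inv_strictMono h))

theorem chi_surjective {K : ℝ≥0∞} (hK : K ≠ 0) (hK_top : K ≠ ⊤) :
    Function.Surjective (Ψ.chi K) := fun y =>
  ⟨Ψ.eval (K⁻¹ * Ψ.inv y), by
    rw [chi, Ψ.inv_eval, ENNReal.mul_inv_cancel_left hK hK_top, Ψ.eval_inv]⟩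

variable {Ψ}

theorem SatisfiesDelta2.exists_eval_sq_le (hΨ : Ψ.SatisfiesDelta2) :
    ∃ α : ℝ≥0, 1 < α ∧ ∃ x₀ : ℝ≥0, ∀ x : ℝ≥0∞, x₀ ≤ x → Ψ.eval x ^ 2 ≤ Ψ.eval (α * x) := by
  obtain ⟨α, hα, h⟩ := hΨ
  obtain ⟨x₀, hx₀⟩ := eventually_atTop.1 h
  lift α to ℝ≥0 using zero_le_one.trans hα.le
  have hα1 : 1 < α := by exact_mod_cast hα
  refine ⟨α, hα1, x₀.toNNReal, fun x hx => ?_⟩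
  induction x with
  | top =>
    rw [ENNReal.mul_top (by exact_mod_cast (zero_lt_one.trans hα1).ne'), Ψ.eval_top]
    exact le_top
  | coe x =>
    have hx' : x₀ ≤ x := Real.toNNReal_le_iff_le_coe.1 (by exact_mod_cast hx)
    rw [← ENNReal.coe_mul, ← ENNReal.ofReal_coe_nnreal, ← ENNReal.ofReal_coe_nnreal,
      Ψ.eval_ofReal x.coe_nonneg, Ψ.eval_ofReal (α * x).coe_nonneg,
      ← ENNReal.ofReal_pow (Ψ.nonneg x.coe_nonneg)]
    exact ENNReal.ofReal_le_ofReal (hx₀ x hx')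

theorem SatisfiesDelta2.exists_chi_sq_le (hΨ : Ψ.SatisfiesDelta2) :
    ∃ α : ℝ≥0, 1 < α ∧ ∀ A : ℝ≥0, A ≠ 0 →
      ∃ x₀ : ℝ≥0∞, x₀ ≠ ⊤ ∧ ∀ x, x₀ ≤ x → Ψ.chi A x ^ 2 ≤ Ψ.chi (α * A : ℝ≥0) x := by
  obtain ⟨α, hα, x₀, h⟩ := hΨ.exists_eval_sq_le
  refine ⟨α, hα, fun A hA => ?_⟩
  have hA0 : (A : ℝ≥0∞) ≠ 0 := ENNReal.coe_ne_zero.2 hA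
  refine ⟨Ψ.eval ((A : ℝ≥0∞)⁻¹ * x₀), Ψ.eval_ne_top (ENNReal.mul_ne_top
    (ENNReal.inv_ne_top.2 hA0) ENNReal.coe_ne_top), fun x hx => ?_⟩
  rw [chi, chi, ENNReal.coe_mul, mul_assoc]
  refine h _ ?_
  calc (x₀ : ℝ≥0∞) = A * ((A : ℝ≥0∞)⁻¹ * x₀) :=
        (ENNReal.mul_inv_cancel_left hA0 ENNReal.coe_ne_top).symm
    _ ≤ A * Ψ.inv x := by gcongr; exact Ψ.eval_le_iff_le_inv.1 hx

end OrliczFunction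

/-! ### Modulars -/

namespace OrliczFunction

variable {Ω ι ε : Type*} [MeasurableSpace Ω] {μ : Measure Ω} (Ψ : OrliczFunction)

section Jensen

variable [IsProbabilityMeasure μ] {g : Ω → ℝ≥0∞}

theorem eval_lintegral_le_of_le_const (hg : AEMeasurable g μ) {M : ℝ≥0} (hM : ∀ x, g x ≤ M) :
    Ψ.eval (∫⁻ x, g x ∂μ) ≤ ∫⁻ x, Ψ.eval (g x) ∂μ := by
  have hg_top : ∀ x, g x ≠ ⊤ := fun x => ne_top_of_le_ne_top ENNReal.coe_ne_top (hM x)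
  have hint : ∀ {f : Ω → ℝ≥0∞} {N : ℝ≥0∞}, AEMeasurable f μ → N ≠ ⊤ → (∀ x, f x ≤ N) →
      Integrable (fun x => (f x).toReal) μ := fun hf hN h =>
    integrable_toReal_of_lintegral_ne_top hf <| ne_top_of_le_ne_top hN <|
      (lintegral_mono h).trans (by simp)
  have hΨg : ∀ x, Ψ.toFun (g x).toReal = (Ψ.eval (g x)).toReal := fun x => by
    simp [eval, hg_top x, ENNReal.toReal_ofReal (Ψ.nonneg ENNReal.toReal_nonneg)]
  have hΨint : Integrable (fun x => Ψ.toFun (g x).toReal) μ := by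
    simp only [hΨg]
    exact hint (Ψ.measurable_eval.comp_aemeasurable hg) (Ψ.eval_ne_top ENNReal.coe_ne_top)
      fun x => Ψ.eval_mono (hM x)
  have hgint := hint hg ENNReal.coe_ne_top hM
  have hjensen := Ψ.strictConvexOn.convexOn.map_integral_le Ψ.continuousOn isClosed_Ici
    (ae_of_all μ fun _ => mem_Ici.2 ENNReal.toReal_nonneg) hgint hΨint
  calc Ψ.eval (∫⁻ x, g x ∂μ) = Ψ.eval (ENNReal.ofReal (∫ x, (g x).toReal ∂μ)) := by
        rw [ofReal_integral_eq_lintegral_ofReal hgint (ae_of_all _ fun _ => ENNReal.toReal_nonneg)]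
        simp only [ENNReal.ofReal_toReal (hg_top _)]
    _ = ENNReal.ofReal (Ψ.toFun (∫ x, (g x).toReal ∂μ)) :=
        Ψ.eval_ofReal (integral_nonneg fun _ => ENNReal.toReal_nonneg)
    _ ≤ ENNReal.ofReal (∫ x, Ψ.toFun (g x).toReal ∂μ) := ENNReal.ofReal_le_ofReal hjensen
    _ = ∫⁻ x, Ψ.eval (g x) ∂μ := by
        rw [ofReal_integral_eq_lintegral_ofReal hΨint
          (ae_of_all _ fun _ => Ψ.nonneg ENNReal.toReal_nonneg)]
        simp only [hΨg, ENNReal.ofReal_toReal (Ψ.eval_ne_top (hg_top _))]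

theorem eval_lintegral_le (hg : AEMeasurable g μ) :
    Ψ.eval (∫⁻ x, g x ∂μ) ≤ ∫⁻ x, Ψ.eval (g x) ∂μ := by
  have hlim : Tendsto (fun n : ℕ => ∫⁻ x, min (g x) n ∂μ) atTop (𝓝 (∫⁻ x, g x ∂μ)) := by
    refine lintegral_tendsto_of_tendsto_of_monotone (fun n => hg.min aemeasurable_const)
      (ae_of_all _ fun x m n hmn => min_le_min_left _ (by exact_mod_cast hmn))
      (ae_of_all _ fun x => ?_)
    simpa using tendsto_const_nhds.min ENNReal.tendsto_nat_nhds_top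
  refine le_of_tendsto ((Ψ.continuous_eval.tendsto _).comp hlim) (Eventually.of_forall fun n => ?_)
  exact (Ψ.eval_lintegral_le_of_le_const (hg.min aemeasurable_const) (M := n)
    fun x => min_le_right _ _).trans (lintegral_mono fun x => Ψ.eval_mono (min_le_left _ _))

end Jensen

/-- The modular `∫ Ψ(|f| / C) dμ`, from which the Luxemburg norm is built. -/
def modular [ENorm ε] (μ : Measure Ω) (C : ℝ≥0∞) (f : Ω → ε) : ℝ≥0∞ :=
  ∫⁻ x, Ψ.eval (‖f x‖ₑ / C) ∂μ

theorem modular_le_of_tendsto [TopologicalSpace ε] [ContinuousENorm ε] {u : Filter ι} [u.NeBot]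
    [u.IsCountablyGenerated] {f : ι → Ω → ε} {g : Ω → ε} {C K : ℝ≥0∞} (hC : C ≠ 0)
    (hf : ∀ᶠ i in u, AEStronglyMeasurable (f i) μ)
    (hlim : ∀ᵐ x ∂μ, Tendsto (fun i => f i x) u (𝓝 (g x)))
    (hK : ∀ᶠ i in u, Ψ.modular μ C (f i) ≤ K) : Ψ.modular μ C g ≤ K := by
  obtain ⟨ns, hns, hns'⟩ := exists_seq_forall_of_frequently (hf.and hK).frequently
  have hcont : Continuous fun x : ε => Ψ.eval (‖x‖ₑ / C) :=
    Ψ.continuous_eval.comp ((ENNReal.continuous_div_const C hC).comp continuous_enorm)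
  calc Ψ.modular μ C g = ∫⁻ x, liminf (fun n => Ψ.eval (‖f (ns n) x‖ₑ / C)) atTop ∂μ :=
        lintegral_congr_ae (hlim.mono fun x hx =>
          ((hcont.tendsto _).comp (hx.comp hns)).liminf_eq.symm)
    _ ≤ liminf (fun n => Ψ.modular μ C (f (ns n))) atTop :=
        lintegral_liminf_le' fun n =>
          Ψ.measurable_eval.comp_aemeasurable ((hns' n).1.enorm.div_const C)
    _ ≤ K := liminf_le_of_frequently_le' (Frequently.of_forall fun n => (hns' n).2)

end OrliczFunction

section Luxemburg

variable {Ψ : OrliczFunction} {ε : Type*} [ENorm ε] {f : ℝ → ε} {C : ℝ≥0∞}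

theorem modular_le_one_of_luxemburgNorm_lt (h : luxemburgNorm Ψ f < C) :
    Ψ.modular circleMeasure C f ≤ 1 := by
  obtain ⟨D, ⟨-, hD⟩, hDC⟩ := sInf_lt_iff.1 h
  exact (lintegral_mono fun t => Ψ.eval_mono (ENNReal.div_le_div_left hDC.le _)).trans hD

theorem luxemburgNorm_le_of_modular_le {K : ℝ≥0∞} (hC : C ≠ 0) (hK : 1 ≤ K) (hK_top : K ≠ ⊤)
    (h : Ψ.modular circleMeasure C f ≤ K) : luxemburgNorm Ψ f ≤ K * C := by
  have hK0 : K ≠ 0 := (zero_lt_one.trans_le hK).ne'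
  refine sInf_le ⟨pos_iff_ne_zero.2 (mul_ne_zero hK0 hC), ?_⟩
  calc ∫⁻ t, Ψ.eval (‖f t‖ₑ / (K * C)) ∂circleMeasure
      ≤ ∫⁻ t, K⁻¹ * Ψ.eval (‖f t‖ₑ / C) ∂circleMeasure := by
        refine lintegral_mono fun t => ?_
        convert Ψ.eval_mul_le (ENNReal.inv_le_one.2 hK) (‖f t‖ₑ / C) using 2
        rw [div_eq_mul_inv, div_eq_mul_inv, ENNReal.mul_inv (Or.inl hK0) (Or.inl hK_top)]
        ring
    _ = K⁻¹ * Ψ.modular circleMeasure C f :=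
        lintegral_const_mul' _ _ (ENNReal.inv_ne_top.2 hK0)
    _ ≤ K⁻¹ * K := by gcongr
    _ = 1 := ENNReal.inv_mul_cancel hK0 hK_top

end Luxemburg

/-! ### The Poisson kernel -/

theorem integral_circleMeasure {E : Type*} [NormedAddCommGroup E] [NormedSpace ℝ E] (g : ℝ → E) :
    ∫ t, g t ∂circleMeasure = (2 * Real.pi)⁻¹ • ∫ t in (0)..(2 * Real.pi), g t := by
  rw [circleMeasure, integral_smul_measure, intervalIntegral.integral_of_le Real.two_pi_pos.le,
    ENNReal.toReal_inv, ENNReal.toReal_ofReal Real.two_pi_pos.le]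

theorem ae_circleMeasure_of_ae {p : ℝ → Prop} (h : ∀ᵐ t, p t) : ∀ᵐ t ∂circleMeasure, p t :=
  Measure.ae_smul_measure (ae_restrict_of_ae h) _

theorem integrable_circleMeasure_of_continuous {E : Type*} [NormedAddCommGroup E] {g : ℝ → E}
    (hg : Continuous g) : Integrable g circleMeasure := by
  rw [circleMeasure]
  refine Integrable.smul_measure ?_ (by simp [Real.pi_pos])
  exact (hg.integrableOn_Icc (a := 0) (b := 2 * Real.pi)).mono_set Ioc_subset_Icc_self

theorem circleMap_mem_unitBall {r : ℝ} (hr : r ∈ Ico (0 : ℝ) 1) (t : ℝ) :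
    circleMap 0 r t ∈ Metric.ball (0 : ℂ) 1 := by
  simp [abs_of_nonneg hr.1, hr.2]

theorem mul_circleMap_one (R t : ℝ) : (R : ℂ) * circleMap 0 1 t = circleMap 0 R t := by
  simp [circleMap]

/-- The Poisson kernel of the unit disc, as a function of the angle on the circle. -/
def discPoisson (z : ℂ) (t : ℝ) : ℝ := poissonKernel 0 z (circleMap 0 1 t)

section DiscPoisson

variable {z : ℂ}

theorem discPoisson_eq (z : ℂ) (t : ℝ) :
    discPoisson z t = (1 - ‖z‖ ^ 2) / ‖circleMap 0 1 t - z‖ ^ 2 := by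
  simp [discPoisson, poissonKernel_def]

theorem discPoisson_eq_re (z : ℂ) (t : ℝ) :
    discPoisson z t = ((circleMap 0 1 t + z) / (circleMap 0 1 t - z)).re := by
  rw [discPoisson, poissonKernel_eq_re_herglotzRieszKernel]
  simp [herglotzRieszKernel_def]

theorem one_sub_norm_le_norm_circleMap_sub (z : ℂ) (t : ℝ) :
    1 - ‖z‖ ≤ ‖circleMap 0 1 t - z‖ := by
  simpa using norm_sub_norm_le (circleMap 0 1 t) z

theorem circleMap_sub_ne_zero (hz : z ∈ Metric.ball (0 : ℂ) 1) (t : ℝ) :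
    circleMap 0 1 t - z ≠ 0 :=
  norm_pos_iff.1 ((sub_pos.2 (mem_ball_zero_iff.1 hz)).trans_le
    (one_sub_norm_le_norm_circleMap_sub z t))

theorem discPoisson_nonneg (hz : z ∈ Metric.ball (0 : ℂ) 1) (t : ℝ) : 0 ≤ discPoisson z t := by
  rw [discPoisson_eq]
  have hz1 : ‖z‖ ^ 2 ≤ 1 := pow_le_one₀ (norm_nonneg z) (mem_ball_zero_iff.1 hz).le
  exact div_nonneg (sub_nonneg.2 hz1) (by positivity)

theorem discPoisson_le (hz : z ∈ Metric.ball (0 : ℂ) 1) (t : ℝ) :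
    discPoisson z t ≤ (1 + ‖z‖) / (1 - ‖z‖) := by
  have h := re_herglotzRieszKernel_le (R := 1) (c := 0) (z := circleMap 0 1 t) (by simp) hz
  simp only [sub_zero] at h
  rw [discPoisson, poissonKernel_eq_re_herglotzRieszKernel]
  simpa [herglotzRieszKernel_def] using h

theorem continuous_uncurry_discPoisson {X : Type*} [TopologicalSpace X] {q : X → ℂ}
    (hq : Continuous q) (hmaps : ∀ x, q x ∈ Metric.ball (0 : ℂ) 1) :
    Continuous fun p : X × ℝ => discPoisson (q p.1) p.2 := by
  simp_rw [discPoisson_eq]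
  exact (by fun_prop : Continuous fun p : X × ℝ => 1 - ‖q p.1‖ ^ 2).div
    ((((continuous_circleMap 0 1).comp continuous_snd).sub
      (hq.comp continuous_fst)).norm.pow 2) fun p =>
    pow_ne_zero _ (norm_ne_zero_iff.2 (circleMap_sub_ne_zero (hmaps _) _))

theorem continuous_discPoisson (hz : z ∈ Metric.ball (0 : ℂ) 1) : Continuous (discPoisson z) := by
  have h := continuous_uncurry_discPoisson (X := Unit) continuous_const fun _ => hz
  exact h.comp₂ (e := fun _ => ()) continuous_const continuous_id

theorem integral_discPoisson_smul {f : ℂ → ℂ} (hf : DiffContOnCl ℂ f (Metric.ball 0 1))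
    (hz : z ∈ Metric.ball (0 : ℂ) 1) :
    ∫ t, discPoisson z t • f (circleMap 0 1 t) ∂circleMeasure = f z := by
  rw [integral_circleMeasure, ← hf.circleAverage_poissonKernel_smul hz, Real.circleAverage_def]
  rfl

theorem integral_discPoisson (hz : z ∈ Metric.ball (0 : ℂ) 1) :
    ∫ t, discPoisson z t ∂circleMeasure = 1 := by
  have h := integral_discPoisson_smul (f := fun _ => 1) diffContOnCl_const hz
  simp only [Complex.real_smul, mul_one] at h
  rw [integral_complex_ofReal] at h
  exact_mod_cast h

theorem lintegral_discPoisson (hz : z ∈ Metric.ball (0 : ℂ) 1) :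
    ∫⁻ t, ENNReal.ofReal (discPoisson z t) ∂circleMeasure = 1 := by
  rw [← ofReal_integral_eq_lintegral_ofReal
    (integrable_circleMeasure_of_continuous (continuous_discPoisson hz))
    (ae_of_all _ (discPoisson_nonneg hz)), integral_discPoisson hz, ENNReal.ofReal_one]

theorem diffContOnCl_comp_mul {f : ℂ → ℂ} (hf : DifferentiableOn ℂ f (Metric.ball 0 1)) {R : ℝ}
    (hR : R ∈ Ico (0 : ℝ) 1) : DiffContOnCl ℂ (fun w => f (R * w)) (Metric.ball 0 1) := by
  refine DifferentiableOn.diffContOnCl (hf.comp (by fun_prop) fun w hw => ?_)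
  rw [closure_ball _ one_ne_zero, mem_closedBall_zero_iff] at hw
  simp only [mem_ball_zero_iff, norm_mul, Complex.norm_real, Real.norm_eq_abs, abs_of_nonneg hR.1]
  exact (mul_le_of_le_one_right hR.1 hw).trans_lt hR.2

theorem integral_discPoisson_smul_slice {f : ℂ → ℂ}
    (hf : DifferentiableOn ℂ f (Metric.ball 0 1)) {R : ℝ} (hR : R ∈ Ico (0 : ℝ) 1)
    (hz : z ∈ Metric.ball (0 : ℂ) 1) :
    ∫ t, discPoisson z t • f (circleMap 0 R t) ∂circleMeasure = f (R * z) := by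
  rw [← integral_discPoisson_smul (diffContOnCl_comp_mul hf hR) hz]
  simp_rw [mul_circleMap_one]

theorem integral_slice {f : ℂ → ℂ} (hf : DifferentiableOn ℂ f (Metric.ball 0 1)) {r : ℝ}
    (hr : r ∈ Ico (0 : ℝ) 1) : ∫ s, f (circleMap 0 r s) ∂circleMeasure = f 0 := by
  have h := integral_discPoisson_smul_slice hf hr (Metric.mem_ball_self one_pos)
  simpa [discPoisson_eq] using h

theorem integral_discPoisson_comp {q : ℂ → ℂ} (hq : DifferentiableOn ℂ q (Metric.ball 0 1))
    (hmaps : MapsTo q (Metric.ball 0 1) (Metric.ball 0 1)) {r : ℝ} (hr : r ∈ Ico (0 : ℝ) 1)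
    (t : ℝ) :
    ∫ s, discPoisson (q (circleMap 0 r s)) t ∂circleMeasure = discPoisson (q 0) t := by
  have hd : DifferentiableOn ℂ (fun w => (circleMap 0 1 t + q w) / (circleMap 0 1 t - q w))
      (Metric.ball 0 1) :=
    ((differentiableOn_const _).add hq).div ((differentiableOn_const _).sub hq)
      fun w hw => circleMap_sub_ne_zero (hmaps hw) t
  simp_rw [discPoisson_eq_re]
  rw [← integral_slice hd hr]
  exact integral_re (𝕜 := ℂ)
    (integrable_circleMeasure_of_continuous (continuous_circle_slice hd hr))

end DiscPoisson

namespace OrliczFunction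

variable (Ψ : OrliczFunction)

theorem eval_enorm_integral_discPoisson_le {E : Type*} [NormedAddCommGroup E] [NormedSpace ℝ E]
    {z : ℂ} (hz : z ∈ Metric.ball (0 : ℂ) 1) {k : ℝ → E}
    (hk : AEStronglyMeasurable k circleMeasure) (C : ℝ≥0∞) :
    Ψ.eval (‖∫ t, discPoisson z t • k t ∂circleMeasure‖ₑ / C) ≤
      ∫⁻ t, ENNReal.ofReal (discPoisson z t) * Ψ.eval (‖k t‖ₑ / C) ∂circleMeasure := by
  have hP : AEMeasurable (fun t => ENNReal.ofReal (discPoisson z t)) circleMeasure :=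
    (continuous_discPoisson hz).measurable.ennreal_ofReal.aemeasurable
  have hkC : AEMeasurable (fun t => ‖k t‖ₑ / C) circleMeasure := hk.enorm.div_const C
  let ν := circleMeasure.withDensity fun t => ENNReal.ofReal (discPoisson z t)
  have : IsProbabilityMeasure ν :=
    ⟨by simp [ν, withDensity_apply _ MeasurableSet.univ, lintegral_discPoisson hz]⟩
  have hnorm : ‖∫ t, discPoisson z t • k t ∂circleMeasure‖ₑ / C ≤ ∫⁻ t, ‖k t‖ₑ / C ∂ν := by
    calc ‖∫ t, discPoisson z t • k t ∂circleMeasure‖ₑ / C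
        ≤ (∫⁻ t, ENNReal.ofReal (discPoisson z t) * ‖k t‖ₑ ∂circleMeasure) / C := by
          refine ENNReal.div_le_div_right ((enorm_integral_le_lintegral_enorm _).trans_eq
            (lintegral_congr fun t => ?_)) _
          rw [enorm_smul, Real.enorm_of_nonneg (discPoisson_nonneg hz t)]
      _ = ∫⁻ t, ‖k t‖ₑ / C ∂ν := by
          rw [lintegral_withDensity_eq_lintegral_mul₀ hP hkC, div_eq_mul_inv,
            ← lintegral_mul_const'' (f := fun t => _ * _) _ (hP.mul hk.enorm)]
          simp only [Pi.mul_apply, mul_assoc, div_eq_mul_inv]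
  calc Ψ.eval (‖∫ t, discPoisson z t • k t ∂circleMeasure‖ₑ / C)
      ≤ ∫⁻ t, Ψ.eval (‖k t‖ₑ / C) ∂ν :=
        (Ψ.eval_mono hnorm).trans
          (Ψ.eval_lintegral_le (hkC.mono_ac (withDensity_absolutelyContinuous _ _)))
    _ = _ := lintegral_withDensity_eq_lintegral_mul₀ hP (Ψ.measurable_eval.comp_aemeasurable hkC)

/-- The harmonic-majorant form of Littlewood's subordination principle: `h ∘ q` is dominated by
the boundary data `k` of `h`, as `q` pushes the Poisson kernel at `0` to the one at `q 0`. -/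
theorem modular_comp_slice_le {h q : ℂ → ℂ} {k : ℝ → ℂ}
    (hk : AEStronglyMeasurable k circleMeasure)
    (hrep : ∀ z ∈ Metric.ball (0 : ℂ) 1, ∫ t, discPoisson z t • k t ∂circleMeasure = h z)
    (hq : DifferentiableOn ℂ q (Metric.ball 0 1))
    (hmaps : MapsTo q (Metric.ball 0 1) (Metric.ball 0 1)) {r : ℝ} (hr : r ∈ Ico (0 : ℝ) 1)
    (C : ℝ≥0∞) :
    Ψ.modular circleMeasure C (fun s => h (q (circleMap 0 r s))) ≤
      ENNReal.ofReal ((1 + ‖q 0‖) / (1 - ‖q 0‖)) * Ψ.modular circleMeasure C k := by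
  have hqb : ∀ s, q (circleMap 0 r s) ∈ Metric.ball (0 : ℂ) 1 :=
    fun s => hmaps (circleMap_mem_unitBall hr s)
  have hcont := continuous_uncurry_discPoisson (continuous_circle_slice hq hr) hqb
  have hmeas : AEMeasurable (fun t => Ψ.eval (‖k t‖ₑ / C)) circleMeasure :=
    Ψ.measurable_eval.comp_aemeasurable (hk.enorm.div_const C)
  calc Ψ.modular circleMeasure C (fun s => h (q (circleMap 0 r s)))
      ≤ ∫⁻ s, ∫⁻ t, ENNReal.ofReal (discPoisson (q (circleMap 0 r s)) t) *
          Ψ.eval (‖k t‖ₑ / C) ∂circleMeasure ∂circleMeasure := by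
        refine lintegral_mono fun s => ?_
        dsimp only
        rw [← hrep _ (hqb s)]
        exact Ψ.eval_enorm_integral_discPoisson_le (hqb s) hk C
    _ = ∫⁻ t, ∫⁻ s, ENNReal.ofReal (discPoisson (q (circleMap 0 r s)) t) *
          Ψ.eval (‖k t‖ₑ / C) ∂circleMeasure ∂circleMeasure :=
        lintegral_lintegral_swap (hcont.measurable.ennreal_ofReal.aemeasurable.mul hmeas.comp_snd)
    _ = ∫⁻ t, ENNReal.ofReal (discPoisson (q 0) t) * Ψ.eval (‖k t‖ₑ / C) ∂circleMeasure := by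
        refine lintegral_congr fun t => ?_
        have hct : Continuous fun s => discPoisson (q (circleMap 0 r s)) t :=
          hcont.comp₂ continuous_id continuous_const
        rw [lintegral_mul_const _ hct.measurable.ennreal_ofReal,
          ← ofReal_integral_eq_lintegral_ofReal (integrable_circleMeasure_of_continuous hct)
            (ae_of_all _ fun s => discPoisson_nonneg (hqb s) t),
          integral_discPoisson_comp hq hmaps hr]
    _ ≤ ∫⁻ t, ENNReal.ofReal ((1 + ‖q 0‖) / (1 - ‖q 0‖)) *
          Ψ.eval (‖k t‖ₑ / C) ∂circleMeasure := by
        refine lintegral_mono fun t => ?_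
        gcongr
        exact discPoisson_le (hmaps (Metric.mem_ball_self one_pos)) t
    _ = _ := lintegral_const_mul' _ _ ENNReal.ofReal_ne_top

end OrliczFunction

/-! ### Fatou's theorem -/

/-- The Poisson kernel `P_r(s)` of the unit disc in polar coordinates. -/
def polarPoisson (r s : ℝ) : ℝ := (1 - r ^ 2) / (1 - 2 * r * Real.cos s + r ^ 2)

/-- The derivative `P_r'(s)` of the Poisson kernel in the angle. -/
def polarPoissonDeriv (r s : ℝ) : ℝ :=
  -(2 * r * Real.sin s * (1 - r ^ 2)) / (1 - 2 * r * Real.cos s + r ^ 2) ^ 2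

section PolarPoisson

variable {r : ℝ}

theorem polarPoisson_denom_pos (hr : r ∈ Ico (0 : ℝ) 1) (s : ℝ) :
    0 < 1 - 2 * r * Real.cos s + r ^ 2 := by
  have h : 2 * r * Real.cos s ≤ 2 * r :=
    mul_le_of_le_one_right (by linarith [hr.1]) (Real.cos_le_one s)
  nlinarith [hr.2]

theorem hasDerivAt_polarPoisson (hr : r ∈ Ico (0 : ℝ) 1) (s : ℝ) :
    HasDerivAt (polarPoisson r) (polarPoissonDeriv r s) s := by
  have hdenom : HasDerivAt (fun s => 1 - 2 * r * Real.cos s + r ^ 2) (2 * r * Real.sin s) s :=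
    ((((Real.hasDerivAt_cos s).const_mul (2 * r)).const_sub 1).add_const (r ^ 2)).congr_deriv
      (by ring)
  exact ((hasDerivAt_const s (1 - r ^ 2)).div hdenom (polarPoisson_denom_pos hr s).ne').congr_deriv
    (by rw [polarPoissonDeriv]; ring)

theorem continuous_polarPoissonDeriv (hr : r ∈ Ico (0 : ℝ) 1) :
    Continuous (polarPoissonDeriv r) := by
  unfold polarPoissonDeriv
  exact Continuous.div (by fun_prop) (by fun_prop)
    fun s => pow_ne_zero _ (polarPoisson_denom_pos hr s).ne'

theorem discPoisson_circleMap (r θ s : ℝ) :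
    discPoisson (circleMap 0 r θ) (θ + s) = polarPoisson r s := by
  have hrot : circleMap 0 1 (θ + s) - circleMap 0 r θ =
      circleMap 0 1 θ * (Complex.exp (s * Complex.I) - r) := by
    simp only [circleMap, Complex.ofReal_add, add_mul, Complex.exp_add]
    push_cast
    ring
  have hnorm : ‖circleMap 0 1 (θ + s) - circleMap 0 r θ‖ ^ 2 =
      1 - 2 * r * Real.cos s + r ^ 2 := by
    rw [hrot, norm_mul, norm_circleMap_zero, abs_one, one_mul, ← Complex.normSq_eq_norm_sq,
      Complex.normSq_apply]
    simp only [Complex.sub_re, Complex.exp_ofReal_mul_I_re, Complex.ofReal_re, Complex.sub_im,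
      Complex.exp_ofReal_mul_I_im, Complex.ofReal_im, sub_zero]
    linear_combination Real.sin_sq_add_cos_sq s
  rw [discPoisson_eq, hnorm, polarPoisson]
  simp

theorem integral_polarPoisson_mul_slice {f : ℂ → ℂ} (hf : DifferentiableOn ℂ f (Metric.ball 0 1))
    (hr : r ∈ Ico (0 : ℝ) 1) (θ : ℝ) {R : ℝ} (hR : R ∈ Ico (0 : ℝ) 1) :
    ∫ s in (-Real.pi)..Real.pi, (polarPoisson r s : ℂ) * f (circleMap 0 R (θ + s)) =
      2 * Real.pi * f (R * circleMap 0 r θ) := by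
  let g : ℝ → ℂ := fun t => discPoisson (circleMap 0 r θ) t • f (circleMap 0 R t)
  have hper : Function.Periodic g (2 * Real.pi) := fun t => by
    simp only [g, discPoisson, periodic_circleMap 0 1 t, periodic_circleMap 0 R t]
  have hg : ∫ t in (0)..(2 * Real.pi), g t = 2 * Real.pi * f (R * circleMap 0 r θ) := by
    rw [← integral_discPoisson_smul_slice hf hR (circleMap_mem_unitBall hr θ),
      integral_circleMeasure, Complex.real_smul, Complex.ofReal_inv, Complex.ofReal_mul,
      Complex.ofReal_ofNat, mul_inv_cancel_left₀ (by exact_mod_cast Real.two_pi_pos.ne')]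
  calc ∫ s in (-Real.pi)..Real.pi, (polarPoisson r s : ℂ) * f (circleMap 0 R (θ + s))
      = ∫ s in (-Real.pi)..Real.pi, g (θ + s) := by
        simp only [g, discPoisson_circleMap, Complex.real_smul]
    _ = ∫ t in (θ + -Real.pi)..(θ + -Real.pi + 2 * Real.pi), g t := by
        rw [intervalIntegral.integral_comp_add_left]
        ring_nf
    _ = ∫ t in (0)..(2 * Real.pi), g t := by
        simpa only [zero_add] using hper.intervalIntegral_add_eq (θ + -Real.pi) 0
    _ = _ := hg

theorem polarPoissonDeriv_mul_sin_nonpos (hr : r ∈ Ico (0 : ℝ) 1) (s : ℝ) :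
    polarPoissonDeriv r s * Real.sin s ≤ 0 := by
  rw [polarPoissonDeriv, div_mul_eq_mul_div]
  refine div_nonpos_of_nonpos_of_nonneg ?_ (by positivity)
  have h : 0 ≤ r * (1 - r ^ 2) := mul_nonneg hr.1 (by nlinarith [hr.1, hr.2])
  nlinarith [mul_nonneg h (sq_nonneg (Real.sin s))]

theorem abs_polarPoissonDeriv_le (hr : r ∈ Ico (1 / 2 : ℝ) 1) {s κ : ℝ} (hκ : 0 < κ)
    (hs : κ ≤ 1 - Real.cos s) : |polarPoissonDeriv r s| ≤ 4 * (1 - r) / κ ^ 2 := by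
  have hdenom : κ ≤ 1 - 2 * r * Real.cos s + r ^ 2 := by
    nlinarith [hr.1, hr.2, sq_nonneg (1 - r)]
  have hnum : |-(2 * r * Real.sin s * (1 - r ^ 2))| ≤ 4 * (1 - r) := by
    rw [abs_neg, abs_mul, abs_mul, abs_of_nonneg (by linarith [hr.1] : 0 ≤ 2 * r),
      abs_of_nonneg (by nlinarith [hr.1, hr.2] : 0 ≤ 1 - r ^ 2)]
    have hsin : 2 * r * |Real.sin s| ≤ 2 * 1 := by
      nlinarith [hr.1, hr.2, Real.abs_sin_le_one s, abs_nonneg (Real.sin s)]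
    calc _ ≤ 2 * 1 * (2 * (1 - r)) :=
          mul_le_mul hsin (by nlinarith [hr.1, hr.2]) (by nlinarith [hr.1, hr.2]) (by norm_num)
      _ = _ := by ring
  rw [polarPoissonDeriv, abs_div, abs_of_nonneg (by positivity :
    0 ≤ (1 - 2 * r * Real.cos s + r ^ 2) ^ 2)]
  exact div_le_div₀ (by linarith [hr.2]) hnum (by positivity) (by gcongr)

end PolarPoisson

section RadialLimit

variable {F φ : ℂ → ℂ}

theorem integral_polarPoissonDeriv_mul_slice
    (hF : ∀ z ∈ Metric.ball (0 : ℂ) 1, HasDerivAt F (φ z) z)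
    (hφ : DifferentiableOn ℂ φ (Metric.ball 0 1)) {r : ℝ} (hr : r ∈ Ico (0 : ℝ) 1) (θ : ℝ)
    {R : ℝ} (hR : R ∈ Ico (0 : ℝ) 1) :
    ∫ s in (-Real.pi)..Real.pi, (polarPoissonDeriv r s : ℂ) * F (circleMap 0 R (θ + s)) =
      -(2 * Real.pi * Complex.I) * (R * circleMap 0 r θ * φ (R * circleMap 0 r θ)) := by
  let ψ : ℂ → ℂ := fun w => w * φ w
  have hψ : DifferentiableOn ℂ ψ (Metric.ball 0 1) := differentiableOn_id.mul hφ
  have hP : ∀ s ∈ uIcc (-Real.pi) Real.pi,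
      HasDerivAt (fun s => (polarPoisson r s : ℂ)) (polarPoissonDeriv r s : ℂ) s :=
    fun s _ => (hasDerivAt_polarPoisson hr s).ofReal_comp
  have hFs : ∀ s ∈ uIcc (-Real.pi) Real.pi, HasDerivAt (fun s => F (circleMap 0 R (θ + s)))
      (Complex.I * ψ (circleMap 0 R (θ + s))) s := fun s _ =>
    ((hF _ (circleMap_mem_unitBall hR (θ + s))).comp s
      ((hasDerivAt_circleMap 0 R (θ + s)).comp_const_add θ s)).congr_deriv (by simp only [ψ]; ring)
  have hcont : Continuous fun s => Complex.I * ψ (circleMap 0 R (θ + s)) :=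
    continuous_const.mul ((continuous_circle_slice hψ hR).comp (continuous_const_add θ))
  have hparts := intervalIntegral.integral_mul_deriv_eq_deriv_mul hP hFs
    ((Complex.continuous_ofReal.comp (continuous_polarPoissonDeriv hr)).intervalIntegrable _ _)
    (hcont.intervalIntegrable _ _)
  have hend : circleMap 0 R (θ + Real.pi) = circleMap 0 R (θ + -Real.pi) := by
    rw [← periodic_circleMap 0 R (θ + -Real.pi)]
    ring_nf
  have hPend : polarPoisson r (-Real.pi) = polarPoisson r Real.pi := by simp [polarPoisson]
  simp only [hend, hPend, sub_self, zero_sub, mul_left_comm _ Complex.I,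
    intervalIntegral.integral_const_mul, integral_polarPoisson_mul_slice hψ hr θ hR] at hparts
  simp only [ψ] at hparts
  linear_combination hparts

theorem integral_polarPoissonDeriv_mul (hFc : Continuous F)
    (hF : ∀ z ∈ Metric.ball (0 : ℂ) 1, HasDerivAt F (φ z) z)
    (hφ : DifferentiableOn ℂ φ (Metric.ball 0 1)) {r : ℝ} (hr : r ∈ Ico (0 : ℝ) 1) (θ : ℝ) :
    ∫ s in (-Real.pi)..Real.pi, (polarPoissonDeriv r s : ℂ) * F (circleMap 0 1 (θ + s)) =
      -(2 * Real.pi * Complex.I) * (circleMap 0 r θ * φ (circleMap 0 r θ)) := by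
  have hleft : Continuous fun R : ℝ => ∫ s in (-Real.pi)..Real.pi,
      (polarPoissonDeriv r s : ℂ) * F (circleMap 0 R (θ + s)) := by
    refine intervalIntegral.continuous_parametric_intervalIntegral_of_continuous' ?_ _ _
    refine (Complex.continuous_ofReal.comp
      ((continuous_polarPoissonDeriv hr).comp continuous_snd)).mul (hFc.comp ?_)
    simp only [circleMap]
    fun_prop
  have hφc : ContinuousAt (fun R : ℝ => φ (R * circleMap 0 r θ)) 1 := by
    refine ContinuousAt.comp (f := fun R : ℝ => (R : ℂ) * circleMap 0 r θ) (g := φ) ?_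
      (by fun_prop)
    simpa using hφ.continuousOn.continuousAt
      (Metric.isOpen_ball.mem_nhds (circleMap_mem_unitBall hr θ))
  have hright : ContinuousAt (fun R : ℝ => -(2 * Real.pi * Complex.I) *
      (R * circleMap 0 r θ * φ (R * circleMap 0 r θ))) 1 :=
    continuousAt_const.mul ((Complex.continuous_ofReal.continuousAt.mul continuousAt_const).mul hφc)
  have hlim := tendsto_nhds_unique
    (((hleft.tendsto 1).mono_left (nhdsWithin_le_nhds (s := Iio 1))).congr' ?_)
    (hright.tendsto.mono_left (nhdsWithin_le_nhds (s := Iio 1)))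
  · simpa using hlim
  · filter_upwards [Ioo_mem_nhdsLT (zero_lt_one' ℝ)] with R hR
    exact integral_polarPoissonDeriv_mul_slice hF hφ hr θ ⟨hR.1.le, hR.2⟩

theorem integral_abs_polarPoissonDeriv_mul_sin {r : ℝ} (hr : r ∈ Ico (0 : ℝ) 1) :
    ∫ s in (-Real.pi)..Real.pi, |polarPoissonDeriv r s * Real.sin s| = 2 * Real.pi * r := by
  have h := integral_polarPoissonDeriv_mul (F := id) (φ := fun _ => 1) continuous_id
    (fun z _ => hasDerivAt_id z) (differentiableOn_const _) hr 0
  have hcont : Continuous fun s => (polarPoissonDeriv r s : ℂ) * id (circleMap 0 1 (0 + s)) :=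
    (Complex.continuous_ofReal.comp (continuous_polarPoissonDeriv hr)).mul
      ((continuous_circleMap 0 1).comp (continuous_const_add 0))
  have him := Complex.imCLM.intervalIntegral_comp_comm
    (hcont.intervalIntegrable (μ := volume) (-Real.pi) Real.pi)
  have hpt : ∀ s : ℝ, Complex.imCLM ((polarPoissonDeriv r s : ℂ) * id (circleMap 0 1 (0 + s))) =
      -|polarPoissonDeriv r s * Real.sin s| := fun s => by
    rw [abs_of_nonpos (polarPoissonDeriv_mul_sin_nonpos hr s)]
    simp [circleMap, Complex.exp_ofReal_mul_I_im]
  have hval : Complex.imCLM (-(2 * Real.pi * Complex.I) * (circleMap 0 r 0 * 1)) =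
      -(2 * Real.pi * r) := by
    simp [circleMap]
  rw [h, hval] at him
  simp_rw [hpt] at him
  rw [intervalIntegral.integral_neg] at him
  exact neg_injective him

theorem mul_norm_radial_le (hFc : Continuous F)
    (hF : ∀ z ∈ Metric.ball (0 : ℂ) 1, HasDerivAt F (φ z) z)
    (hφ : DifferentiableOn ℂ φ (Metric.ball 0 1)) {r : ℝ} (hr : r ∈ Ico (0 : ℝ) 1) {θ a b : ℝ}
    (h : ∀ s ∈ Icc (-Real.pi) Real.pi, |polarPoissonDeriv r s| * ‖F (circleMap 0 1 (θ + s))‖ ≤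
      a * |polarPoissonDeriv r s * Real.sin s| + b) :
    r * ‖φ (circleMap 0 r θ)‖ ≤ a * r + b := by
  have hcont : Continuous fun s => a * |polarPoissonDeriv r s * Real.sin s| := by
    have := continuous_polarPoissonDeriv hr
    fun_prop
  have hint : ‖∫ s in (-Real.pi)..Real.pi,
      (polarPoissonDeriv r s : ℂ) * F (circleMap 0 1 (θ + s))‖ ≤
      ∫ s in (-Real.pi)..Real.pi, (a * |polarPoissonDeriv r s * Real.sin s| + b) := by
    refine intervalIntegral.norm_integral_le_of_norm_le (by linarith [Real.pi_pos])
      (ae_of_all _ fun s hs => ?_) ((hcont.add continuous_const).intervalIntegrable _ _)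
    simpa using h s (Ioc_subset_Icc_self hs)
  rw [integral_polarPoissonDeriv_mul hFc hF hφ hr,
    intervalIntegral.integral_add (hcont.intervalIntegrable _ _)
      (continuous_const.intervalIntegrable _ _),
    intervalIntegral.integral_const_mul, integral_abs_polarPoissonDeriv_mul_sin hr,
    intervalIntegral.integral_const] at hint
  simp only [norm_mul, norm_neg, Complex.norm_I, mul_one, norm_circleMap_zero, Complex.norm_real,
    Complex.norm_ofNat, Real.norm_eq_abs, abs_of_pos Real.pi_pos, abs_of_nonneg hr.1,
    smul_eq_mul] at hint
  refine le_of_mul_le_mul_left ?_ Real.two_pi_pos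
  linarith

/-- Near `s = 0` the kernel `|P_r'(s)| |sin s|` has bounded mass, and away from it `P_r'` is
uniformly small. -/
theorem eventually_norm_radial_le (hFc : Continuous F)
    (hF : ∀ z ∈ Metric.ball (0 : ℂ) 1, HasDerivAt F (φ z) z)
    (hφ : DifferentiableOn ℂ φ (Metric.ball 0 1)) {θ ε : ℝ} (hε : 0 < ε)
    (h : ∀ᶠ s in 𝓝 0, ‖F (circleMap 0 1 (θ + s))‖ ≤ ε * |Real.sin s|) :
    ∀ᶠ r in 𝓝[<] 1, ‖φ (circleMap 0 r θ)‖ ≤ 3 * ε := by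
  obtain ⟨δ, hδ, hnear⟩ := Metric.eventually_nhds_iff.1 h
  simp only [dist_zero_right, Real.norm_eq_abs] at hnear
  obtain ⟨M, hM⟩ := (isCompact_sphere (0 : ℂ) 1).exists_bound_of_continuousOn hFc.continuousOn
  have hM' : ∀ t, ‖F (circleMap 0 1 t)‖ ≤ M := fun t => hM _ (by simp)
  let d := min δ Real.pi
  have hd : 0 < d := lt_min hδ Real.pi_pos
  have hκ : 0 < 1 - Real.cos d := by
    have := Real.cos_lt_cos_of_nonneg_of_le_pi le_rfl (min_le_right _ _) hd
    rw [Real.cos_zero] at this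
    linarith
  have htail : ∀ᶠ r in 𝓝[<] (1 : ℝ), 4 * (1 - r) / (1 - Real.cos d) ^ 2 * M ≤ ε := by
    have hc : Continuous fun r : ℝ => 4 * (1 - r) / (1 - Real.cos d) ^ 2 * M := by fun_prop
    have hlim := hc.tendsto 1
    simp only [sub_self, mul_zero, zero_div, zero_mul] at hlim
    exact nhdsWithin_le_nhds (hlim.eventually_le_const hε)
  filter_upwards [htail, Ioo_mem_nhdsLT (by norm_num : (1 / 2 : ℝ) < 1)] with r hr_tail hr
  have hr0 : r ∈ Ico (0 : ℝ) 1 := ⟨by linarith [hr.1], hr.2⟩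
  have hbound := mul_norm_radial_le hFc hF hφ hr0 (θ := θ) (a := ε) (b := ε) fun s hs => ?_
  · nlinarith [hr.1, hr.2, norm_nonneg (φ (circleMap 0 r θ))]
  by_cases hsd : |s| < d
  · calc |polarPoissonDeriv r s| * ‖F (circleMap 0 1 (θ + s))‖
        ≤ |polarPoissonDeriv r s| * (ε * |Real.sin s|) := by
          gcongr
          exact hnear (hsd.trans_le (min_le_left _ _))
      _ = ε * |polarPoissonDeriv r s * Real.sin s| := by rw [abs_mul]; ring
      _ ≤ _ := le_add_of_nonneg_right hε.le
  · have hcos := Real.cos_le_cos_of_nonneg_of_le_pi hd.le (abs_le.2 hs) (not_lt.1 hsd)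
    rw [Real.cos_abs] at hcos
    have hP := abs_polarPoissonDeriv_le (Ioo_subset_Ico_self hr) hκ (sub_le_sub_left hcos 1)
    calc _ ≤ 4 * (1 - r) / (1 - Real.cos d) ^ 2 * M :=
          mul_le_mul hP (hM' _) (norm_nonneg _) ((abs_nonneg _).trans hP)
      _ ≤ ε := hr_tail
      _ ≤ _ := le_add_of_nonneg_left (by positivity)

theorem tendsto_radial_zero_of_hasDerivAt (hFc : Continuous F)
    (hF : ∀ z ∈ Metric.ball (0 : ℂ) 1, HasDerivAt F (φ z) z)
    (hφ : DifferentiableOn ℂ φ (Metric.ball 0 1)) {θ : ℝ} (hFθ : F (circleMap 0 1 θ) = 0)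
    (hd : HasDerivAt (fun t => F (circleMap 0 1 t)) 0 θ) :
    Tendsto (fun r => φ (circleMap 0 r θ)) (𝓝[<] 1) (𝓝 0) := by
  have hsmall : (fun s => F (circleMap 0 1 (θ + s))) =o[𝓝 0] Real.sin := by
    have h := hasDerivAt_iff_isLittleO_nhds_zero.1 hd
    simp only [hFθ, sub_zero, smul_zero] at h
    exact h.trans_isBigO Real.isEquivalent_sin.isBigO_symm
  rw [tendsto_zero_iff_norm_tendsto_zero, Metric.tendsto_nhds]
  intro ε hε
  filter_upwards [eventually_norm_radial_le hFc hF hφ (by positivity : 0 < ε / 4)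
    (hsmall.bound (by positivity))] with r hr
  rw [Real.dist_0_eq_abs, abs_norm]
  linarith

theorem tendsto_radial_of_hasDerivAt (hFc : Continuous F)
    (hF : ∀ z ∈ Metric.ball (0 : ℂ) 1, HasDerivAt F (φ z) z)
    (hφ : DifferentiableOn ℂ φ (Metric.ball 0 1)) {θ : ℝ} {l : ℂ}
    (hd : HasDerivAt (fun t => F (circleMap 0 1 t)) (circleMap 0 1 θ * Complex.I * l) θ) :
    Tendsto (fun r => φ (circleMap 0 r θ)) (𝓝[<] 1) (𝓝 l) := by
  let ζ := circleMap 0 1 θ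
  let E : ℂ → ℂ := fun w => F w - F ζ - l * (w - ζ)
  have hE : ∀ z ∈ Metric.ball (0 : ℂ) 1, HasDerivAt E (φ z - l) z := fun z hz =>
    (((hF z hz).sub_const (F ζ)).sub (((hasDerivAt_id z).sub_const ζ).const_mul l)).congr_deriv
      (by ring)
  have hEθ : HasDerivAt (fun t => E (circleMap 0 1 t)) 0 θ :=
    ((hd.sub_const (F ζ)).sub
      (((hasDerivAt_circleMap 0 1 θ).sub_const ζ).const_mul l)).congr_deriv (by ring)
  have h := tendsto_radial_zero_of_hasDerivAt (by fun_prop : Continuous E) hE (hφ.sub_const l)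
    (by simp [E, ζ]) hEθ
  simpa using h.add_const l

/-- **Fatou's theorem** for bounded analytic functions: a primitive is Lipschitz, hence
differentiable a.e. on the circle by Rademacher's theorem. -/
theorem ae_exists_radial_limit (hφ : DifferentiableOn ℂ φ (Metric.ball 0 1)) {M : ℝ≥0}
    (hM : ∀ z ∈ Metric.ball (0 : ℂ) 1, ‖φ z‖₊ ≤ M) :
    ∀ᵐ t ∂circleMeasure, ∃ l, Tendsto (fun r => φ (circleMap 0 r t)) (𝓝[<] 1) (𝓝 l) := by
  obtain ⟨F₀, hF₀⟩ := hφ.isExactOn_ball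
  have hlip : LipschitzOnWith M F₀ (Metric.ball 0 1) :=
    (convex_ball (0 : ℂ) 1).lipschitzOnWith_of_nnnorm_hasDerivWithin_le
      (fun z hz => (hF₀ z hz).hasDerivWithinAt) hM
  obtain ⟨F, hF, hEq⟩ := hlip.extend_finite_dimension
  have hFd : ∀ z ∈ Metric.ball (0 : ℂ) 1, HasDerivAt F (φ z) z := fun z hz =>
    (hF₀ z hz).congr_of_eventuallyEq
      (eventually_of_mem (Metric.isOpen_ball.mem_nhds hz) fun w hw => (hEq hw).symm)
  have hdiff := (hF.comp (lipschitzWith_circleMap 0 1)).ae_differentiableAt_real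
  refine ae_circleMeasure_of_ae (hdiff.mono fun θ hθ => ?_)
  have hne : circleMap 0 1 θ * Complex.I ≠ 0 := by simp [circleMap]
  refine ⟨deriv (F ∘ circleMap 0 1) θ / (circleMap 0 1 θ * Complex.I),
    tendsto_radial_of_hasDerivAt hF.continuous hFd hφ ?_⟩
  rw [mul_div_cancel₀ _ hne]
  exact hθ.hasDerivAt

end RadialLimit

/-! ### Hardy–Orlicz spaces and composition operators -/

namespace OrliczFunction

variable (Ψ : OrliczFunction) {r : ℝ}

/-- The growth rate `Ψ⁻¹(1 / (1 - r))` of the functions of `H^Ψ` near the circle, as a real number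
(meaningful for `r < 1` only). -/
def growth (r : ℝ) : ℝ := (Ψ.inv (ENNReal.ofReal (1 / (1 - r)))).toReal

theorem ofReal_growth : ENNReal.ofReal (Ψ.growth r) = Ψ.inv (ENNReal.ofReal (1 / (1 - r))) :=
  ENNReal.ofReal_toReal (Ψ.inv_ne_top ENNReal.ofReal_ne_top)

theorem growth_nonneg : 0 ≤ Ψ.growth r := ENNReal.toReal_nonneg

theorem growth_pos (hr : r < 1) : 0 < Ψ.growth r :=
  ENNReal.toReal_pos (Ψ.inv_ne_zero (by simpa using hr)) (Ψ.inv_ne_top ENNReal.ofReal_ne_top)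

end OrliczFunction

theorem one_div_one_sub_enorm {z : ℂ} (hz : z ∈ Metric.ball (0 : ℂ) 1) :
    1 / (1 - ‖z‖ₑ) = ENNReal.ofReal (1 / (1 - ‖z‖)) := by
  rw [ENNReal.ofReal_div_of_pos (sub_pos.2 (mem_ball_zero_iff.1 hz)), ENNReal.ofReal_one,
    ENNReal.ofReal_sub _ (norm_nonneg z), ENNReal.ofReal_one, ofReal_norm]

theorem one_le_ofReal_one_add_norm_div {w : ℂ} (hw : w ∈ Metric.ball (0 : ℂ) 1) :
    1 ≤ ENNReal.ofReal ((1 + ‖w‖) / (1 - ‖w‖)) := by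
  rw [ENNReal.one_le_ofReal, le_div_iff₀ (sub_pos.2 (mem_ball_zero_iff.1 hw))]
  linarith [norm_nonneg w]

namespace HardyOrlicz

variable {Ψ : OrliczFunction} {C K : ℝ≥0∞}

theorem ext_on_ball {f g : HardyOrlicz Ψ} (h : ∀ z ∈ Metric.ball (0 : ℂ) 1, f z = g z) : f = g := by
  refine Subtype.ext (funext fun z => ?_)
  by_cases hz : z ∈ Metric.ball (0 : ℂ) 1
  · exact h z hz
  · exact (f.2.2.1 z hz).trans (g.2.2.1 z hz).symm

theorem sub_apply (f g : HardyOrlicz Ψ) (z : ℂ) : (f - g) z = f z - g z := rfl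

theorem smul_apply (c : ℂ) (f : HardyOrlicz Ψ) (z : ℂ) : (c • f) z = c * f z := rfl

theorem differentiableOn (f : HardyOrlicz Ψ) : DifferentiableOn ℂ f (Metric.ball 0 1) := f.2.1

theorem enorm_eq (f : HardyOrlicz Ψ) : ‖f‖ₑ = hardyOrliczENorm Ψ f := by
  rw [← ofReal_norm, norm_def, ENNReal.ofReal_toReal f.2.2.2.ne]

theorem modular_slice_le_one {f : HardyOrlicz Ψ} (hC : ‖f‖ₑ < C) {r : ℝ}
    (hr : r ∈ Ico (0 : ℝ) 1) :
    Ψ.modular circleMeasure C (fun t => f (circleMap 0 r t)) ≤ 1 := by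
  rw [enorm_eq] at hC
  exact modular_le_one_of_luxemburgNorm_lt ((le_iSup₂ (f := fun r (_ : r ∈ Ico (0 : ℝ) 1) =>
    luxemburgNorm Ψ fun t => f (circleMap 0 r t)) r hr).trans_lt hC)

theorem enorm_le_of_modular_slice_le {f : HardyOrlicz Ψ} (hC : C ≠ 0) (hK : 1 ≤ K) (hK_top : K ≠ ⊤)
    (h : ∀ r ∈ Ico (0 : ℝ) 1,
      Ψ.modular circleMeasure C (fun t => f (circleMap 0 r t)) ≤ K) : ‖f‖ₑ ≤ K * C := by
  rw [enorm_eq]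
  exact iSup₂_le fun r hr => luxemburgNorm_le_of_modular_le hC hK hK_top (h r hr)

theorem tendsto_apply_ofReal_mul (f : HardyOrlicz Ψ) {z : ℂ} (hz : z ∈ Metric.ball (0 : ℂ) 1) :
    Tendsto (fun R : ℝ => f (R * z)) (𝓝[<] 1) (𝓝 (f z)) := by
  have hmul : Tendsto (fun R : ℝ => (R : ℂ) * z) (𝓝[<] 1) (𝓝 z) := by
    simpa using ((Complex.continuous_ofReal.tendsto 1).mul_const z).mono_left nhdsWithin_le_nhds
  exact (f.differentiableOn.continuousOn.continuousAt
    (Metric.isOpen_ball.mem_nhds hz)).tendsto.comp hmul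

theorem modular_comp_slice_le {q : ℂ → ℂ} (hq : DifferentiableOn ℂ q (Metric.ball 0 1))
    (hmaps : MapsTo q (Metric.ball 0 1) (Metric.ball 0 1)) {f : HardyOrlicz Ψ}
    (hC : ‖f‖ₑ < C) {r : ℝ} (hr : r ∈ Ico (0 : ℝ) 1) :
    Ψ.modular circleMeasure C (fun t => f (q (circleMap 0 r t))) ≤
      ENNReal.ofReal ((1 + ‖q 0‖) / (1 - ‖q 0‖)) := by
  refine Ψ.modular_le_of_tendsto (u := 𝓝[<] (1 : ℝ))
    (f := fun R t => f (R * q (circleMap 0 r t))) (pos_of_gt hC).ne' ?_ (ae_of_all _ fun t =>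
      f.tendsto_apply_ofReal_mul (hmaps (circleMap_mem_unitBall hr t))) ?_
  · filter_upwards [Ico_mem_nhdsLT zero_lt_one] with R hR
    exact (continuous_circle_slice
      ((diffContOnCl_comp_mul f.differentiableOn hR).differentiableOn.comp hq hmaps)
      hr).aestronglyMeasurable
  · filter_upwards [Ico_mem_nhdsLT zero_lt_one] with R hR
    exact (Ψ.modular_comp_slice_le (h := fun w => f (R * w))
      (continuous_circle_slice f.differentiableOn hR).aestronglyMeasurable
      (fun z hz => integral_discPoisson_smul_slice f.differentiableOn hR hz) hq hmaps hr C).trans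
      (mul_le_of_le_one_right' (modular_slice_le_one hC hR))

section PointEvaluation

theorem enorm_apply_div_le {f : HardyOrlicz Ψ} (hC : ‖f‖ₑ < C) {z : ℂ}
    (hz : z ∈ Metric.ball (0 : ℂ) 1) :
    ‖f z‖ₑ / C ≤ Ψ.inv (ENNReal.ofReal ((1 + ‖z‖) / (1 - ‖z‖))) := by
  have h := modular_comp_slice_le (q := fun _ => z) (differentiableOn_const z) (fun _ _ => hz) hC
    (r := 0) (by simp)
  rwa [OrliczFunction.modular, lintegral_const, measure_univ, mul_one,
    Ψ.eval_le_iff_le_inv] at h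

theorem enorm_apply_le (f : HardyOrlicz Ψ) {z : ℂ} (hz : z ∈ Metric.ball (0 : ℂ) 1) :
    ‖f z‖ₑ ≤ 2 * Ψ.inv (1 / (1 - ‖z‖ₑ)) * ‖f‖ₑ := by
  have hz1 := mem_ball_zero_iff.1 hz
  have hinv : Ψ.inv (ENNReal.ofReal ((1 + ‖z‖) / (1 - ‖z‖))) ≤
      2 * Ψ.inv (1 / (1 - ‖z‖ₑ)) := by
    refine (Ψ.inv_mono ?_).trans (Ψ.inv_mul_le one_le_two ENNReal.ofNat_ne_top _)
    rw [one_div_one_sub_enorm hz, ← ENNReal.ofReal_ofNat, ← ENNReal.ofReal_mul zero_le_two,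
      mul_one_div]
    exact ENNReal.ofReal_le_ofReal (div_le_div_of_nonneg_right (by linarith) (by linarith))
  have h0 : 2 * Ψ.inv (1 / (1 - ‖z‖ₑ)) ≠ 0 := by
    rw [one_div_one_sub_enorm hz]
    exact mul_ne_zero two_ne_zero (Ψ.inv_ne_zero (by simpa using hz1))
  have htop : 2 * Ψ.inv (1 / (1 - ‖z‖ₑ)) ≠ ⊤ := by
    rw [one_div_one_sub_enorm hz]
    exact ENNReal.mul_ne_top ENNReal.ofNat_ne_top (Ψ.inv_ne_top ENNReal.ofReal_ne_top)
  rw [← ENNReal.div_le_iff' h0 htop]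
  refine le_of_forall_gt_imp_ge_of_dense fun C hC => ?_
  rcases eq_or_ne C ⊤ with rfl | hC_top
  · exact le_top
  rw [ENNReal.div_le_iff' h0 htop, ← ENNReal.div_le_iff (pos_of_gt hC).ne' hC_top]
  exact (enorm_apply_div_le hC hz).trans hinv

theorem norm_apply_le (f : HardyOrlicz Ψ) {z : ℂ} {R : ℝ} (hR : R < 1) (hz : ‖z‖ ≤ R) :
    ‖f z‖ ≤ 2 * Ψ.growth R * ‖f‖ := by
  have hzb : z ∈ Metric.ball (0 : ℂ) 1 := mem_ball_zero_iff.2 (hz.trans_lt hR)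
  have hmono : 1 / (1 - ‖z‖ₑ) ≤ ENNReal.ofReal (1 / (1 - R)) := by
    rw [one_div_one_sub_enorm hzb]
    exact ENNReal.ofReal_le_ofReal (one_div_le_one_div_of_le (by linarith) (by linarith))
  have hg := Ψ.growth_nonneg (r := R)
  rw [← ENNReal.ofReal_le_ofReal_iff (by positivity), ENNReal.ofReal_mul (by positivity),
    ENNReal.ofReal_mul zero_le_two, Ψ.ofReal_growth, ENNReal.ofReal_ofNat, ofReal_norm, ofReal_norm]
  exact (f.enorm_apply_le hzb).trans (by gcongr; exact Ψ.inv_mono hmono)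

/-- Point evaluation at a point of the disc, as a continuous functional on `H^Ψ`. -/
def evalCLM (Ψ : OrliczFunction) (z : ℂ) (hz : z ∈ Metric.ball (0 : ℂ) 1) :
    HardyOrlicz Ψ →L[ℂ] ℂ :=
  LinearMap.mkContinuous
    { toFun := fun f => f z
      map_add' := fun _ _ => rfl
      map_smul' := fun _ _ => rfl }
    (2 * Ψ.growth ‖z‖) fun f => f.norm_apply_le (mem_ball_zero_iff.1 hz) le_rfl

end PointEvaluation

section OfModular

variable {f : ℂ → ℂ} (hf : DifferentiableOn ℂ f (Metric.ball 0 1)) (hC : C ≠ 0) (hC_top : C ≠ ⊤)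
  (hK : 1 ≤ K) (hK_top : K ≠ ⊤)
  (h : ∀ r ∈ Ico (0 : ℝ) 1, Ψ.modular circleMeasure C (fun t => f (circleMap 0 r t)) ≤ K)

/-- An analytic function whose modulars on the circles `|z| = r < 1` are bounded, as an element
of `H^Ψ`; its values outside the open disc are replaced by `0`. -/
def ofModular : HardyOrlicz Ψ :=
  ⟨(Metric.ball (0 : ℂ) 1).indicator f, hf.congr fun _ hz => indicator_of_mem hz f,
    fun _ hz => indicator_of_notMem hz f, by
      refine lt_of_le_of_lt (iSup₂_le fun r hr => ?_)
        (ENNReal.mul_lt_top hK_top.lt_top hC_top.lt_top)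
      simp only [indicator_of_mem (circleMap_mem_unitBall hr _)]
      exact luxemburgNorm_le_of_modular_le hC hK hK_top (h r hr)⟩

theorem ofModular_apply {z : ℂ} (hz : z ∈ Metric.ball (0 : ℂ) 1) :
    ofModular hf hC hC_top hK hK_top h z = f z := indicator_of_mem hz f

theorem enorm_ofModular_le : ‖ofModular hf hC hC_top hK hK_top h‖ₑ ≤ K * C := by
  refine enorm_le_of_modular_slice_le hC hK hK_top fun r hr => ?_
  simp only [ofModular_apply hf hC hC_top hK hK_top h (circleMap_mem_unitBall hr _)]
  exact h r hr

end OfModular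

section Composition

variable {φ : ℂ → ℂ} (hφ : DifferentiableOn ℂ φ (Metric.ball 0 1))
  (hmaps : MapsTo φ (Metric.ball 0 1) (Metric.ball 0 1))

/-- `f ∘ φ` as an element of `H^Ψ`. -/
def comp (f : HardyOrlicz Ψ) : HardyOrlicz Ψ :=
  ofModular (C := ‖f‖ₑ + 1) (f.differentiableOn.comp hφ hmaps) (by simp) (by simp)
    (one_le_ofReal_one_add_norm_div (hmaps (Metric.mem_ball_self one_pos))) ENNReal.ofReal_ne_top
    fun _ hr => modular_comp_slice_le hφ hmaps (ENNReal.lt_add_right enorm_ne_top one_ne_zero) hr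

theorem comp_apply (f : HardyOrlicz Ψ) {z : ℂ} (hz : z ∈ Metric.ball (0 : ℂ) 1) :
    comp hφ hmaps f z = f (φ z) := ofModular_apply _ _ _ _ _ _ hz

theorem norm_comp_le (f : HardyOrlicz Ψ) :
    ‖comp hφ hmaps f‖ ≤ (1 + ‖φ 0‖) / (1 - ‖φ 0‖) * ‖f‖ := by
  have hφ0 := hmaps (Metric.mem_ball_self one_pos)
  have hK := one_le_ofReal_one_add_norm_div hφ0
  have hK0 : 0 ≤ (1 + ‖φ 0‖) / (1 - ‖φ 0‖) :=
    div_nonneg (by positivity) (sub_nonneg.2 (mem_ball_zero_iff.1 hφ0).le)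
  rw [← ENNReal.ofReal_le_ofReal_iff (by positivity), ENNReal.ofReal_mul hK0, ofReal_norm,
    ofReal_norm, ← ENNReal.div_le_iff' (zero_lt_one.trans_le hK).ne' ENNReal.ofReal_ne_top]
  refine le_of_forall_gt_imp_ge_of_dense fun C hC => ?_
  rw [ENNReal.div_le_iff' (zero_lt_one.trans_le hK).ne' ENNReal.ofReal_ne_top]
  refine enorm_le_of_modular_slice_le (pos_of_gt hC).ne' hK ENNReal.ofReal_ne_top fun r hr => ?_
  simp only [comp_apply hφ hmaps f (circleMap_mem_unitBall hr _)]
  exact modular_comp_slice_le hφ hmaps hC hr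

/-- The composition operator `C_φ` on `H^Ψ`. -/
def compCLM : HardyOrlicz Ψ →L[ℂ] HardyOrlicz Ψ :=
  LinearMap.mkContinuous
    { toFun := comp hφ hmaps
      map_add' := fun f g => ext_on_ball fun z hz => by
        change comp hφ hmaps (f + g) z = comp hφ hmaps f z + comp hφ hmaps g z
        simp only [comp_apply hφ hmaps _ hz]
        rfl
      map_smul' := fun c f => ext_on_ball fun z hz => by
        rw [RingHom.id_apply, smul_apply]
        simp only [comp_apply hφ hmaps _ hz, smul_apply] }
    ((1 + ‖φ 0‖) / (1 - ‖φ 0‖)) (norm_comp_le hφ hmaps)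

theorem compCLM_apply (f : HardyOrlicz Ψ) {z : ℂ} (hz : z ∈ Metric.ball (0 : ℂ) 1) :
    compCLM hφ hmaps f z = f (φ z) := comp_apply hφ hmaps f hz

end Composition

end HardyOrlicz

/-! ### Integrability of the functions `χ_B` and their tails -/

section LayerCake

variable {Ω : Type*} {m : MeasurableSpace Ω} {μ : Measure Ω} {f : Ω → ℝ≥0∞} {K y₀ : ℝ≥0∞}

theorem ae_lt_top_of_measure_mul_sq_le (hK : K ≠ ⊤) (hy₀ : y₀ ≠ ⊤)
    (h : ∀ y, y₀ ≤ y → y ≠ ⊤ → μ {x | y < f x} * y ^ 2 ≤ K) : ∀ᵐ x ∂μ, f x < ⊤ := by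
  simp only [ae_iff, not_lt_top_iff]
  by_contra hpos
  set c := μ {x | f x = ⊤}
  obtain ⟨y, hy, hy_top⟩ : ∃ y, max (max y₀ 1) (K / c) < y ∧ y < ⊤ :=
    exists_between (by simp [hy₀.lt_top, ENNReal.div_lt_top hK hpos])
  have hy₀y : y₀ ≤ y := ((le_max_left _ _).trans (le_max_left _ _)).trans hy.le
  have h1y : 1 ≤ y := ((le_max_right _ _).trans (le_max_left _ _)).trans hy.le
  have hlt : K < c * y := by
    rw [mul_comm]
    exact ENNReal.div_lt_iff (.inl hpos) (.inr hK) |>.1 ((le_max_right _ _).trans_lt hy)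
  refine hlt.not_ge (le_trans ?_ (h y hy₀y hy_top.ne))
  gcongr
  · exact measure_mono fun x (hx : f x = ⊤) => mem_ofPred.2 (hx ▸ hy_top)
  · exact le_self_pow₀ h1y two_ne_zero

theorem lintegral_Ioi_inv_sq_lt_top {a : ℝ} (ha : 0 < a) :
    ∫⁻ s in Ioi a, (ENNReal.ofReal s ^ 2)⁻¹ < ⊤ := by
  refine lt_of_eq_of_lt (setLIntegral_congr_fun measurableSet_Ioi fun s hs => ?_)
    (integrableOn_Ioi_rpow_of_lt (by norm_num : (-2 : ℝ) < -1) ha).lintegral_lt_top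
  have hs : 0 < s := ha.trans hs
  simp only [Real.rpow_neg hs.le, Real.rpow_two, ENNReal.ofReal_inv_of_pos (pow_pos hs 2),
    ENNReal.ofReal_pow hs.le]

theorem lintegral_lt_top_of_measure_mul_sq_le [IsFiniteMeasure μ] (hf : AEMeasurable f μ)
    (hK : K ≠ ⊤) (hy₀ : y₀ ≠ ⊤) (h : ∀ y, y₀ ≤ y → y ≠ ⊤ → μ {x | y < f x} * y ^ 2 ≤ K) :
    ∫⁻ x, f x ∂μ < ⊤ := by
  have htop := ae_lt_top_of_measure_mul_sq_le hK hy₀ h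
  set a := max y₀.toReal 1
  have ha : 0 < a := lt_max_of_lt_right one_pos
  have htail : ∀ s ∈ Ioi a, μ {x | s < (f x).toReal} ≤ K * (ENNReal.ofReal s ^ 2)⁻¹ := by
    intro s hs
    have hs0 : ENNReal.ofReal s ≠ 0 := (ENNReal.ofReal_pos.2 (ha.trans hs)).ne'
    rw [← div_eq_mul_inv, ENNReal.le_div_iff_mul_le (.inl (pow_ne_zero 2 hs0))
      (.inl (ENNReal.pow_ne_top ENNReal.ofReal_ne_top))]
    refine le_trans (mul_le_mul_left (measure_mono fun x hx => ?_) _) (h (ENNReal.ofReal s)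
      ((ENNReal.le_ofReal_iff_toReal_le hy₀ (ha.trans hs).le).2
        ((le_max_left _ _).trans (mem_Ioi.1 hs).le)) ENNReal.ofReal_ne_top)
    exact (ENNReal.ofReal_lt_iff_lt_toReal (ha.trans hs).le
      fun htop' => by simp [htop', (ha.trans hs).not_gt] at hx).2 hx
  calc ∫⁻ x, f x ∂μ = ∫⁻ x, ENNReal.ofReal (f x).toReal ∂μ :=
        lintegral_congr_ae (htop.mono fun x hx => (ENNReal.ofReal_toReal hx.ne).symm)
    _ = ∫⁻ s in Ioi 0, μ {x | s < (f x).toReal} :=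
        lintegral_eq_lintegral_meas_lt μ (ae_of_all _ fun _ => ENNReal.toReal_nonneg)
          hf.ennreal_toReal
    _ ≤ (∫⁻ s in Ioc 0 a, μ {x | s < (f x).toReal}) +
          ∫⁻ s in Ioi a, μ {x | s < (f x).toReal} := by
        rw [← Ioc_union_Ioi_eq_Ioi ha.le]
        exact lintegral_union_le _ _ _
    _ ≤ (∫⁻ _ in Ioc 0 a, μ univ) + ∫⁻ s in Ioi a, K * (ENNReal.ofReal s ^ 2)⁻¹ :=
        add_le_add (lintegral_mono fun _ => measure_mono (subset_univ _))
          (setLIntegral_mono' measurableSet_Ioi htail)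
    _ < ⊤ := by
        rw [lintegral_const_mul' _ _ hK, setLIntegral_const, Real.volume_Ioc]
        exact ENNReal.add_lt_top.2 ⟨by finiteness,
          ENNReal.mul_lt_top hK.lt_top (lintegral_Ioi_inv_sq_lt_top ha)⟩

end LayerCake

namespace OrliczFunction

variable {Ω : Type*} {m : MeasurableSpace Ω} {Ψ : OrliczFunction} {μ : Measure Ω} {R : Ω → ℝ≥0∞}

/-- `χ_B ∘ R` has finite integral for every `B > 0`. For `R = 1 / (1 - |φ*|)` this is assertion 4
of the theorem. -/
def ChiIntegrable (Ψ : OrliczFunction) (μ : Measure Ω) (R : Ω → ℝ≥0∞) : Prop :=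
  ∀ B : ℝ≥0, 0 < B → ∫⁻ t, Ψ.chi B (R t) ∂μ < ⊤

/-- `μ {x < R} = O(1 / χ_A(x))` as `x → ∞`, for every `A > 0`. For `R = 1 / (1 - |φ*|)` and
`x = 1 / λ` this is assertion 5 of the theorem; at `x = ∞` the bound holds trivially. -/
def ChiTail (Ψ : OrliczFunction) (μ : Measure Ω) (R : Ω → ℝ≥0∞) : Prop :=
  ∀ A : ℝ≥0, 0 < A → ∃ K x₀ : ℝ≥0, ∀ x : ℝ≥0∞, x₀ ≤ x → μ {t | x < R t} * Ψ.chi A x ≤ K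

theorem ChiIntegrable.chiTail (h : Ψ.ChiIntegrable μ R) (hR : AEMeasurable R μ) :
    Ψ.ChiTail μ R := by
  intro A hA
  refine ⟨(∫⁻ t, Ψ.chi A (R t) ∂μ).toNNReal, 0, fun x _ => ?_⟩
  rw [ENNReal.coe_toNNReal (h A hA).ne, mul_comm]
  refine le_trans ?_ (mul_meas_ge_le_lintegral₀ ((Ψ.measurable_chi A).comp_aemeasurable hR)
    (Ψ.chi A x))
  gcongr
  exact fun ht => Ψ.chi_mono A ht.le

/-- Under `Δ²`, `χ_B² ≤ χ_{αB}` near infinity: the tail of `χ_B ∘ R` decays quadratically. -/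
theorem ChiTail.chiIntegrable [IsFiniteMeasure μ] (h : Ψ.ChiTail μ R) (hΨ : Ψ.SatisfiesDelta2)
    (hR : AEMeasurable R μ) : Ψ.ChiIntegrable μ R := by
  intro B hB
  have hB₀ : (B : ℝ≥0∞) ≠ 0 := by exact_mod_cast hB.ne'
  obtain ⟨α, hα, hχ⟩ := hΨ.exists_chi_sq_le
  obtain ⟨x₀, hx₀, hsq⟩ := hχ B hB.ne'
  obtain ⟨K, x₁, hK⟩ := h (α * B) (mul_pos (zero_lt_one.trans hα) hB)
  refine lintegral_lt_top_of_measure_mul_sq_le ((Ψ.measurable_chi B).comp_aemeasurable hR)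
    (ENNReal.coe_ne_top (r := K)) (y₀ := Ψ.chi B (max x₀ x₁))
    (Ψ.chi_ne_top ENNReal.coe_ne_top (by simp [hx₀])) fun y hy _ => ?_
  obtain ⟨x, rfl⟩ := Ψ.chi_surjective hB₀ ENNReal.coe_ne_top y
  simp only [(Ψ.chi_strictMono hB₀ ENNReal.coe_ne_top).lt_iff_lt,
    (Ψ.chi_strictMono hB₀ ENNReal.coe_ne_top).le_iff_le, max_le_iff] at hy ⊢
  exact (mul_le_mul_right (hsq x hy.1) _).trans (hK x hy.2)

theorem ChiIntegrable.ae_lt_top (h : Ψ.ChiIntegrable μ R) (hR : AEMeasurable R μ) :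
    ∀ᵐ t ∂μ, R t < ⊤ := by
  have h1 := h 1 one_pos
  simp only [ENNReal.coe_one, Ψ.chi_one] at h1
  exact ae_lt_top' hR h1.ne

theorem integrable_chi_iff (hR : AEMeasurable R μ) :
    (∀ B : ℝ≥0, 0 < B → Integrable (fun t => Ψ.chi B (R t)) μ) ↔ Ψ.ChiIntegrable μ R := by
  refine forall₂_congr fun B _ => ⟨fun h => h.2, fun h => ⟨?_, h⟩⟩
  exact ((Ψ.measurable_chi B).comp_aemeasurable hR).aestronglyMeasurable

theorem memMorseTransue_inv_iff {R : ℝ → ℝ≥0∞} (hR : AEMeasurable R circleMeasure) :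
    MemMorseTransue Ψ (fun t => Ψ.inv (R t)) ↔ Ψ.ChiIntegrable circleMeasure R := by
  have eval_div : ∀ C : ℝ≥0, 0 < C → ∀ x, Ψ.eval (‖Ψ.inv x‖ₑ / C) = Ψ.chi (C⁻¹ : ℝ≥0) x :=
    fun C hC x => by rw [enorm_eq_self, chi, ENNReal.coe_inv hC.ne', div_eq_mul_inv, mul_comm]
  constructor
  · rintro ⟨-, h⟩ B hB
    simpa only [eval_div B⁻¹ (inv_pos.2 hB), inv_inv] using h B⁻¹ (inv_pos.2 hB)
  · refine fun h => ⟨(Ψ.inv_mono.measurable.comp_aemeasurable hR).aestronglyMeasurable,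
      fun C hC => ?_⟩
    simpa only [eval_div C hC] using h C⁻¹ (inv_pos.2 hC)

end OrliczFunction

/-! ### Boundary values of a self-map of the disc -/

section Boundary

variable {φ : ℂ → ℂ}

theorem boundaryValue_eq {f : ℂ → ℂ} {t : ℝ} {l : ℂ}
    (hl : Tendsto (fun r => f (circleMap 0 r t)) (𝓝[<] 1) (𝓝 l)) : boundaryValue f t = l :=
  hl.limUnder_eq

theorem ae_tendsto_boundaryValue (hφ : DifferentiableOn ℂ φ (Metric.ball 0 1))
    (hmaps : MapsTo φ (Metric.ball 0 1) (Metric.ball 0 1)) :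
    ∀ᵐ t ∂circleMeasure,
      Tendsto (fun r => φ (circleMap 0 r t)) (𝓝[<] 1) (𝓝 (boundaryValue φ t)) := by
  have hbdd : ∀ z ∈ Metric.ball (0 : ℂ) 1, ‖φ z‖₊ ≤ 1 := fun z hz =>
    (mem_ball_zero_iff.1 (hmaps hz)).le
  filter_upwards [ae_exists_radial_limit hφ hbdd] with t ⟨l, hl⟩
  rwa [boundaryValue_eq hl]

theorem aestronglyMeasurable_of_tendsto_of_eventually {ι Ω E : Type*} [MeasurableSpace Ω]
    {μ : Measure Ω} [TopologicalSpace E] [TopologicalSpace.PseudoMetrizableSpace E]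
    {u : Filter ι} [u.NeBot] [u.IsCountablyGenerated] {f : ι → Ω → E} {g : Ω → E}
    (hf : ∀ᶠ i in u, AEStronglyMeasurable (f i) μ)
    (hlim : ∀ᵐ x ∂μ, Tendsto (fun i => f i x) u (𝓝 (g x))) : AEStronglyMeasurable g μ := by
  obtain ⟨ns, hns, hmeas⟩ := exists_seq_forall_of_frequently hf.frequently
  exact aestronglyMeasurable_of_tendsto_ae atTop hmeas (hlim.mono fun _ hx => hx.comp hns)

theorem aestronglyMeasurable_boundaryValue (hφ : DifferentiableOn ℂ φ (Metric.ball 0 1))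
    (hmaps : MapsTo φ (Metric.ball 0 1) (Metric.ball 0 1)) :
    AEStronglyMeasurable (boundaryValue φ) circleMeasure :=
  aestronglyMeasurable_of_tendsto_of_eventually
    (eventually_of_mem (Ico_mem_nhdsLT (zero_lt_one' ℝ)) fun _ hr =>
      (continuous_circle_slice hφ hr).aestronglyMeasurable)
    (ae_tendsto_boundaryValue hφ hmaps)

theorem ae_norm_boundaryValue_le (hφ : DifferentiableOn ℂ φ (Metric.ball 0 1))
    (hmaps : MapsTo φ (Metric.ball 0 1) (Metric.ball 0 1)) :
    ∀ᵐ t ∂circleMeasure, ‖boundaryValue φ t‖ ≤ 1 := by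
  filter_upwards [ae_tendsto_boundaryValue hφ hmaps] with t ht
  refine le_of_tendsto ht.norm ?_
  filter_upwards [Ico_mem_nhdsLT (zero_lt_one' ℝ)] with r hr
  exact (mem_ball_zero_iff.1 (hmaps (circleMap_mem_unitBall hr t))).le

/-- The function `1 / (1 - |φ*|)`, with `1 / 0 = ∞`. -/
def invBoundaryDist (φ : ℂ → ℂ) (t : ℝ) : ℝ≥0∞ := 1 / (1 - ‖boundaryValue φ t‖ₑ)

theorem aemeasurable_invBoundaryDist (hφ : DifferentiableOn ℂ φ (Metric.ball 0 1))
    (hmaps : MapsTo φ (Metric.ball 0 1) (Metric.ball 0 1)) :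
    AEMeasurable (invBoundaryDist φ) circleMeasure :=
  ((aestronglyMeasurable_boundaryValue hφ hmaps).enorm.const_sub 1).const_div 1

theorem invBoundaryDist_lt_top {t : ℝ} :
    invBoundaryDist φ t < ⊤ ↔ boundaryValue φ t ∈ Metric.ball (0 : ℂ) 1 := by
  simp [invBoundaryDist, ENNReal.inv_lt_top, ← ofReal_norm]

theorem lt_invBoundaryDist_iff {s t : ℝ} (hs : 0 < s) :
    ENNReal.ofReal (1 / s) < invBoundaryDist φ t ↔ 1 - ‖boundaryValue φ t‖ < s := by
  rw [invBoundaryDist, one_div, one_div, ENNReal.ofReal_inv_of_pos hs, ENNReal.inv_lt_inv,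
    ← ofReal_norm, ← ENNReal.ofReal_one, ← ENNReal.ofReal_sub _ (norm_nonneg _),
    ENNReal.ofReal_lt_ofReal_iff hs]

namespace OrliczFunction

variable {Ψ : OrliczFunction}

theorem chiTail_invBoundaryDist_iff :
    Ψ.ChiTail circleMeasure (invBoundaryDist φ) ↔ ∀ A : ℝ≥0, 0 < A → ∃ K : ℝ≥0,
      ∀ᶠ s in 𝓝[>] (0 : ℝ), circleMeasure {t | 1 - ‖boundaryValue φ t‖ < s} *
        Ψ.chi A (ENNReal.ofReal (1 / s)) ≤ K := by
  refine forall₂_congr fun A _ => exists_congr fun K => ⟨?_, fun h => ?_⟩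
  · rintro ⟨x₀, h⟩
    filter_upwards [Ioo_mem_nhdsGT (show (0 : ℝ) < 1 / (x₀ + 1) by positivity)] with s hs
    have hx₀ : (x₀ : ℝ) + 1 < 1 / s := (lt_one_div hs.1 (by positivity)).1 hs.2
    simpa only [lt_invBoundaryDist_iff hs.1] using h (ENNReal.ofReal (1 / s))
      (ENNReal.ofReal_coe_nnreal (p := x₀) ▸ ENNReal.ofReal_le_ofReal (by linarith))
  · obtain ⟨δ, hδ : 0 < δ, h⟩ := mem_nhdsGT_iff_exists_Ioo_subset.1 h
    refine ⟨(2 / δ).toNNReal, fun x hx => ?_⟩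
    rcases eq_or_ne x ⊤ with rfl | hx_top
    · simp
    have hδx : 2 / δ ≤ x.toReal := (ENNReal.ofReal_le_iff_le_toReal hx_top).1 hx
    have hxpos : 0 < x.toReal := (by positivity : 0 < 2 / δ).trans_le hδx
    have hs : 1 / x.toReal ∈ Ioo 0 δ := by
      refine ⟨by positivity, (one_div_lt hxpos hδ).2 (lt_of_lt_of_le ?_ hδx)⟩
      gcongr
      exact one_lt_two
    simpa only [mem_ofPred_eq, ← lt_invBoundaryDist_iff hs.1, one_div_one_div,
      ENNReal.ofReal_toReal hx_top] using h hs

theorem isBigO_tail_iff :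
    (∀ A : ℝ≥0, 0 < A →
      (fun s : ℝ => circleMeasure.real {t | 1 - ‖boundaryValue φ t‖ < s}) =O[𝓝[>] 0]
        fun s : ℝ => 1 / (Ψ.chi A (ENNReal.ofReal (1 / s))).toReal) ↔
      Ψ.ChiTail circleMeasure (invBoundaryDist φ) := by
  rw [chiTail_invBoundaryDist_iff]
  refine forall₂_congr fun A hA => ?_
  have norm_le_iff : ∀ s : ℝ, 0 < s → ∀ K : ℝ, 0 ≤ K →
      (‖circleMeasure.real {t | 1 - ‖boundaryValue φ t‖ < s}‖ ≤
        K * ‖1 / (Ψ.chi A (ENNReal.ofReal (1 / s))).toReal‖ ↔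
      circleMeasure {t | 1 - ‖boundaryValue φ t‖ < s} * Ψ.chi A (ENNReal.ofReal (1 / s)) ≤
        ENNReal.ofReal K) := fun s hs K hK => by
    have h0 : Ψ.chi A (ENNReal.ofReal (1 / s)) ≠ 0 :=
      Ψ.chi_ne_zero (by exact_mod_cast hA.ne') (by simpa using hs)
    have htop : Ψ.chi A (ENNReal.ofReal (1 / s)) ≠ ⊤ :=
      Ψ.chi_ne_top ENNReal.coe_ne_top ENNReal.ofReal_ne_top
    rw [Real.norm_of_nonneg measureReal_nonneg, Real.norm_of_nonneg (by positivity),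
      mul_one_div, le_div_iff₀ (ENNReal.toReal_pos h0 htop), Measure.real, ← ENNReal.toReal_mul]
    exact (ENNReal.le_ofReal_iff_toReal_le
      (ENNReal.mul_ne_top (measure_ne_top _ _) htop) hK).symm
  constructor
  · intro h
    obtain ⟨K, hK0, hK⟩ := h.exists_nonneg
    refine ⟨K.toNNReal, ?_⟩
    filter_upwards [hK.bound, self_mem_nhdsWithin] with s hs hs0
    exact (norm_le_iff s hs0 K hK0).1 hs
  · rintro ⟨K, h⟩
    refine IsBigO.of_bound K ?_
    filter_upwards [h, self_mem_nhdsWithin] with s hs hs0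
    rwa [norm_le_iff s hs0 K K.2, ENNReal.ofReal_coe_nnreal]

end OrliczFunction

end Boundary

/-! ### The functions `u_{a,r}` -/

/-- `v_{a,r}(z) = (1 - r) / (1 - \bar a r z)`: the square root of `u_{a,r}` with positive real
part. -/
def vFun (a : Circle) (r : ℝ) (z : ℂ) : ℂ := (1 - r) / (1 - (starRingEnd ℂ) (a : ℂ) * r * z)

section Kernels

variable {a : Circle} {r : ℝ} {z : ℂ}

theorem uFun_eq_sq (a : Circle) (r : ℝ) (z : ℂ) : uFun a r z = vFun a r z ^ 2 := rfl

theorem norm_one_sub_ofReal (hr : r ≤ 1) : ‖(1 - r : ℂ)‖ = 1 - r := by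
  rw [← Complex.ofReal_one, ← Complex.ofReal_sub, Complex.norm_of_nonneg (by linarith)]

theorem norm_conj_mul_ofReal_mul (a : Circle) (hr : 0 ≤ r) (z : ℂ) :
    ‖(starRingEnd ℂ) (a : ℂ) * r * z‖ = r * ‖z‖ := by
  rw [norm_mul, norm_mul, RCLike.norm_conj, Circle.norm_coe, one_mul, Complex.norm_of_nonneg hr]

theorem one_sub_mul_norm_le_re (a : Circle) (hr : 0 ≤ r) (z : ℂ) :
    1 - r * ‖z‖ ≤ (1 - (starRingEnd ℂ) (a : ℂ) * r * z).re := by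
  rw [Complex.sub_re, Complex.one_re, ← norm_conj_mul_ofReal_mul a hr]
  exact sub_le_sub_left (Complex.re_le_norm _) 1

theorem one_sub_le_re (a : Circle) (hr : 0 ≤ r) (hz : ‖z‖ ≤ 1) :
    1 - r ≤ (1 - (starRingEnd ℂ) (a : ℂ) * r * z).re :=
  (sub_le_sub_left (mul_le_of_le_one_right hr hz) 1).trans (one_sub_mul_norm_le_re a hr z)

theorem one_sub_conj_mul_ne_zero (a : Circle) (hr : r ∈ Ico (0 : ℝ) 1) (hz : ‖z‖ ≤ 1) :
    1 - (starRingEnd ℂ) (a : ℂ) * r * z ≠ 0 := fun h => by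
  have hre := one_sub_le_re a hr.1 hz
  rw [h, Complex.zero_re] at hre
  linarith [hr.2]

theorem norm_vFun (a : Circle) (hr : r ≤ 1) (z : ℂ) :
    ‖vFun a r z‖ = (1 - r) / ‖1 - (starRingEnd ℂ) (a : ℂ) * r * z‖ := by
  rw [vFun, norm_div, norm_one_sub_ofReal hr]

theorem norm_vFun_le_one (a : Circle) (hr : r ∈ Ico (0 : ℝ) 1) (hz : ‖z‖ ≤ 1) :
    ‖vFun a r z‖ ≤ 1 := by
  rw [norm_vFun a hr.2.le]
  exact div_le_one_of_le₀ ((one_sub_le_re a hr.1 hz).trans (Complex.re_le_norm _)) (norm_nonneg _)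

theorem norm_vFun_le (a : Circle) (hr : r ∈ Ico (0 : ℝ) 1) {R : ℝ} (hR : R < 1) (hz : ‖z‖ ≤ R) :
    ‖vFun a r z‖ ≤ (1 - r) / (1 - R) := by
  rw [norm_vFun a hr.2.le]
  refine div_le_div_of_nonneg_left (sub_nonneg.2 hr.2.le) (sub_pos.2 hR) ?_
  calc 1 - R ≤ 1 - r * ‖z‖ :=
        sub_le_sub_left ((mul_le_of_le_one_left (norm_nonneg z) hr.2.le).trans hz) 1
    _ ≤ ‖1 - (starRingEnd ℂ) (a : ℂ) * r * z‖ :=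
        (one_sub_mul_norm_le_re a hr.1 z).trans (Complex.re_le_norm _)

theorem sq_norm_vFun_le_re (a : Circle) (hr : r ∈ Ico (0 : ℝ) 1) (hz : ‖z‖ ≤ 1) :
    ‖vFun a r z‖ ^ 2 ≤ (vFun a r z).re := by
  have hre := one_sub_le_re a hr.1 hz
  rw [norm_vFun a hr.2.le, vFun]
  set d := 1 - (starRingEnd ℂ) (a : ℂ) * r * z
  have re_div : ((1 - r : ℂ) / d).re = (1 - r) * d.re / ‖d‖ ^ 2 := by
    rw [Complex.div_re, Complex.normSq_eq_norm_sq]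
    simp
  rw [re_div, div_pow, sq (1 - r)]
  exact div_le_div_of_nonneg_right (mul_le_mul_of_nonneg_left hre (sub_nonneg.2 hr.2.le))
    (sq_nonneg _)

theorem re_vFun_nonneg (a : Circle) (hr : r ∈ Ico (0 : ℝ) 1) (hz : ‖z‖ ≤ 1) :
    0 ≤ (vFun a r z).re := (sq_nonneg _).trans (sq_norm_vFun_le_re a hr hz)

theorem one_ninth_le_sq_norm_vFun (hr : r ∈ Ico (0 : ℝ) 1) (hz : ‖z‖ ≤ 1)
    (hza : ‖z - a‖ ≤ 2 * (1 - r)) : 1 / 9 ≤ ‖vFun a r z‖ ^ 2 := by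
  have conj_mul_self : (starRingEnd ℂ) (a : ℂ) * a = 1 := by
    rw [mul_comm, Complex.mul_conj, Circle.normSq_coe, Complex.ofReal_one]
  have norm_denom_le : ‖1 - (starRingEnd ℂ) (a : ℂ) * r * z‖ ≤ 3 * (1 - r) := by
    calc ‖1 - (starRingEnd ℂ) (a : ℂ) * r * z‖
        = ‖(1 - r : ℂ) - (starRingEnd ℂ) (a : ℂ) * r * (z - a)‖ := by
          congr 1
          linear_combination -(r : ℂ) * conj_mul_self
      _ ≤ (1 - r) + r * ‖z - a‖ := by
          rw [← norm_one_sub_ofReal hr.2.le, ← norm_conj_mul_ofReal_mul a hr.1]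
          exact norm_sub_le _ _
      _ ≤ 3 * (1 - r) := by
          have := mul_le_of_le_one_left (norm_nonneg (z - a)) hr.2.le
          linarith
  have hthird : 1 / 3 ≤ ‖vFun a r z‖ := by
    rw [norm_vFun a hr.2.le, le_div_iff₀ (norm_pos_iff.2 (one_sub_conj_mul_ne_zero a hr hz))]
    linarith
  calc (1 / 9 : ℝ) = (1 / 3) ^ 2 := by norm_num
    _ ≤ _ := by gcongr

theorem differentiableAt_vFun (a : Circle) (hr : r ∈ Ico (0 : ℝ) 1) (hz : ‖z‖ ≤ 1) :
    DifferentiableAt ℂ (vFun a r) z := by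
  unfold vFun
  exact DifferentiableAt.div (by fun_prop) (by fun_prop) (one_sub_conj_mul_ne_zero a hr hz)

theorem differentiableOn_vFun (a : Circle) (hr : r ∈ Ico (0 : ℝ) 1) :
    DifferentiableOn ℂ (vFun a r) (Metric.ball 0 1) := fun _ hz =>
  (differentiableAt_vFun a hr (mem_ball_zero_iff.1 hz).le).differentiableWithinAt

theorem continuousOn_vFun (a : Circle) (hr : r ∈ Ico (0 : ℝ) 1) :
    ContinuousOn (vFun a r) (Metric.closedBall 0 1) := fun _ hz =>
  (differentiableAt_vFun a hr (mem_closedBall_zero_iff.1 hz)).continuousAt.continuousWithinAt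

theorem norm_one_sub_conj_mul_circleMap (a : Circle) (r ρ t : ℝ) :
    ‖1 - (starRingEnd ℂ) (a : ℂ) * r * circleMap 0 ρ t‖ =
      ‖circleMap 0 1 t - a * (r * ρ : ℝ)‖ := by
  have conj_mul_self : (starRingEnd ℂ) (circleMap 0 1 t) * circleMap 0 1 t = 1 := by
    rw [mul_comm, Complex.mul_conj, Complex.normSq_eq_norm_sq]
    simp
  calc ‖1 - (starRingEnd ℂ) (a : ℂ) * r * circleMap 0 ρ t‖
      = ‖(starRingEnd ℂ) (circleMap 0 1 t - a * (r * ρ : ℝ)) * circleMap 0 1 t‖ := by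
        congr 1
        rw [map_sub, sub_mul, conj_mul_self, map_mul, Complex.conj_ofReal, ← mul_circleMap_one ρ t]
        push_cast
        ring
    _ = ‖circleMap 0 1 t - a * (r * ρ : ℝ)‖ := by
        rw [norm_mul, RCLike.norm_conj]
        simp

theorem sq_norm_vFun_circleMap_le (a : Circle) (hr : r ∈ Ico (0 : ℝ) 1) {ρ : ℝ}
    (hρ : ρ ∈ Ico (0 : ℝ) 1) (t : ℝ) :
    ‖vFun a r (circleMap 0 ρ t)‖ ^ 2 ≤ (1 - r) * discPoisson (a * (r * ρ : ℝ)) t := by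
  have hrρ : 0 ≤ r * ρ := mul_nonneg hr.1 hρ.1
  rw [norm_vFun a hr.2.le, norm_one_sub_conj_mul_circleMap, discPoisson_eq, norm_mul,
    Circle.norm_coe, one_mul, Complex.norm_of_nonneg hrρ, div_pow, ← mul_div_assoc, sq (1 - r)]
  refine div_le_div_of_nonneg_right (mul_le_mul_of_nonneg_left ?_ (sub_nonneg.2 hr.2.le))
    (sq_nonneg _)
  nlinarith [hr.1, hr.2, mul_le_of_le_one_right hr.1 hρ.2.le]

theorem lintegral_sq_enorm_vFun_le (a : Circle) (hr : r ∈ Ico (0 : ℝ) 1) {ρ : ℝ}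
    (hρ : ρ ∈ Ico (0 : ℝ) 1) :
    ∫⁻ t, ‖vFun a r (circleMap 0 ρ t)‖ₑ ^ 2 ∂circleMeasure ≤ ENNReal.ofReal (1 - r) := by
  have hmem : (a * (r * ρ : ℝ) : ℂ) ∈ Metric.ball (0 : ℂ) 1 := by
    rw [mem_ball_zero_iff, norm_mul, Circle.norm_coe, one_mul,
      Complex.norm_of_nonneg (mul_nonneg hr.1 hρ.1)]
    exact (mul_le_of_le_one_right hr.1 hρ.2.le).trans_lt hr.2
  calc ∫⁻ t, ‖vFun a r (circleMap 0 ρ t)‖ₑ ^ 2 ∂circleMeasure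
      ≤ ∫⁻ t, ENNReal.ofReal (1 - r) * ENNReal.ofReal (discPoisson (a * (r * ρ : ℝ)) t)
          ∂circleMeasure := by
        refine lintegral_mono fun t => ?_
        rw [← ENNReal.ofReal_mul (by linarith [hr.2]), ← ofReal_norm,
          ← ENNReal.ofReal_pow (norm_nonneg _)]
        exact ENNReal.ofReal_le_ofReal (sq_norm_vFun_circleMap_le a hr hρ t)
    _ = ENNReal.ofReal (1 - r) := by
        rw [lintegral_const_mul' _ _ ENNReal.ofReal_ne_top, lintegral_discPoisson hmem, mul_one]

end Kernels

theorem div_ofReal_one_div {c : ℝ} (hc : 0 < c) (x : ℝ≥0∞) :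
    x / ENNReal.ofReal (1 / c) = x * ENNReal.ofReal c := by
  rw [one_div, ENNReal.ofReal_inv_of_pos hc, div_eq_mul_inv, inv_inv]

namespace HardyOrlicz

variable {Ψ : OrliczFunction} {r : ℝ}

theorem uElem_apply (a : Circle) (hr : r ∈ Ico (0 : ℝ) 1) {z : ℂ}
    (hz : z ∈ Metric.ball (0 : ℂ) 1) : uElem Ψ a r z = uFun a r z := by
  rw [uElem, dif_pos hr]
  exact indicator_of_mem hz _

theorem eval_enorm_uElem_mul_growth_le (a : Circle) (hr : r ∈ Ico (0 : ℝ) 1) {z : ℂ}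
    (hz : z ∈ Metric.ball (0 : ℂ) 1) :
    Ψ.eval (‖uElem Ψ a r z‖ₑ * ENNReal.ofReal (Ψ.growth r)) ≤
      ENNReal.ofReal (1 / (1 - r)) * ‖vFun a r z‖ₑ ^ 2 := by
  have hle : ‖vFun a r z‖ₑ ^ 2 ≤ 1 := by
    refine pow_le_one₀ zero_le ?_
    rw [← ofReal_norm]
    exact ENNReal.ofReal_le_one.2 (norm_vFun_le_one a hr (mem_ball_zero_iff.1 hz).le)
  rw [uElem_apply a hr hz, uFun_eq_sq, enorm_pow, Ψ.ofReal_growth]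
  refine (Ψ.eval_mul_le hle _).trans_eq ?_
  rw [Ψ.eval_inv, mul_comm]

theorem norm_uElem_le (a : Circle) (hr : r ∈ Ico (0 : ℝ) 1) :
    ‖uElem Ψ a r‖ ≤ 1 / Ψ.growth r := by
  have hg := Ψ.growth_pos hr.2
  have hr' : 0 < 1 - r := sub_pos.2 hr.2
  have hmod : ∀ ρ ∈ Ico (0 : ℝ) 1, Ψ.modular circleMeasure (ENNReal.ofReal (1 / Ψ.growth r))
      (fun t => uElem Ψ a r (circleMap 0 ρ t)) ≤ 1 := fun ρ hρ =>
    calc Ψ.modular circleMeasure (ENNReal.ofReal (1 / Ψ.growth r))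
          (fun t => uElem Ψ a r (circleMap 0 ρ t))
        ≤ ∫⁻ t, ENNReal.ofReal (1 / (1 - r)) * ‖vFun a r (circleMap 0 ρ t)‖ₑ ^ 2
            ∂circleMeasure := by
          refine lintegral_mono fun t => ?_
          rw [div_ofReal_one_div hg]
          exact eval_enorm_uElem_mul_growth_le a hr (circleMap_mem_unitBall hρ t)
      _ = ENNReal.ofReal (1 / (1 - r)) *
            ∫⁻ t, ‖vFun a r (circleMap 0 ρ t)‖ₑ ^ 2 ∂circleMeasure :=
          lintegral_const_mul' _ _ ENNReal.ofReal_ne_top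
      _ ≤ ENNReal.ofReal (1 / (1 - r)) * ENNReal.ofReal (1 - r) :=
          mul_le_mul_right (lintegral_sq_enorm_vFun_le a hr hρ) _
      _ = 1 := by
          rw [← ENNReal.ofReal_mul (by positivity), one_div_mul_cancel hr'.ne', ENNReal.ofReal_one]
  have hle := enorm_le_of_modular_slice_le (by simpa using hg) le_rfl ENNReal.one_ne_top hmod
  rw [one_mul, ← ofReal_norm] at hle
  exact (ENNReal.ofReal_le_ofReal_iff (by positivity)).1 hle

end HardyOrlicz

/-! ### Small windows -/

namespace OrliczFunction

variable {φ : ℂ → ℂ} {Ψ : OrliczFunction}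

/-- For every `A`, the probability that `φ*` falls in a window of radius `2 h` around a point of
the circle is at most a constant times `1 / χ_A(1 / h)`, uniformly in the window. -/
def ChiWindow (Ψ : OrliczFunction) (φ : ℂ → ℂ) : Prop :=
  ∀ A : ℝ≥0, 0 < A → ∃ K : ℝ≥0, ∀ᶠ h in 𝓝[>] (0 : ℝ), ∀ a : Circle,
    circleMeasure {t | ‖boundaryValue φ t - a‖ ≤ 2 * h} * Ψ.chi A (ENNReal.ofReal (1 / h)) ≤ K

theorem measure_mul_eval_le_modular {Ω E : Type*} [MeasurableSpace Ω] {μ : Measure Ω}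
    [TopologicalSpace E] [ContinuousENorm E] {f : Ω → E} (hf : AEStronglyMeasurable f μ)
    {C y : ℝ≥0∞} {s : Set Ω} (hy : ∀ᵐ x ∂μ, x ∈ s → y ≤ ‖f x‖ₑ / C) :
    μ s * Ψ.eval y ≤ Ψ.modular μ C f := by
  calc μ s * Ψ.eval y ≤ Ψ.eval y * μ {x | Ψ.eval y ≤ Ψ.eval (‖f x‖ₑ / C)} := by
        rw [mul_comm]
        exact mul_le_mul_right (measure_mono_ae (hy.mono fun x hx hxs => Ψ.eval_mono (hx hxs))) _
    _ ≤ Ψ.modular μ C f :=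
        mul_meas_ge_le_lintegral₀ (Ψ.measurable_eval.comp_aemeasurable (hf.enorm.div_const C)) _

theorem measure_boundaryValue_mul_eval_le (hφ : DifferentiableOn ℂ φ (Metric.ball 0 1))
    (hmaps : MapsTo φ (Metric.ball 0 1) (Metric.ball 0 1)) {G : ℂ → ℂ}
    (hG : ContinuousOn G (Metric.closedBall 0 1)) {C K y : ℝ≥0∞} (hC : C ≠ 0)
    (hK : ∀ r ∈ Ico (0 : ℝ) 1, Ψ.modular circleMeasure C (fun t => G (φ (circleMap 0 r t))) ≤ K)
    {E : Set ℂ} (hy : ∀ w ∈ E, ‖w‖ ≤ 1 → y ≤ ‖G w‖ₑ / C) :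
    circleMeasure {t | boundaryValue φ t ∈ E} * Ψ.eval y ≤ K := by
  have hmem : ∀ r ∈ Ico (0 : ℝ) 1, ∀ t, φ (circleMap 0 r t) ∈ Metric.closedBall (0 : ℂ) 1 :=
    fun r hr t => Metric.ball_subset_closedBall (hmaps (circleMap_mem_unitBall hr t))
  have hmeas : ∀ r ∈ Ico (0 : ℝ) 1,
      AEStronglyMeasurable (fun t => G (φ (circleMap 0 r t))) circleMeasure := fun r hr =>
    (hG.comp_continuous (continuous_circle_slice hφ hr) (hmem r hr)).aestronglyMeasurable
  have hlim : ∀ᵐ t ∂circleMeasure, Tendsto (fun r => G (φ (circleMap 0 r t))) (𝓝[<] 1)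
      (𝓝 (G (boundaryValue φ t))) := by
    filter_upwards [ae_tendsto_boundaryValue hφ hmaps, ae_norm_boundaryValue_le hφ hmaps]
      with t ht ht1
    refine (hG _ (mem_closedBall_zero_iff.2 ht1)).tendsto.comp
      (tendsto_nhdsWithin_iff.2 ⟨ht, ?_⟩)
    filter_upwards [Ico_mem_nhdsLT (zero_lt_one' ℝ)] with r hr using hmem r hr t
  have hev : ∀ᶠ r in 𝓝[<] (1 : ℝ), r ∈ Ico (0 : ℝ) 1 := Ico_mem_nhdsLT (zero_lt_one' ℝ)
  calc circleMeasure {t | boundaryValue φ t ∈ E} * Ψ.eval y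
      ≤ Ψ.modular circleMeasure C (fun t => G (boundaryValue φ t)) :=
        measure_mul_eval_le_modular
          (aestronglyMeasurable_of_tendsto_of_eventually (hev.mono hmeas) hlim)
          ((ae_norm_boundaryValue_le hφ hmaps).mono fun t ht hE => hy _ hE ht)
    _ ≤ K := Ψ.modular_le_of_tendsto hC (hev.mono hmeas) hlim (hev.mono hK)

open HardyOrlicz in
theorem measure_window_mul_chi_le (hφ : DifferentiableOn ℂ φ (Metric.ball 0 1))
    (hmaps : MapsTo φ (Metric.ball 0 1) (Metric.ball 0 1)) {A : ℝ≥0} (hA : 0 < A) {a : Circle}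
    {r : ℝ} (hr : r ∈ Ico (0 : ℝ) 1)
    (h : ‖compCLM (Ψ := Ψ) hφ hmaps (uElem Ψ a r)‖ < 1 / (9 * A * Ψ.growth r)) :
    circleMeasure {t | ‖boundaryValue φ t - a‖ ≤ 2 * (1 - r)} *
      Ψ.chi A (ENNReal.ofReal (1 / (1 - r))) ≤ 1 := by
  have hD : 0 < 9 * A * Ψ.growth r := by
    have := Ψ.growth_pos hr.2
    positivity
  have hC : ENNReal.ofReal (1 / (9 * A * Ψ.growth r)) ≠ 0 :=
    (ENNReal.ofReal_pos.2 (one_div_pos.2 hD)).ne'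
  have hcont : ContinuousOn (uFun a r) (Metric.closedBall 0 1) := (continuousOn_vFun a hr).pow 2
  refine measure_boundaryValue_mul_eval_le (E := {w | ‖w - a‖ ≤ 2 * (1 - r)}) hφ hmaps hcont hC
    (fun ρ hρ => ?_) fun w hwa hw => ?_
  · have hlt : ‖compCLM (Ψ := Ψ) hφ hmaps (uElem Ψ a r)‖ₑ <
        ENNReal.ofReal (1 / (9 * A * Ψ.growth r)) := by
      rw [← ofReal_norm]
      exact (ENNReal.ofReal_lt_ofReal_iff (by positivity)).2 h
    have slice_eq : (fun t => uFun a r (φ (circleMap 0 ρ t))) =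
        fun t => compCLM (Ψ := Ψ) hφ hmaps (uElem Ψ a r) (circleMap 0 ρ t) := funext fun t => by
      have hmem := circleMap_mem_unitBall hρ t
      rw [compCLM_apply hφ hmaps _ hmem, uElem_apply a hr (hmaps hmem)]
    rw [slice_eq]
    exact modular_slice_le_one hlt hρ
  · have hninth : 1 / 9 ≤ ‖uFun a r w‖ := by
      rw [uFun_eq_sq, norm_pow]
      exact one_ninth_le_sq_norm_vFun hr hw hwa
    calc A * Ψ.inv (ENNReal.ofReal (1 / (1 - r)))
        = ENNReal.ofReal (1 / 9) * ENNReal.ofReal (9 * A * Ψ.growth r) := by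
          rw [← Ψ.ofReal_growth, ← ENNReal.ofReal_coe_nnreal, ← ENNReal.ofReal_mul A.coe_nonneg,
            ← ENNReal.ofReal_mul (by norm_num)]
          ring_nf
      _ ≤ ‖uFun a r w‖ₑ / ENNReal.ofReal (1 / (9 * A * Ψ.growth r)) := by
          rw [div_ofReal_one_div hD, ← ofReal_norm]
          gcongr

theorem tendsto_one_sub_nhdsGT_zero : Tendsto (fun h : ℝ => 1 - h) (𝓝[>] 0) (𝓝[<] 1) := by
  refine tendsto_nhdsWithin_iff.2 ⟨?_, ?_⟩
  · exact (Continuous.tendsto' (by fun_prop) _ _ (sub_zero 1)).mono_left nhdsWithin_le_nhds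
  · filter_upwards [self_mem_nhdsWithin] with h hh using sub_lt_self (1 : ℝ) (mem_Ioi.1 hh)

open HardyOrlicz in
theorem ChiWindow.of_isLittleO (hφ : DifferentiableOn ℂ φ (Metric.ball 0 1))
    (hmaps : MapsTo φ (Metric.ball 0 1) (Metric.ball 0 1))
    (h : (fun r : ℝ => ⨆ a : Circle, ‖compCLM (Ψ := Ψ) hφ hmaps (uElem Ψ a r)‖) =o[𝓝[<] 1]
      fun r : ℝ => 1 / (Ψ.inv (ENNReal.ofReal (1 / (1 - r)))).toReal) : Ψ.ChiWindow φ := by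
  intro A hA
  have hbound := h.def (show (0 : ℝ) < 1 / (18 * A) by positivity)
  refine ⟨1, ?_⟩
  filter_upwards [tendsto_one_sub_nhdsGT_zero.eventually hbound, tendsto_one_sub_nhdsGT_zero
    (Ico_mem_nhdsLT (zero_lt_one' ℝ))] with s hs hmem a
  have hg := Ψ.growth_pos hmem.2
  have hbdd : BddAbove (range fun b : Circle =>
      ‖compCLM (Ψ := Ψ) hφ hmaps (uElem Ψ b (1 - s))‖) := by
    refine ⟨‖compCLM (Ψ := Ψ) hφ hmaps‖ * (1 / Ψ.growth (1 - s)), ?_⟩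
    rintro _ ⟨b, rfl⟩
    exact (compCLM hφ hmaps).le_opNorm_of_le (norm_uElem_le b hmem)
  have hlt : ‖compCLM (Ψ := Ψ) hφ hmaps (uElem Ψ a (1 - s))‖ <
      1 / (9 * A * Ψ.growth (1 - s)) := by
    calc _ ≤ _ := le_ciSup hbdd a
      _ ≤ 1 / (18 * A) * ‖1 / Ψ.growth (1 - s)‖ := (le_abs_self _).trans hs
      _ = 1 / (18 * A * Ψ.growth (1 - s)) := by
        rw [Real.norm_of_nonneg (by positivity), div_mul_div_comm, mul_one]
      _ < 1 / (9 * A * Ψ.growth (1 - s)) := by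
        gcongr
        norm_num
  simpa only [sub_sub_cancel, ENNReal.coe_one] using measure_window_mul_chi_le hφ hmaps hA hmem hlt

end OrliczFunction

section Cover

theorem exists_abs_sub_mul_div_le {N : ℕ} (hN : 0 < N) {L x : ℝ} (hL : 0 < L)
    (hx : x ∈ Icc 0 L) : ∃ j ∈ Finset.range (N + 1), |x - L * j / N| ≤ L / N := by
  have hN' : (0 : ℝ) < N := Nat.cast_pos.2 hN
  set y := x * N / L with hy
  have hy0 : 0 ≤ y := div_nonneg (mul_nonneg hx.1 hN'.le) hL.le
  have hyN : y ≤ N := by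
    rw [hy, div_le_iff₀ hL, mul_comm (N : ℝ)]
    exact mul_le_mul_of_nonneg_right hx.2 hN'.le
  refine ⟨⌊y⌋₊, Finset.mem_range.2 (Nat.lt_succ_of_le (Nat.floor_le_of_le hyN)), ?_⟩
  have hsub : x - L * ⌊y⌋₊ / N = (y - ⌊y⌋₊) * (L / N) := by
    rw [hy]
    field_simp
  rw [hsub, abs_of_nonneg (mul_nonneg (sub_nonneg.2 (Nat.floor_le hy0)) (by positivity))]
  refine mul_le_of_le_one_left (by positivity) ?_
  linarith [Nat.lt_floor_add_one y]

theorem norm_circleMap_sub_circleMap_one {ρ : ℝ} (hρ : ρ ≤ 1) (θ : ℝ) :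
    ‖circleMap 0 ρ θ - circleMap 0 1 θ‖ = 1 - ρ := by
  have hsub : circleMap 0 ρ θ - circleMap 0 1 θ = (ρ - 1 : ℝ) * circleMap 0 1 θ := by
    rw [← mul_circleMap_one ρ θ]
    push_cast
    ring
  rw [hsub, norm_mul, Complex.norm_real, Real.norm_of_nonpos (by linarith)]
  simp

theorem exists_norm_sub_circleExp_eq {w : ℂ} (hw : ‖w‖ ≤ 1) :
    ∃ θ ∈ Icc 0 (2 * Real.pi), ‖w - Circle.exp θ‖ = 1 - ‖w‖ := by
  obtain ⟨θ, hθ, hθw⟩ : w ∈ circleMap 0 ‖w‖ '' Ioc 0 (2 * Real.pi) := by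
    rw [image_circleMap_Ioc]
    simp
  have hexp : (Circle.exp θ : ℂ) = circleMap 0 1 θ := by
    simp [Circle.coe_exp, circleMap]
  refine ⟨θ, Ioc_subset_Icc_self hθ, ?_⟩
  conv_lhs => rw [← hθw]
  rw [hexp]
  exact norm_circleMap_sub_circleMap_one hw θ

theorem exists_norm_sub_circle_le {w : ℂ} {s : ℝ} (hw : 1 - ‖w‖ < s) (hw1 : ‖w‖ ≤ 1) {N : ℕ}
    (hN : 0 < N) (hNs : 2 * Real.pi / N ≤ s) :
    ∃ j ∈ Finset.range (N + 1), ‖w - Circle.exp (2 * Real.pi * j / N)‖ ≤ 2 * s := by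
  obtain ⟨θ, hθ, hradial⟩ := exists_norm_sub_circleExp_eq hw1
  obtain ⟨j, hj, hjs⟩ := exists_abs_sub_mul_div_le hN Real.two_pi_pos hθ
  refine ⟨j, hj, ?_⟩
  set β := 2 * Real.pi * j / N
  have hlip : ‖(Circle.exp θ : ℂ) - Circle.exp β‖ ≤ |θ - β| := by
    simpa [dist_eq_norm, Real.dist_eq, Circle.coe_exp, circleMap] using
      (lipschitzWith_circleMap 0 1).dist_le_mul θ β
  linarith [norm_sub_le_norm_sub_add_norm_sub w (Circle.exp θ) (Circle.exp β)]

variable {φ : ℂ → ℂ}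

theorem measure_one_sub_norm_boundaryValue_lt_le (hφ : DifferentiableOn ℂ φ (Metric.ball 0 1))
    (hmaps : MapsTo φ (Metric.ball 0 1) (Metric.ball 0 1)) {s : ℝ} (hs0 : 0 < s) (hs1 : s ≤ 1) :
    circleMeasure {t | 1 - ‖boundaryValue φ t‖ < s} ≤ 9 * ENNReal.ofReal (1 / s) *
      ⨆ a : Circle, circleMeasure {t | ‖boundaryValue φ t - a‖ ≤ 2 * s} := by
  have hL : 0 < 2 * Real.pi / s := div_pos Real.two_pi_pos hs0
  set N := ⌈2 * Real.pi / s⌉₊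
  have hN : 0 < N := Nat.ceil_pos.2 hL
  have hNs : 2 * Real.pi / N ≤ s := by
    rw [div_le_comm₀ (Nat.cast_pos.2 hN) hs0]
    exact Nat.le_ceil _
  have hcard : ((N + 1 : ℕ) : ℝ≥0∞) ≤ 9 * ENNReal.ofReal (1 / s) := by
    have hreal : ((N + 1 : ℕ) : ℝ) ≤ 9 * (1 / s) := by
      have hceil : (N : ℝ) ≤ 2 * Real.pi / s + 1 := (Nat.ceil_lt_add_one hL.le).le
      have hle : 2 * Real.pi / s + 2 ≤ 9 * (1 / s) := by
        rw [mul_one_div, div_add' _ _ _ hs0.ne']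
        refine div_le_div_of_nonneg_right ?_ hs0.le
        linarith [Real.pi_lt_d2]
      push_cast
      linarith
    rw [← ENNReal.ofReal_ofNat, ← ENNReal.ofReal_mul (by norm_num), ← ENNReal.ofReal_natCast]
    exact ENNReal.ofReal_le_ofReal hreal
  set E : ℕ → Set ℝ := fun j =>
    {t | ‖boundaryValue φ t - Circle.exp (2 * Real.pi * j / N)‖ ≤ 2 * s}
  calc circleMeasure {t | 1 - ‖boundaryValue φ t‖ < s}
      ≤ ∑ j ∈ Finset.range (N + 1), circleMeasure (E j) := by
        refine le_trans (measure_mono_ae ?_) (measure_biUnion_finset_le (Finset.range (N + 1)) E)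
        filter_upwards [ae_norm_boundaryValue_le hφ hmaps] with t ht hts
        obtain ⟨j, hj, hj'⟩ := exists_norm_sub_circle_le hts ht hN hNs
        exact mem_biUnion (Finset.mem_coe.2 hj) hj'
    _ ≤ ((N + 1 : ℕ) : ℝ≥0∞) *
          ⨆ a : Circle, circleMeasure {t | ‖boundaryValue φ t - a‖ ≤ 2 * s} := by
        refine (Finset.sum_le_card_nsmul _ _ _ fun j _ => le_iSup (fun a : Circle =>
          circleMeasure {t | ‖boundaryValue φ t - a‖ ≤ 2 * s}) _).trans_eq ?_
        rw [Finset.card_range, nsmul_eq_mul]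
    _ ≤ _ := mul_le_mul_left hcard _

theorem OrliczFunction.ChiWindow.chiTail {Ψ : OrliczFunction} (hΨ : Ψ.SatisfiesDelta2)
    (hφ : DifferentiableOn ℂ φ (Metric.ball 0 1))
    (hmaps : MapsTo φ (Metric.ball 0 1) (Metric.ball 0 1)) (h : Ψ.ChiWindow φ) :
    Ψ.ChiTail circleMeasure (invBoundaryDist φ) := by
  rw [chiTail_invBoundaryDist_iff]
  intro A _
  obtain ⟨α, hα, hχ⟩ := hΨ.exists_chi_sq_le
  set A' := max A 1
  have hA' : 0 < A' := zero_lt_one.trans_le (le_max_right _ _)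
  obtain ⟨x₀, hx₀, hsq⟩ := hχ A' hA'.ne'
  obtain ⟨K, hK⟩ := h (α * A') (mul_pos (zero_lt_one.trans hα) hA')
  have hlarge : ∀ᶠ s in 𝓝[>] (0 : ℝ), x₀ ≤ ENNReal.ofReal (1 / s) := by
    filter_upwards [tendsto_inv_nhdsGT_zero.eventually_ge_atTop x₀.toReal] with s hs
    rw [one_div]
    exact (ENNReal.ofReal_toReal hx₀).symm.trans_le (ENNReal.ofReal_le_ofReal hs)
  refine ⟨9 * K, ?_⟩
  filter_upwards [hK, hlarge, Ioc_mem_nhdsGT one_pos] with s hsK hsx hs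
  set x := ENNReal.ofReal (1 / s)
  set W := ⨆ a : Circle, circleMeasure {t | ‖boundaryValue φ t - a‖ ≤ 2 * s}
  have hχA : Ψ.chi A x ≤ Ψ.chi A' x :=
    Ψ.chi_mono_left x (ENNReal.coe_le_coe.2 (le_max_left _ _))
  have hxχ : x ≤ Ψ.chi A' x := by
    simpa only [ENNReal.coe_one, Ψ.chi_one] using
      Ψ.chi_mono_left x (ENNReal.coe_le_coe.2 (le_max_right A 1))
  calc circleMeasure {t | 1 - ‖boundaryValue φ t‖ < s} * Ψ.chi A x
      ≤ 9 * x * W * Ψ.chi A' x := by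
        gcongr
        exact measure_one_sub_norm_boundaryValue_lt_le hφ hmaps hs.1 hs.2
    _ = 9 * (W * (x * Ψ.chi A' x)) := by ring
    _ ≤ 9 * (W * Ψ.chi (α * A' : ℝ≥0) x) := by
        gcongr
        refine le_trans ?_ (hsq x hsx)
        rw [sq]
        gcongr
    _ ≤ 9 * K := by
        gcongr
        rw [ENNReal.iSup_mul]
        exact iSup_le hsK
    _ = ((9 * K : ℝ≥0) : ℝ≥0∞) := by push_cast; rfl

end Cover

/-! ### From a modular bound to `L¹` convergence -/

namespace OrliczFunction

variable {Ω ι E : Type*} [MeasurableSpace Ω] {μ : Measure Ω} [NormedAddCommGroup E]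
  (Ψ : OrliczFunction)

theorem exists_le_min_add_eval {ε : ℝ≥0} {C : ℝ≥0∞} (hε : 0 < ε) (hC : C ≠ 0) (hC_top : C ≠ ⊤) :
    ∃ M : ℝ≥0, ∀ x : ℝ≥0∞, x ≤ min x M + ε * Ψ.eval (x / C) := by
  lift C to ℝ≥0 using hC_top
  have hC' : 0 < C := pos_iff_ne_zero.2 (by simpa using hC)
  obtain ⟨Y, hY⟩ := eventually_atTop.1
    ((Ψ.tendsto_div.eventually_ge_atTop (C / ε : ℝ)).and (eventually_gt_atTop 0))
  refine ⟨C * Y.toNNReal, fun x => ?_⟩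
  rcases le_total x ((C * Y.toNNReal : ℝ≥0) : ℝ≥0∞) with hx | hx
  · rw [min_eq_left hx]
    exact le_self_add
  refine le_trans ?_ le_add_self
  rcases eq_or_ne x ⊤ with rfl | hx_top
  · simp [Ψ.eval_top, ENNReal.top_div, ENNReal.mul_top, hε.ne']
  lift x to ℝ≥0 using hx_top
  have hYx : Y ≤ x / C := by
    rw [le_div_iff₀ (by exact_mod_cast hC'), mul_comm]
    have : C * Y.toNNReal ≤ x := by exact_mod_cast hx
    exact (mul_le_mul_of_nonneg_left Y.le_coe_toNNReal C.2).trans (by exact_mod_cast this)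
  obtain ⟨hslope, hpos⟩ := hY _ hYx
  rw [le_div_iff₀ hpos, div_mul_div_cancel₀' (by exact_mod_cast hC'.ne'),
    div_le_iff₀' (by exact_mod_cast hε)] at hslope
  rw [← ENNReal.coe_div hC'.ne', ← ENNReal.ofReal_coe_nnreal (p := x / C),
    ← ENNReal.ofReal_coe_nnreal (p := ε), ← ENNReal.ofReal_coe_nnreal (p := x), NNReal.coe_div,
    Ψ.eval_ofReal hpos.le, ← ENNReal.ofReal_mul ε.coe_nonneg]
  exact ENNReal.ofReal_le_ofReal hslope

theorem eval_enorm_sub_le (x y : E) (C : ℝ≥0∞) :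
    Ψ.eval (‖x - y‖ₑ / (2 * C)) ≤ 2⁻¹ * Ψ.eval (‖x‖ₑ / C) + 2⁻¹ * Ψ.eval (‖y‖ₑ / C) := by
  refine (Ψ.eval_mono ?_).trans (Ψ.eval_convex ENNReal.inv_two_add_inv_two)
  rw [← mul_add, ← ENNReal.add_div, div_eq_mul_inv, div_eq_mul_inv,
    ENNReal.mul_inv (Or.inl two_ne_zero) (Or.inl ENNReal.ofNat_ne_top), mul_left_comm]
  gcongr
  exact enorm_sub_le

theorem modular_sub_le {f g : Ω → E} (hf : AEStronglyMeasurable f μ) (C : ℝ≥0∞) :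
    Ψ.modular μ (2 * C) (f - g) ≤ 2⁻¹ * Ψ.modular μ C f + 2⁻¹ * Ψ.modular μ C g := by
  have hfm : AEMeasurable (fun x => Ψ.eval (‖f x‖ₑ / C)) μ :=
    Ψ.measurable_eval.comp_aemeasurable (hf.enorm.div_const C)
  calc Ψ.modular μ (2 * C) (f - g)
      ≤ ∫⁻ x, (2⁻¹ * Ψ.eval (‖f x‖ₑ / C) + 2⁻¹ * Ψ.eval (‖g x‖ₑ / C)) ∂μ :=
        lintegral_mono fun x => Ψ.eval_enorm_sub_le _ _ C
    _ = _ := by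
        rw [lintegral_add_left' (hfm.const_mul _), lintegral_const_mul' _ _ (by simp),
          lintegral_const_mul' _ _ (by simp)]
        rfl

variable [IsFiniteMeasure μ] {C : ℝ≥0∞}

theorem lintegral_enorm_lt_top_of_modular_lt_top (hC : C ≠ 0) (hC_top : C ≠ ⊤) {f : Ω → E}
    (hf : Ψ.modular μ C f < ⊤) : ∫⁻ x, ‖f x‖ₑ ∂μ < ⊤ := by
  obtain ⟨M, hM⟩ := Ψ.exists_le_min_add_eval one_pos hC hC_top
  calc ∫⁻ x, ‖f x‖ₑ ∂μ ≤ ∫⁻ x, (M + Ψ.eval (‖f x‖ₑ / C)) ∂μ := by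
        refine lintegral_mono fun x => (hM _).trans ?_
        rw [ENNReal.coe_one, one_mul]
        gcongr
        exact min_le_right _ _
    _ = M * μ univ + Ψ.modular μ C f := by
        rw [lintegral_add_left measurable_const, lintegral_const]
        rfl
    _ < ⊤ := ENNReal.add_lt_top.2
        ⟨ENNReal.mul_lt_top ENNReal.coe_lt_top (measure_lt_top μ univ), hf⟩

theorem tendsto_lintegral_enorm_of_modular_le {u : Filter ι} [u.IsCountablyGenerated]
    (hC : C ≠ 0) (hC_top : C ≠ ⊤) {K : ℝ≥0∞} (hK_top : K ≠ ⊤) {f : ι → Ω → E}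
    (hf : ∀ᶠ i in u, AEStronglyMeasurable (f i) μ)
    (hlim : ∀ᵐ x ∂μ, Tendsto (fun i => f i x) u (𝓝 0))
    (hK : ∀ᶠ i in u, Ψ.modular μ C (f i) ≤ K) :
    Tendsto (fun i => ∫⁻ x, ‖f i x‖ₑ ∂μ) u (𝓝 0) := by
  rw [ENNReal.tendsto_nhds_zero]
  intro ε hε
  obtain ⟨δ, hδ, hδK⟩ := ENNReal.exists_nnreal_pos_mul_lt hK_top (ENNReal.half_pos hε.ne').ne'
  obtain ⟨M, hM⟩ := Ψ.exists_le_min_add_eval hδ hC hC_top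
  have hmin : Tendsto (fun i => ∫⁻ x, min ‖f i x‖ₑ M ∂μ) u (𝓝 (∫⁻ _, 0 ∂μ)) := by
    refine tendsto_lintegral_filter_of_dominated_convergence' (fun _ => M)
      (hf.mono fun i hi => hi.enorm.min aemeasurable_const)
      (Eventually.of_forall fun i => ae_of_all _ fun x => min_le_right _ _)
      (by simp [ENNReal.mul_eq_top]) ?_
    filter_upwards [hlim] with x hx
    simpa using hx.enorm.min (tendsto_const_nhds (x := (M : ℝ≥0∞)))
  rw [lintegral_zero] at hmin
  filter_upwards [hf, hK, ENNReal.tendsto_nhds_zero.1 hmin _ (ENNReal.half_pos hε.ne')]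
    with i hfi hKi hi
  calc ∫⁻ x, ‖f i x‖ₑ ∂μ ≤ ∫⁻ x, (min ‖f i x‖ₑ M + δ * Ψ.eval (‖f i x‖ₑ / C)) ∂μ :=
        lintegral_mono fun x => hM _
    _ = ∫⁻ x, min ‖f i x‖ₑ M ∂μ + δ * Ψ.modular μ C (f i) := by
        rw [lintegral_add_left' (hfi.enorm.min aemeasurable_const),
          lintegral_const_mul' _ _ ENNReal.coe_ne_top]
        rfl
    _ ≤ ε / 2 + ε / 2 := by
        gcongr
        exact (mul_le_mul_right hKi _).trans hδK.le
    _ = ε := ENNReal.add_halves ε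

end OrliczFunction

namespace HardyOrlicz

variable {Ψ : OrliczFunction} {φ : ℂ → ℂ} {g : HardyOrlicz Ψ} {l : ℝ → ℂ}

theorem continuousAt (f : HardyOrlicz Ψ) {z : ℂ} (hz : z ∈ Metric.ball (0 : ℂ) 1) :
    ContinuousAt f z :=
  f.differentiableOn.continuousOn.continuousAt (Metric.isOpen_ball.mem_nhds hz)

theorem tendsto_lintegral_slice_sub
    (hl : ∀ᵐ t ∂circleMeasure, Tendsto (fun r => g (circleMap 0 r t)) (𝓝[<] 1) (𝓝 (l t))) :
    Integrable l circleMeasure ∧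
      Tendsto (fun r => ∫⁻ t, ‖g (circleMap 0 r t) - l t‖ₑ ∂circleMeasure) (𝓝[<] 1) (𝓝 0) := by
  have hmeas : ∀ᶠ r in 𝓝[<] (1 : ℝ),
      AEStronglyMeasurable (fun t => g (circleMap 0 r t)) circleMeasure := by
    filter_upwards [Ico_mem_nhdsLT (zero_lt_one' ℝ)] with r hr
    exact (continuous_circle_slice g.differentiableOn hr).aestronglyMeasurable
  have hC : ‖g‖ₑ + 1 ≠ 0 := by simp
  have hC_top : ‖g‖ₑ + 1 ≠ ⊤ := by simp
  have hslice : ∀ᶠ r in 𝓝[<] (1 : ℝ),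
      Ψ.modular circleMeasure (‖g‖ₑ + 1) (fun t => g (circleMap 0 r t)) ≤ 1 := by
    filter_upwards [Ico_mem_nhdsLT (zero_lt_one' ℝ)] with r hr
    exact modular_slice_le_one (ENNReal.lt_add_right enorm_ne_top one_ne_zero) hr
  have hlm := aestronglyMeasurable_of_tendsto_of_eventually hmeas hl
  have hl_le := Ψ.modular_le_of_tendsto hC hmeas hl hslice
  refine ⟨⟨hlm, Ψ.lintegral_enorm_lt_top_of_modular_lt_top hC hC_top
    (hl_le.trans_lt ENNReal.one_lt_top)⟩, ?_⟩
  refine Ψ.tendsto_lintegral_enorm_of_modular_le (f := fun r t => g (circleMap 0 r t) - l t)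
    (C := 2 * (‖g‖ₑ + 1)) (mul_ne_zero two_ne_zero hC)
    (ENNReal.mul_ne_top ENNReal.ofNat_ne_top hC_top) ENNReal.one_ne_top
    (hmeas.mono fun r hr => hr.sub hlm) ?_ ?_
  · filter_upwards [hl] with t ht
    simpa using ht.sub_const (l t)
  · filter_upwards [hmeas, hslice] with r hr hr1
    calc _ ≤ _ := Ψ.modular_sub_le hr _
      _ ≤ 2⁻¹ * 1 + 2⁻¹ * 1 := by gcongr
      _ = 1 := by rw [mul_one, ENNReal.inv_two_add_inv_two]

theorem integral_discPoisson_smul_of_tendsto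
    (hl : ∀ᵐ t ∂circleMeasure, Tendsto (fun r => g (circleMap 0 r t)) (𝓝[<] 1) (𝓝 (l t)))
    {z : ℂ} (hz : z ∈ Metric.ball (0 : ℂ) 1) :
    ∫ t, discPoisson z t • l t ∂circleMeasure = g z := by
  obtain ⟨hli, hL1⟩ := tendsto_lintegral_slice_sub hl
  have hPb : ∀ t, ‖discPoisson z t‖ₑ ≤ ENNReal.ofReal ((1 + ‖z‖) / (1 - ‖z‖)) := fun t => by
    rw [← ofReal_norm, Real.norm_of_nonneg (discPoisson_nonneg hz t)]
    exact ENNReal.ofReal_le_ofReal (discPoisson_le hz t)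
  have hPsub : ∀ (x y : ℂ) t, ‖discPoisson z t • x - discPoisson z t • y‖ₑ ≤
      ENNReal.ofReal ((1 + ‖z‖) / (1 - ‖z‖)) * ‖x - y‖ₑ := fun x y t => by
    rw [← smul_sub, enorm_smul]
    exact mul_le_mul_left (hPb t) _
  have hPl : AEStronglyMeasurable (fun t => discPoisson z t • l t) circleMeasure :=
    (continuous_discPoisson hz).aestronglyMeasurable.smul hli.1
  have hlim : Tendsto (fun r => ∫ t, discPoisson z t • g (circleMap 0 r t) ∂circleMeasure)
      (𝓝[<] 1) (𝓝 (∫ t, discPoisson z t • l t ∂circleMeasure)) := by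
    refine tendsto_integral_of_L1 _ hPl ?_ ?_
    · filter_upwards [Ico_mem_nhdsLT (zero_lt_one' ℝ)] with r hr
      exact integrable_circleMeasure_of_continuous
        ((continuous_discPoisson hz).smul (continuous_circle_slice g.differentiableOn hr))
    · have hmul := ENNReal.Tendsto.const_mul hL1
        (Or.inr (ENNReal.ofReal_ne_top (r := (1 + ‖z‖) / (1 - ‖z‖))))
      rw [mul_zero] at hmul
      refine tendsto_of_tendsto_of_tendsto_of_le_of_le tendsto_const_nhds hmul
        (fun _ => zero_le) fun r => ?_
      rw [← lintegral_const_mul' _ _ ENNReal.ofReal_ne_top]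
      exact lintegral_mono fun t => hPsub _ _ t
  refine tendsto_nhds_unique hlim ((g.tendsto_apply_ofReal_mul hz).congr' ?_)
  filter_upwards [Ico_mem_nhdsLT (zero_lt_one' ℝ)] with r hr
  exact (integral_discPoisson_smul_slice g.differentiableOn hr hz).symm

theorem enorm_le_of_modular_boundary_le
    (hl : ∀ᵐ t ∂circleMeasure, Tendsto (fun r => g (circleMap 0 r t)) (𝓝[<] 1) (𝓝 (l t)))
    {C : ℝ≥0∞} (hC : C ≠ 0) (h : Ψ.modular circleMeasure C l ≤ 1) : ‖g‖ₑ ≤ C := by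
  have hle := enorm_le_of_modular_slice_le (f := g) hC le_rfl ENNReal.one_ne_top fun r hr => by
    refine (Ψ.modular_comp_slice_le (tendsto_lintegral_slice_sub hl).1.1
      (fun z hz => integral_discPoisson_smul_of_tendsto hl hz) differentiableOn_id (mapsTo_id _)
      hr C).trans ?_
    simpa using h
  rwa [one_mul] at hle

theorem tendsto_compCLM_boundary (hφ : DifferentiableOn ℂ φ (Metric.ball 0 1))
    (hmaps : MapsTo φ (Metric.ball 0 1) (Metric.ball 0 1)) (f : HardyOrlicz Ψ) {F : ℂ → ℂ}
    (hF : EqOn f F (Metric.ball 0 1)) {t : ℝ}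
    (ht : Tendsto (fun r => φ (circleMap 0 r t)) (𝓝[<] 1) (𝓝 (boundaryValue φ t)))
    (hc : ContinuousAt F (boundaryValue φ t)) :
    Tendsto (fun r => compCLM hφ hmaps f (circleMap 0 r t)) (𝓝[<] 1)
      (𝓝 (F (boundaryValue φ t))) := by
  refine (hc.tendsto.comp ht).congr' ?_
  filter_upwards [Ico_mem_nhdsLT (zero_lt_one' ℝ)] with r hr
  have hmem := circleMap_mem_unitBall hr t
  rw [compCLM_apply hφ hmaps f hmem, hF (hmaps hmem)]
  rfl

end HardyOrlicz

/-! ### Order boundedness -/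

section OrderBounded

variable {Ψ : OrliczFunction} {φ : ℂ → ℂ}

open HardyOrlicz

theorem OrliczFunction.growth_mul_one_sub_le {r : ℝ} (hr : r ∈ Ico (0 : ℝ) 1) :
    Ψ.growth r * (1 - r) ≤ (Ψ.inv 1).toReal := by
  have h1r : 0 < 1 - r := sub_pos.2 hr.2
  have one_le : 1 ≤ ENNReal.ofReal (1 / (1 - r)) := by
    rw [ENNReal.one_le_ofReal, one_le_div h1r]
    linarith [hr.1]
  have hle := Ψ.inv_mul_le one_le ENNReal.ofReal_ne_top 1
  have hinv : Ψ.inv 1 ≠ ⊤ := Ψ.inv_ne_top ENNReal.one_ne_top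
  rw [mul_one, ← Ψ.ofReal_growth, ← ENNReal.ofReal_toReal hinv,
    ← ENNReal.ofReal_mul (by positivity), ENNReal.ofReal_le_ofReal_iff (by positivity)] at hle
  rwa [← le_div_iff₀ h1r, ← one_div_mul_eq_div]

namespace HardyOrlicz

theorem norm_growth_smul_uElem_le_one (a : Circle) {r : ℝ} (hr : r ∈ Ico (0 : ℝ) 1) :
    ‖(Ψ.growth r : ℂ) • uElem Ψ a r‖ ≤ 1 := by
  have hpos := Ψ.growth_pos hr.2
  rw [norm_smul, Complex.norm_of_nonneg hpos.le, ← le_div_iff₀' hpos]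
  exact norm_uElem_le a hr

theorem growth_smul_uElem_apply (a : Circle) {r : ℝ} (hr : r ∈ Ico (0 : ℝ) 1) {z : ℂ}
    (hz : z ∈ Metric.ball (0 : ℂ) 1) :
    ((Ψ.growth r : ℂ) • uElem Ψ a r) z = Ψ.growth r * uFun a r z := by
  rw [smul_apply, uElem_apply a hr hz]

theorem norm_growth_smul_uElem_apply_le (a : Circle) {r R : ℝ} (hr : r ∈ Ico (0 : ℝ) 1)
    (hR : R < 1) {z : ℂ} (hz : ‖z‖ ≤ R) :
    ‖((Ψ.growth r : ℂ) • uElem Ψ a r) z‖ ≤ (Ψ.inv 1).toReal * (1 - r) / (1 - R) ^ 2 := by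
  have hpos := Ψ.growth_nonneg (r := r)
  rw [growth_smul_uElem_apply a hr (mem_ball_zero_iff.2 (hz.trans_lt hR)), norm_mul,
    Complex.norm_of_nonneg hpos, uFun_eq_sq, norm_pow]
  calc Ψ.growth r * ‖vFun a r z‖ ^ 2 ≤ Ψ.growth r * ((1 - r) / (1 - R)) ^ 2 := by
        gcongr
        exact norm_vFun_le a hr hR hz
    _ = Ψ.growth r * (1 - r) * (1 - r) / (1 - R) ^ 2 := by
        rw [div_pow]
        ring
    _ ≤ (Ψ.inv 1).toReal * (1 - r) / (1 - R) ^ 2 := by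
        gcongr
        · exact sub_nonneg.2 hr.2.le
        · exact Ψ.growth_mul_one_sub_le hr

end HardyOrlicz

theorem lintegral_le_add_setLIntegral {Ω : Type*} [MeasurableSpace Ω] {μ : Measure Ω}
    [IsProbabilityMeasure μ] {F G : Ω → ℝ≥0∞} {c : ℝ≥0∞} {E : Set Ω}
    (hG : ∀ᵐ t ∂μ, t ∈ E → F t ≤ G t) (hc : ∀ᵐ t ∂μ, t ∉ E → F t ≤ c) :
    ∫⁻ t, F t ∂μ ≤ c + ∫⁻ t in E, G t ∂μ := by
  calc ∫⁻ t, F t ∂μ ≤ ∫⁻ t, (c + E.indicator G t) ∂μ := by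
        refine lintegral_mono_ae ?_
        filter_upwards [hG, hc] with t htG htc
        by_cases ht : t ∈ E
        · rw [indicator_of_mem ht]
          exact (htG ht).trans le_add_self
        · rw [indicator_of_notMem ht, add_zero]
          exact htc ht
    _ ≤ c + ∫⁻ t in E, G t ∂μ := by
        rw [lintegral_add_left measurable_const, lintegral_const, measure_univ, mul_one]
        exact add_le_add_right (lintegral_indicator_le _ _) _

theorem one_div_one_sub_enorm_le_of_forall_rat {w : ℂ} (hw : ‖w‖ ≤ 1) {E : ℝ≥0∞}
    (h : ∀ q : ℚ, (q : ℝ) ∈ Ico (0 : ℝ) 1 → (q : ℝ) < (1 + ‖w‖) / 2 →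
      ENNReal.ofReal (1 / (1 - q)) ≤ E) : 1 / (1 - ‖w‖ₑ) ≤ E := by
  rcases eq_or_ne E ⊤ with rfl | hE
  · exact le_top
  have hq : ∀ q : ℚ, (q : ℝ) ∈ Ico (0 : ℝ) 1 → (q : ℝ) < (1 + ‖w‖) / 2 → 1 / (1 - q) ≤ E.toReal :=
    fun q hq hqw => (ENNReal.ofReal_le_iff_le_toReal hE).1 (h q hq hqw)
  have hone : 1 ≤ E.toReal := by
    simpa using hq 0 (by simp) (by rw [Rat.cast_zero]; positivity)
  have hdist : 1 / E.toReal ≤ 1 - ‖w‖ := by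
    by_contra! hlt
    have : 0 < 1 / E.toReal := by positivity
    obtain ⟨q, hq1, hqw⟩ := exists_rat_btwn
      (show 1 - 1 / E.toReal < (1 + ‖w‖) / 2 by linarith)
    have hq0 : (0 : ℝ) ≤ q := by
      have := div_le_one_of_le₀ hone (zero_le_one.trans hone)
      linarith
    have hqlt : (q : ℝ) < 1 := by linarith
    have := (one_div_le (sub_pos.2 hqlt) (by positivity)).1 (hq q ⟨hq0, hqlt⟩ hqw)
    linarith
  have hlt : 0 < 1 - ‖w‖ := (by positivity : 0 < 1 / E.toReal).trans_le hdist
  rw [one_div_one_sub_enorm (mem_ball_zero_iff.2 (sub_pos.1 hlt)),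
    ENNReal.ofReal_le_iff_le_toReal hE]
  exact (one_div_le hlt (by positivity)).2 hdist

namespace OrliczFunction

theorem inv_one_div_one_sub_enorm_le {w : ℂ} (hw : ‖w‖ ≤ 1) {D : Set Circle} (hD : Dense D)
    {x : ℝ} (h : ∀ q : ℚ, (q : ℝ) ∈ Ico (0 : ℝ) 1 → ∀ a ∈ D,
      Ψ.growth q * ‖uFun a q w‖ ≤ x) : Ψ.inv (1 / (1 - ‖w‖ₑ)) ≤ ENNReal.ofReal (9 * x) := by
  rw [← Ψ.inv_eval (ENNReal.ofReal (9 * x))]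
  refine Ψ.inv_mono (one_div_one_sub_enorm_le_of_forall_rat hw fun q hq hqw => ?_)
  obtain ⟨θ, -, hθ⟩ := exists_norm_sub_circleExp_eq hw
  obtain ⟨a, haD, ha⟩ := hD.exists_mem_open
    (isOpen_lt (f := fun a : Circle => ‖w - a‖) (by fun_prop)
      (continuous_const (y := 2 * (1 - (q : ℝ))))) ⟨Circle.exp θ, by
        rw [mem_ofPred_eq, hθ]
        linarith⟩
  have hninth := one_ninth_le_sq_norm_vFun hq hw (le_of_lt ha)
  have hle := h q hq a haD
  rw [uFun_eq_sq, norm_pow] at hle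
  rw [← Ψ.eval_inv (ENNReal.ofReal (1 / (1 - q))), ← Ψ.ofReal_growth]
  refine Ψ.eval_mono (ENNReal.ofReal_le_ofReal ?_)
  linarith [mul_le_mul_of_nonneg_left hninth (Ψ.growth_nonneg (r := q))]

theorem ChiIntegrable.orderBounded (hφ : DifferentiableOn ℂ φ (Metric.ball 0 1))
    (hmaps : MapsTo φ (Metric.ball 0 1) (Metric.ball 0 1))
    (h : Ψ.ChiIntegrable circleMeasure (invBoundaryDist φ)) :
    OrderBoundedIntoMorseTransue (compCLM (Ψ := Ψ) hφ hmaps) := by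
  have hR := aemeasurable_invBoundaryDist hφ hmaps
  refine ⟨fun t => (2 * Ψ.inv (invBoundaryDist φ t)).toReal,
    ⟨((Ψ.inv_mono.measurable.comp_aemeasurable hR).const_mul 2).ennreal_toReal.aestronglyMeasurable,
      fun C hC => ?_⟩, fun f hf => ?_⟩
  · refine (lintegral_mono fun t => Ψ.eval_mono ?_).trans_lt (h (2 * C⁻¹) (by positivity))
    rw [ENNReal.coe_mul, ENNReal.coe_inv hC.ne', ENNReal.coe_ofNat, mul_right_comm,
      ← div_eq_mul_inv]
    gcongr
    rw [Real.enorm_of_nonneg ENNReal.toReal_nonneg]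
    exact ENNReal.ofReal_toReal_le
  · filter_upwards [ae_tendsto_boundaryValue hφ hmaps, h.ae_lt_top hR] with t ht hlt
    have hball := invBoundaryDist_lt_top.1 hlt
    rw [boundaryValue_eq (tendsto_compCLM_boundary hφ hmaps f (fun _ _ => rfl) ht
      (f.continuousAt hball)), ← ENNReal.ofReal_le_iff_le_toReal
      (ENNReal.mul_ne_top ENNReal.ofNat_ne_top (Ψ.inv_ne_top hlt.ne)), ofReal_norm]
    refine (f.enorm_apply_le hball).trans (mul_le_of_le_one_right' ?_)
    simpa [← ofReal_norm] using hf

theorem ChiIntegrable.of_orderBounded (hφ : DifferentiableOn ℂ φ (Metric.ball 0 1))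
    (hmaps : MapsTo φ (Metric.ball 0 1) (Metric.ball 0 1))
    (h : OrderBoundedIntoMorseTransue (compCLM (Ψ := Ψ) hφ hmaps)) :
    Ψ.ChiIntegrable circleMeasure (invBoundaryDist φ) := by
  obtain ⟨g, ⟨-, hg⟩, hdom⟩ := h
  obtain ⟨D, hDc, hD⟩ := TopologicalSpace.exists_countable_dense Circle
  have hball := ae_norm_boundaryValue_le hφ hmaps
  have hkernel : ∀ᵐ t ∂circleMeasure, ∀ q : ℚ, (q : ℝ) ∈ Ico (0 : ℝ) 1 → ∀ a ∈ D,
      Ψ.growth q * ‖uFun a q (boundaryValue φ t)‖ ≤ g t := by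
    simp only [ae_all_iff, ae_ball_iff hDc]
    intro q hq a _
    filter_upwards [hdom _ (norm_growth_smul_uElem_le_one a hq), ae_tendsto_boundaryValue hφ hmaps,
      hball] with t hdom_t ht ht1
    rwa [boundaryValue_eq (tendsto_compCLM_boundary hφ hmaps _
      (F := fun z => Ψ.growth q * uFun a q z) (fun z hz => growth_smul_uElem_apply a hq hz) ht
      (continuousAt_const.mul ((differentiableAt_vFun a hq ht1).continuousAt.pow 2))), norm_mul,
      Complex.norm_of_nonneg Ψ.growth_nonneg] at hdom_t
  intro B hB
  refine (lintegral_mono_ae ?_).trans_lt (hg (9 * B)⁻¹ (by positivity))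
  filter_upwards [hkernel, hball] with t ht ht1
  refine Ψ.eval_mono ?_
  calc B * Ψ.inv (invBoundaryDist φ t) ≤ B * ENNReal.ofReal (9 * g t) := by
        gcongr
        exact inv_one_div_one_sub_enorm_le ht1 hD ht
    _ ≤ B * (9 * ‖g t‖ₑ) := by
        rw [ENNReal.ofReal_mul (by norm_num), ENNReal.ofReal_ofNat]
        gcongr
        exact Real.ofReal_le_enorm _
    _ = ‖g t‖ₑ / ((9 * B)⁻¹ : ℝ≥0) := by
        rw [ENNReal.coe_inv (by positivity), ENNReal.div_eq_inv_mul, inv_inv, ENNReal.coe_mul,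
          ENNReal.coe_ofNat]
        ring

theorem ChiIntegrable.exists_setLIntegral_chi_lt {Ω : Type*} [MeasurableSpace Ω] {μ : Measure Ω}
    {R : Ω → ℝ≥0∞} (h : Ψ.ChiIntegrable μ R) (hR : AEMeasurable R μ) {B : ℝ≥0} (hB : 0 < B)
    {ε : ℝ≥0∞} (hε : ε ≠ 0) :
    ∃ s : ℝ, 0 < s ∧ ∫⁻ t in {t | ENNReal.ofReal (1 / s) < R t}, Ψ.chi B (R t) ∂μ < ε := by
  have hR_top : ∫⁻ t, R t ∂μ ≠ ⊤ := by simpa [Ψ.chi_one] using (h 1 one_pos).ne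
  obtain ⟨δ, hδ, hsmall⟩ := exists_pos_setLIntegral_lt_of_measure_lt (h B hB).ne hε
  obtain ⟨s, hs, hsδ⟩ := ENNReal.exists_nnreal_pos_mul_lt hR_top hδ.ne'
  refine ⟨s, hs, hsmall _ (lt_of_le_of_lt ?_ hsδ)⟩
  rw [one_div, ENNReal.ofReal_inv_of_pos (NNReal.coe_pos.2 hs), ENNReal.ofReal_coe_nnreal]
  calc μ {t | (s : ℝ≥0∞)⁻¹ < R t} ≤ μ {t | (s : ℝ≥0∞)⁻¹ ≤ R t} :=
        measure_mono (ofPred_subset_ofPred.2 fun t => le_of_lt)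
    _ ≤ (∫⁻ t, R t ∂μ) / (s : ℝ≥0∞)⁻¹ :=
        meas_ge_le_lintegral_div hR (by simp) (by simpa using hs.ne')
    _ = s * ∫⁻ t, R t ∂μ := by rw [div_eq_mul_inv, inv_inv, mul_comm]

/-- Near the circle the growth estimate bounds `f ∘ φ*` by the integrable function `χ_B(1 / (1 -
|φ*|))`; elsewhere `φ*` stays in a compact part of the disc. -/
theorem ChiIntegrable.exists_norm_compCLM_le (hφ : DifferentiableOn ℂ φ (Metric.ball 0 1))
    (hmaps : MapsTo φ (Metric.ball 0 1) (Metric.ball 0 1))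
    (h : Ψ.ChiIntegrable circleMeasure (invBoundaryDist φ)) {ε : ℝ} (hε : 0 < ε) :
    ∃ R < 1, ∃ η > 0, ∀ f : HardyOrlicz Ψ, ‖f‖ ≤ 1 → (∀ w, ‖w‖ ≤ R → ‖f w‖ ≤ η) →
      ‖compCLM hφ hmaps f‖ ≤ ε := by
  have hR := aemeasurable_invBoundaryDist hφ hmaps
  lift ε to ℝ≥0 using hε.le
  have hε' : 0 < ε := hε
  have hhalf : Ψ.inv 2⁻¹ ≠ ⊤ := Ψ.inv_ne_top (by simp)
  obtain ⟨s, hs, hint⟩ := h.exists_setLIntegral_chi_lt hR (B := 2 * ε⁻¹) (by positivity)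
    (ε := 2⁻¹) (by simp)
  refine ⟨1 - s, by linarith, ε * (Ψ.inv 2⁻¹).toReal,
    mul_pos hε (ENNReal.toReal_pos (Ψ.inv_ne_zero (by simp)) hhalf), fun f hf hsmall => ?_⟩
  have near : ∀ t, invBoundaryDist φ t < ⊤ → Ψ.eval (‖f (boundaryValue φ t)‖ₑ / ε) ≤
      Ψ.chi (2 * ε⁻¹ : ℝ≥0) (invBoundaryDist φ t) := fun t ht => by
    have hf' : ‖f‖ₑ ≤ 1 := by simpa [← ofReal_norm] using hf
    refine Ψ.eval_mono ?_
    rw [ENNReal.coe_mul, ENNReal.coe_inv hε'.ne', ENNReal.coe_ofNat, mul_right_comm,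
      ← div_eq_mul_inv]
    gcongr
    exact (f.enorm_apply_le (invBoundaryDist_lt_top.1 ht)).trans (mul_le_of_le_one_right' hf')
  have far : ∀ w, ‖w‖ ≤ 1 - s → Ψ.eval (‖f w‖ₑ / ε) ≤ 2⁻¹ := fun w hw => by
    rw [Ψ.eval_le_iff_le_inv, ENNReal.div_le_iff' (by simpa using hε'.ne') ENNReal.coe_ne_top,
      ← ofReal_norm, ← ENNReal.ofReal_toReal hhalf, ← ENNReal.ofReal_coe_nnreal,
      ← ENNReal.ofReal_mul hε.le]
    exact ENNReal.ofReal_le_ofReal (hsmall w hw)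
  have hbound : ‖compCLM hφ hmaps f‖ₑ ≤ ε := by
    refine enorm_le_of_modular_boundary_le (l := fun t => f (boundaryValue φ t)) ?_
      (by simpa using hε'.ne') ?_
    · filter_upwards [ae_tendsto_boundaryValue hφ hmaps, h.ae_lt_top hR] with t ht hlt
      exact tendsto_compCLM_boundary hφ hmaps f (fun _ _ => rfl) ht
        (f.continuousAt (invBoundaryDist_lt_top.1 hlt))
    · refine (lintegral_le_add_setLIntegral ((h.ae_lt_top hR).mono fun t ht _ => near t ht)
        (ae_of_all _ fun t ht => far _ ?_)).trans
        ((add_le_add_right hint.le _).trans_eq ENNReal.inv_two_add_inv_two)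
      linarith [not_lt.1 (mt (lt_invBoundaryDist_iff hs).2 ht)]
  exact_mod_cast enorm_le_coe.1 hbound

theorem ChiIntegrable.isLittleO (hφ : DifferentiableOn ℂ φ (Metric.ball 0 1))
    (hmaps : MapsTo φ (Metric.ball 0 1) (Metric.ball 0 1))
    (h : Ψ.ChiIntegrable circleMeasure (invBoundaryDist φ)) :
    (fun r : ℝ => ⨆ a : Circle, ‖compCLM (Ψ := Ψ) hφ hmaps (uElem Ψ a r)‖) =o[𝓝[<] 1]
      fun r : ℝ => 1 / (Ψ.inv (ENNReal.ofReal (1 / (1 - r)))).toReal := by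
  refine IsLittleO.of_bound fun ε hε => ?_
  obtain ⟨R, hR, η, hη, hsmall⟩ := h.exists_norm_compCLM_le hφ hmaps hε
  have hdecay : Tendsto (fun r : ℝ => (Ψ.inv 1).toReal * (1 - r) / (1 - R) ^ 2) (𝓝[<] 1) (𝓝 0) :=
    (Continuous.tendsto' (by fun_prop) _ _ (by simp)).mono_left nhdsWithin_le_nhds
  filter_upwards [hdecay.eventually_le_const hη, Ico_mem_nhdsLT (zero_lt_one' ℝ)] with r hrη hr
  have hpos := Ψ.growth_pos hr.2
  change ‖_‖ ≤ ε * ‖1 / Ψ.growth r‖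
  rw [Real.norm_of_nonneg (Real.iSup_nonneg fun _ => norm_nonneg _),
    Real.norm_of_nonneg (by positivity), mul_one_div]
  refine ciSup_le fun a => ?_
  have hle := hsmall _ (norm_growth_smul_uElem_le_one a hr) fun w hw =>
    (norm_growth_smul_uElem_apply_le a hr hR hw).trans hrη
  rwa [map_smul, norm_smul, Complex.norm_of_nonneg hpos.le, ← le_div_iff₀' hpos] at hle

end OrliczFunction

end OrderBounded

/-! ### Completeness and compactness -/

namespace HardyOrlicz

variable {Ψ : OrliczFunction} {R : ℝ}

section Completeness

variable {ι : Type*} {l : Filter ι} [l.NeBot] [l.IsCountablyGenerated] {u : ι → HardyOrlicz Ψ}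
  {F : ℂ → ℂ} {C : ℝ≥0∞}

theorem modular_slice_le_one_of_tendsto (hC : C ≠ 0) (hu : ∀ᶠ i in l, ‖u i‖ₑ < C)
    (hlim : ∀ z ∈ Metric.ball (0 : ℂ) 1, Tendsto (fun i => u i z) l (𝓝 (F z))) {r : ℝ}
    (hr : r ∈ Ico (0 : ℝ) 1) : Ψ.modular circleMeasure C (fun t => F (circleMap 0 r t)) ≤ 1 :=
  Ψ.modular_le_of_tendsto hC
    (Eventually.of_forall fun i =>
      (continuous_circle_slice (u i).differentiableOn hr).aestronglyMeasurable)
    (ae_of_all _ fun t => hlim _ (circleMap_mem_unitBall hr t))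
    (hu.mono fun _ hi => modular_slice_le_one hi hr)

theorem enorm_le_of_tendsto_apply {f : HardyOrlicz Ψ} (hC : C ≠ 0) (hu : ∀ᶠ i in l, ‖u i‖ₑ < C)
    (hlim : ∀ z ∈ Metric.ball (0 : ℂ) 1, Tendsto (fun i => u i z) l (𝓝 (f z))) : ‖f‖ₑ ≤ C := by
  simpa only [one_mul] using enorm_le_of_modular_slice_le hC le_rfl ENNReal.one_ne_top
    fun r hr => modular_slice_le_one_of_tendsto hC hu hlim hr

end Completeness

section CauchySeq

variable {u : ℕ → HardyOrlicz Ψ}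

theorem uniformCauchySeqOn (hu : CauchySeq u) (hR : R < 1) :
    UniformCauchySeqOn (fun n => (u n : ℂ → ℂ)) atTop (Metric.closedBall 0 R) := by
  rw [Metric.uniformCauchySeqOn_iff]
  intro ε hε
  have hg := Ψ.growth_nonneg (r := R)
  obtain ⟨N, hN⟩ := Metric.cauchySeq_iff.1 hu (ε / (2 * Ψ.growth R + 1)) (by positivity)
  refine ⟨N, fun m hm n hn z hz => ?_⟩
  have hclose := hN m hm n hn
  rw [dist_eq_norm, lt_div_iff₀ (by positivity)] at hclose
  calc dist (u m z) (u n z) = ‖(u m - u n) z‖ := by rw [dist_eq_norm, sub_apply]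
    _ ≤ 2 * Ψ.growth R * ‖u m - u n‖ := (u m - u n).norm_apply_le hR (mem_closedBall_zero_iff.1 hz)
    _ < ε := by linarith [norm_nonneg (u m - u n)]

theorem tendstoLocallyUniformlyOn {F : ℂ → ℂ} (hu : CauchySeq u)
    (hlim : ∀ z ∈ Metric.ball (0 : ℂ) 1, Tendsto (fun n => u n z) atTop (𝓝 (F z))) :
    TendstoLocallyUniformlyOn (fun n => (u n : ℂ → ℂ)) F atTop (Metric.ball 0 1) := by
  intro s hs z hz
  obtain ⟨R, hzR, hR⟩ := exists_between (mem_ball_zero_iff.1 hz)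
  have huni : TendstoUniformlyOn (fun n => (u n : ℂ → ℂ)) F atTop (Metric.closedBall 0 R) :=
    (uniformCauchySeqOn hu hR).tendstoUniformlyOn_of_tendsto fun w hw =>
      hlim w (Metric.closedBall_subset_ball hR hw)
  exact ⟨Metric.closedBall 0 R, mem_nhdsWithin_of_mem_nhds (Metric.closedBall_mem_nhds_of_mem
    (mem_ball_zero_iff.2 hzR)), huni s hs⟩

theorem exists_tendsto_apply (hu : CauchySeq u) : ∃ f : HardyOrlicz Ψ,
    ∀ z ∈ Metric.ball (0 : ℂ) 1, Tendsto (fun n => u n z) atTop (𝓝 (f z)) := by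
  have hpt : ∀ z ∈ Metric.ball (0 : ℂ) 1, ∃ w, Tendsto (fun n => u n z) atTop (𝓝 w) :=
    fun z hz => cauchySeq_tendsto_of_complete
      ((evalCLM Ψ z hz).uniformContinuous.comp_cauchySeq hu)
  choose! F hF using hpt
  have hdiff : DifferentiableOn ℂ F (Metric.ball 0 1) :=
    (tendstoLocallyUniformlyOn hu hF).differentiableOn
      (Eventually.of_forall fun n => (u n).differentiableOn) Metric.isOpen_ball
  obtain ⟨b, hb⟩ := hu.norm_bddAbove
  have hbound : ∀ n, ‖u n‖ₑ < ENNReal.ofReal (b + 1) := fun n => by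
    have hn : ‖u n‖ < b + 1 := (hb (mem_range_self n)).trans_lt (lt_add_one b)
    rw [← ofReal_norm]
    exact (ENNReal.ofReal_lt_ofReal_iff ((norm_nonneg _).trans_lt hn)).2 hn
  have hC : ENNReal.ofReal (b + 1) ≠ 0 := (bot_le.trans_lt (hbound 0)).ne'
  exact ⟨ofModular hdiff hC ENNReal.ofReal_ne_top le_rfl ENNReal.one_ne_top fun r hr =>
    modular_slice_le_one_of_tendsto hC (Eventually.of_forall hbound) hF hr,
    fun z hz => by rw [ofModular_apply _ _ _ _ _ _ hz]; exact hF z hz⟩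

instance : CompleteSpace (HardyOrlicz Ψ) := by
  refine Metric.complete_of_cauchySeq_tendsto fun u hu => ?_
  obtain ⟨f, hf⟩ := exists_tendsto_apply hu
  refine ⟨f, Metric.tendsto_atTop'.2 fun ε hε => ?_⟩
  obtain ⟨N, hN⟩ := Metric.cauchySeq_iff.1 hu (ε / 2) (half_pos hε)
  have hε0 : ENNReal.ofReal (ε / 2) ≠ 0 := (ENNReal.ofReal_pos.2 (half_pos hε)).ne'
  refine ⟨N, fun n hn => ?_⟩
  have hle : ‖u n - f‖ₑ ≤ ENNReal.ofReal (ε / 2) := by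
    refine enorm_le_of_tendsto_apply (l := atTop) (u := fun m => u n - u m) hε0 ?_ fun z hz =>
      (hf z hz).const_sub _
    filter_upwards [eventually_ge_atTop N] with m hm
    rw [← ofReal_norm, ← dist_eq_norm]
    exact (ENNReal.ofReal_lt_ofReal_iff (half_pos hε)).2 (hN n hn.le m hm)
  rw [← ofReal_norm, ENNReal.ofReal_le_ofReal_iff (half_pos hε).le, ← dist_eq_norm] at hle
  exact hle.trans_lt (half_lt_self hε)

end CauchySeq

section Montel

theorem norm_deriv_le {f : HardyOrlicz Ψ} (hf : ‖f‖ ≤ 1) {R' : ℝ} (hRR' : R < R') (hR' : R' < 1)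
    {z : ℂ} (hz : ‖z‖ ≤ R) : ‖deriv f z‖ ≤ 2 * Ψ.growth R' / (R' - R) := by
  have hsub : Metric.closedBall z (R' - R) ⊆ Metric.closedBall 0 R' :=
    Metric.closedBall_subset_closedBall' (by rw [dist_zero_right]; linarith)
  refine Complex.norm_deriv_le_of_forall_mem_sphere_norm_le (sub_pos.2 hRR')
    (f.differentiableOn.diffContOnCl_ball (hsub.trans (Metric.closedBall_subset_ball hR')))
    fun w hw => ?_
  have hw' := f.norm_apply_le hR'
    (mem_closedBall_zero_iff.1 (hsub (Metric.sphere_subset_closedBall hw)))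
  exact hw'.trans (mul_le_of_le_one_right (by linarith [Ψ.growth_nonneg (r := R')]) hf)

theorem exists_lipschitzOnWith (Ψ : OrliczFunction) (hR : R < 1) :
    ∃ K : ℝ≥0, ∀ f : HardyOrlicz Ψ, ‖f‖ ≤ 1 → LipschitzOnWith K f (Metric.closedBall 0 R) := by
  obtain ⟨R', hRR', hR'⟩ := exists_between hR
  refine ⟨(2 * Ψ.growth R' / (R' - R)).toNNReal, fun f hf =>
    (convex_closedBall (0 : ℂ) R).lipschitzOnWith_of_nnnorm_deriv_le (fun z hz => ?_)
      fun z hz => ?_⟩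
  · exact f.differentiableOn.differentiableAt (Metric.isOpen_ball.mem_nhds
      (Metric.closedBall_subset_ball hR hz))
  · exact NNReal.le_toNNReal_of_coe_le (norm_deriv_le hf hRR' hR' (mem_closedBall_zero_iff.1 hz))

/-- The restriction of a function in `H^Ψ` to a smaller closed disc, where uniform convergence is
convergence in norm. -/
def restrictClosedBall (hR : R < 1) (f : HardyOrlicz Ψ) :
    BoundedContinuousFunction (Metric.closedBall (0 : ℂ) R) ℂ :=
  BoundedContinuousFunction.mkOfCompact ⟨(Metric.closedBall (0 : ℂ) R).domRestrict f,
    (f.differentiableOn.continuousOn.mono (Metric.closedBall_subset_ball hR)).domRestrict⟩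

theorem totallyBounded_image_restrictClosedBall (hR : R < 1) :
    TotallyBounded (restrictClosedBall (Ψ := Ψ) hR '' Metric.closedBall 0 1) := by
  obtain ⟨K, hK⟩ := exists_lipschitzOnWith Ψ hR
  refine (BoundedContinuousFunction.arzela_ascoli (Metric.closedBall 0 (2 * Ψ.growth R))
    (isCompact_closedBall _ _) _ ?_ ?_).totallyBounded.subset subset_closure
  · rintro _ w ⟨f, hf, rfl⟩
    have hw := f.norm_apply_le hR (mem_closedBall_zero_iff.1 w.2)
    exact mem_closedBall_zero_iff.2 (hw.trans
      (mul_le_of_le_one_right (by linarith [Ψ.growth_nonneg (r := R)])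
        (mem_closedBall_zero_iff.1 hf)))
  · refine (LipschitzWith.uniformEquicontinuous _ K ?_).equicontinuous
    rintro ⟨_, f, hf, rfl⟩
    exact (hK f (mem_closedBall_zero_iff.1 hf)).to_restrict

theorem exists_finite_net (hR : R < 1) {η : ℝ} (hη : 0 < η) :
    ∃ S ⊆ Metric.closedBall (0 : HardyOrlicz Ψ) 1, S.Finite ∧
      ∀ f : HardyOrlicz Ψ, ‖f‖ ≤ 1 → ∃ g ∈ S, ∀ w, ‖w‖ ≤ R → ‖f w - g w‖ ≤ η := by
  obtain ⟨S, hS, hSfin, hcov⟩ := exists_subset_image_finite_and.1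
    (Metric.finite_approx_of_totallyBounded (totallyBounded_image_restrictClosedBall hR) η hη)
  refine ⟨S, hS, hSfin, fun f hf => ?_⟩
  obtain ⟨_, ⟨g, hgS, rfl⟩, hfg⟩ := mem_iUnion₂.1 (hcov ⟨f, mem_closedBall_zero_iff.2 hf, rfl⟩)
  refine ⟨g, hgS, fun w hw => ?_⟩
  rw [← dist_eq_norm]
  exact (BoundedContinuousFunction.dist_coe_le_dist
    (⟨w, mem_closedBall_zero_iff.2 hw⟩ : Metric.closedBall (0 : ℂ) R)).trans
    (Metric.mem_ball.1 hfg).le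

end Montel

end HardyOrlicz

open HardyOrlicz in
theorem OrliczFunction.ChiIntegrable.isCompactOperator {Ψ : OrliczFunction} {φ : ℂ → ℂ}
    (hφ : DifferentiableOn ℂ φ (Metric.ball 0 1))
    (hmaps : MapsTo φ (Metric.ball 0 1) (Metric.ball 0 1))
    (h : Ψ.ChiIntegrable circleMeasure (invBoundaryDist φ)) :
    IsCompactOperator (compCLM (Ψ := Ψ) hφ hmaps) := by
  suffices htb : TotallyBounded (compCLM (Ψ := Ψ) hφ hmaps '' Metric.closedBall 0 1) from
    (isCompactOperator_iff_isCompact_closure_image_closedBall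
      (compCLM (Ψ := Ψ) hφ hmaps).toLinearMap one_pos).2
      (htb.closure.isCompact_of_isClosed isClosed_closure)
  rw [Metric.totallyBounded_iff]
  intro ε hε
  obtain ⟨R, hR, η, hη, hsmall⟩ := h.exists_norm_compCLM_le hφ hmaps (show 0 < ε / 3 by positivity)
  obtain ⟨S, hS1, hSfin, hS⟩ :=
    exists_finite_net (Ψ := Ψ) hR (show 0 < 2 * η by positivity)
  refine ⟨compCLM hφ hmaps '' S, hSfin.image _, ?_⟩
  rintro _ ⟨f, hf, rfl⟩
  rw [mem_closedBall_zero_iff] at hf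
  obtain ⟨g, hgS, hfg⟩ := hS f hf
  refine mem_iUnion₂.2 ⟨_, ⟨g, hgS, rfl⟩, ?_⟩
  have hhalf : ‖(2⁻¹ : ℂ)‖ = 2⁻¹ := by simp
  have hnorm : ‖(2⁻¹ : ℂ) • (f - g)‖ ≤ 1 := by
    rw [norm_smul, hhalf]
    linarith [norm_sub_le f g, mem_closedBall_zero_iff.1 (hS1 hgS)]
  have hdisc : ∀ w, ‖w‖ ≤ R → ‖((2⁻¹ : ℂ) • (f - g)) w‖ ≤ η := fun w hw => by
    rw [smul_apply, sub_apply, norm_mul, hhalf]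
    linarith [hfg w hw]
  have hC := hsmall _ hnorm hdisc
  rw [map_smul, map_sub, norm_smul, hhalf] at hC
  rw [Metric.mem_ball, dist_eq_norm]
  linarith

theorem isWeaklyCompactOperator_of_isCompactOperator {E F : Type*} [NormedAddCommGroup E]
    [NormedSpace ℂ E] [NormedAddCommGroup F] [NormedSpace ℂ F] {T : E →L[ℂ] F}
    (h : IsCompactOperator T) : IsWeaklyCompactOperator T := by
  have hcl : IsCompact (closure (T '' Metric.closedBall 0 1)) :=
    (isCompactOperator_iff_isCompact_closure_image_closedBall T.toLinearMap one_pos).1 h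
  exact (hcl.image (toWeakSpaceCLM ℂ F).continuous).closure_of_subset (image_mono subset_closure)

/-! ### Bumps and their sparse sums -/

theorem mul_le_inv_add_pow_three_mul_sq (x p : ℝ≥0∞) : x * p ≤ p⁻¹ + p ^ 3 * x ^ 2 := by
  rcases le_total (x * p ^ 2) 1 with h | h
  · refine le_add_right (ENNReal.le_inv_iff_mul_le.2 ?_)
    calc x * p * p = x * p ^ 2 := by ring
      _ ≤ 1 := h
  · refine le_add_left ?_
    calc x * p = x * p * 1 := (mul_one _).symm
      _ ≤ x * p * (x * p ^ 2) := by gcongr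
      _ = p ^ 3 * x ^ 2 := by ring

namespace OrliczFunction

variable {Ψ : OrliczFunction} {β : ℝ≥0}

section Bump

variable {a : Circle} {r : ℝ} {z : ℂ}

/-- The function `v_{a,r}` normalized to have the size `Ψ⁻¹(1 / (1 - r))` of a point evaluation:
its values have nonnegative real part and it is concentrated near `a`. -/
def bump (Ψ : OrliczFunction) (a : Circle) (r : ℝ) (z : ℂ) : ℂ := Ψ.growth r * vFun a r z

theorem norm_bump (Ψ : OrliczFunction) (a : Circle) (r : ℝ) (z : ℂ) :
    ‖Ψ.bump a r z‖ = Ψ.growth r * ‖vFun a r z‖ := by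
  rw [bump, norm_mul, Complex.norm_of_nonneg (Ψ.growth_nonneg)]

theorem re_bump (Ψ : OrliczFunction) (a : Circle) (r : ℝ) (z : ℂ) :
    (Ψ.bump a r z).re = Ψ.growth r * (vFun a r z).re := by
  rw [bump, Complex.re_ofReal_mul]

theorem enorm_bump (Ψ : OrliczFunction) (a : Circle) (r : ℝ) (z : ℂ) :
    ‖Ψ.bump a r z‖ₑ = ‖vFun a r z‖ₑ * ENNReal.ofReal (Ψ.growth r) := by
  rw [← ofReal_norm, norm_bump, ENNReal.ofReal_mul Ψ.growth_nonneg, ofReal_norm, mul_comm]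

theorem norm_bump_le (a : Circle) (hr : r ∈ Ico (0 : ℝ) 1) (hz : ‖z‖ ≤ 1) :
    ‖Ψ.bump a r z‖ ≤ Ψ.growth r := by
  rw [norm_bump]
  exact mul_le_of_le_one_right Ψ.growth_nonneg (norm_vFun_le_one a hr hz)

theorem re_bump_nonneg (a : Circle) (hr : r ∈ Ico (0 : ℝ) 1) (hz : ‖z‖ ≤ 1) :
    0 ≤ (Ψ.bump a r z).re := by
  rw [re_bump]
  exact mul_nonneg Ψ.growth_nonneg (re_vFun_nonneg a hr hz)

theorem growth_le_nine_mul_re_bump (hr : r ∈ Ico (0 : ℝ) 1) (hz : ‖z‖ ≤ 1)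
    (hza : ‖z - a‖ ≤ 2 * (1 - r)) : Ψ.growth r ≤ 9 * (Ψ.bump a r z).re := by
  have hninth : 1 / 9 ≤ (vFun a r z).re :=
    (one_ninth_le_sq_norm_vFun hr hz hza).trans (sq_norm_vFun_le_re a hr hz)
  rw [re_bump]
  nlinarith [Ψ.growth_nonneg (r := r)]

theorem differentiableOn_bump (a : Circle) (hr : r ∈ Ico (0 : ℝ) 1) :
    DifferentiableOn ℂ (Ψ.bump a r) (Metric.ball 0 1) :=
  (differentiableOn_vFun a hr).const_mul _

theorem continuousOn_bump (a : Circle) (hr : r ∈ Ico (0 : ℝ) 1) :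
    ContinuousOn (Ψ.bump a r) (Metric.closedBall 0 1) :=
  continuousOn_const.mul (continuousOn_vFun a hr)

theorem modular_bump_le (a : Circle) (hr : r ∈ Ico (0 : ℝ) 1) {C : ℝ≥0∞}
    (hC : Ψ.eval (ENNReal.ofReal (Ψ.growth r) / C) ^ 4 ≤ ENNReal.ofReal (1 / (1 - r))) {ρ : ℝ}
    (hρ : ρ ∈ Ico (0 : ℝ) 1) :
    Ψ.modular circleMeasure C (fun t => Ψ.bump a r (circleMap 0 ρ t)) ≤
      2 / Ψ.eval (ENNReal.ofReal (Ψ.growth r) / C) := by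
  set p := Ψ.eval (ENNReal.ofReal (Ψ.growth r) / C)
  have hp_top : p ≠ ⊤ := fun h => by
    rw [h, ENNReal.top_pow four_ne_zero, top_le_iff] at hC
    exact ENNReal.ofReal_ne_top hC
  have hr' : 0 < 1 - r := sub_pos.2 hr.2
  have hpointwise (t : ℝ) : Ψ.eval (‖Ψ.bump a r (circleMap 0 ρ t)‖ₑ / C) ≤
      p⁻¹ + p ^ 3 * ‖vFun a r (circleMap 0 ρ t)‖ₑ ^ 2 := by
    have hle : ‖vFun a r (circleMap 0 ρ t)‖ₑ ≤ 1 := by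
      rw [← ofReal_norm]
      exact ENNReal.ofReal_le_one.2
        (norm_vFun_le_one a hr (mem_ball_zero_iff.1 (circleMap_mem_unitBall hρ t)).le)
    rw [enorm_bump, mul_div_assoc]
    exact (Ψ.eval_mul_le hle _).trans (mul_le_inv_add_pow_three_mul_sq _ _)
  have hmass : p ^ 3 * ENNReal.ofReal (1 - r) ≤ p⁻¹ := by
    rw [ENNReal.le_inv_iff_mul_le]
    calc p ^ 3 * ENNReal.ofReal (1 - r) * p = p ^ 4 * ENNReal.ofReal (1 - r) := by ring
      _ ≤ ENNReal.ofReal (1 / (1 - r)) * ENNReal.ofReal (1 - r) := by gcongr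
      _ = 1 := by
          rw [← ENNReal.ofReal_mul (by positivity), one_div_mul_cancel hr'.ne', ENNReal.ofReal_one]
  calc Ψ.modular circleMeasure C (fun t => Ψ.bump a r (circleMap 0 ρ t))
      ≤ ∫⁻ t, (p⁻¹ + p ^ 3 * ‖vFun a r (circleMap 0 ρ t)‖ₑ ^ 2) ∂circleMeasure :=
        lintegral_mono hpointwise
    _ = p⁻¹ + p ^ 3 * ∫⁻ t, ‖vFun a r (circleMap 0 ρ t)‖ₑ ^ 2 ∂circleMeasure := by
        rw [lintegral_add_left measurable_const,
          lintegral_const_mul' _ _ (ENNReal.pow_ne_top hp_top), lintegral_const, measure_univ,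
          mul_one]
    _ ≤ p⁻¹ + p⁻¹ := by
        gcongr
        exact le_trans (by gcongr; exact lintegral_sq_enorm_vFun_le a hr hρ) hmass
    _ = 2 / p := by rw [← two_mul, div_eq_mul_inv]

end Bump

theorem tendsto_ofReal_one_div_one_sub :
    Tendsto (fun r : ℝ => ENNReal.ofReal (1 / (1 - r))) (𝓝[<] 1) (𝓝 ⊤) := by
  have hsub : Tendsto (fun r : ℝ => 1 - r) (𝓝[<] 1) (𝓝[>] 0) := by
    refine tendsto_nhdsWithin_iff.2 ⟨?_, ?_⟩
    · exact (Continuous.tendsto' (by fun_prop) _ _ (sub_self 1)).mono_left nhdsWithin_le_nhds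
    · filter_upwards [self_mem_nhdsWithin] with r hr using sub_pos.2 (mem_Iio.1 hr)
  simp only [one_div]
  exact ENNReal.tendsto_ofReal_nhds_top.2 (tendsto_inv_nhdsGT_zero.comp hsub)

theorem tendsto_ofReal_growth (Ψ : OrliczFunction) :
    Tendsto (fun r : ℝ => ENNReal.ofReal (Ψ.growth r)) (𝓝[<] 1) (𝓝 ⊤) := by
  simp only [ofReal_growth]
  have hinv : Tendsto Ψ.inv (𝓝 ⊤) (𝓝 ⊤) :=
    Ψ.evalOrderIso.symm.continuous.tendsto' ⊤ ⊤ Ψ.inv_top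
  exact hinv.comp tendsto_ofReal_one_div_one_sub

theorem SatisfiesDelta2.exists_eval_pow_four_le (hΨ : Ψ.SatisfiesDelta2) :
    ∃ β : ℝ≥0, 0 < β ∧ ∃ x₀ : ℝ≥0, ∀ x : ℝ≥0∞, x₀ ≤ x → Ψ.eval x ^ 4 ≤ Ψ.eval (β * x) := by
  obtain ⟨α, hα, x₀, hsq⟩ := hΨ.exists_eval_sq_le
  refine ⟨α ^ 2, pow_pos (zero_lt_one.trans hα) 2, x₀, fun x hx => ?_⟩
  calc Ψ.eval x ^ 4 = (Ψ.eval x ^ 2) ^ 2 := by ring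
    _ ≤ Ψ.eval (α * x) ^ 2 := by gcongr; exact hsq x hx
    _ ≤ Ψ.eval (α * (α * x)) :=
        hsq _ (hx.trans (le_mul_of_one_le_left' (ENNReal.one_le_coe_iff.2 hα.le)))
    _ = Ψ.eval ((α ^ 2 : ℝ≥0) * x) := by rw [ENNReal.coe_pow, sq, mul_assoc]

theorem SatisfiesDelta2.exists_modular_bump_le (hΨ : Ψ.SatisfiesDelta2) :
    ∃ β : ℝ≥0, 0 < β ∧ ∀ τ : ℝ≥0∞, τ ≠ 0 → ∀ᶠ r in 𝓝[<] (1 : ℝ), ∀ a : Circle,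
      ∀ ρ ∈ Ico (0 : ℝ) 1,
        Ψ.modular circleMeasure β (fun t => Ψ.bump a r (circleMap 0 ρ t)) ≤ τ := by
  obtain ⟨β, hβ, x₀, hx₀⟩ := hΨ.exists_eval_pow_four_le
  have hβ0 : (β : ℝ≥0∞) ≠ 0 := ENNReal.coe_ne_zero.2 hβ.ne'
  refine ⟨β, hβ, fun τ hτ => ?_⟩
  have hdiv : Tendsto (fun r => ENNReal.ofReal (Ψ.growth r) / β) (𝓝[<] 1) (𝓝 ⊤) := by
    simpa only [ENNReal.top_div_coe, Function.comp_def] using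
      ((ENNReal.continuous_div_const (β : ℝ≥0∞) hβ0).tendsto ⊤).comp Ψ.tendsto_ofReal_growth
  have heval : Tendsto (fun r => Ψ.eval (ENNReal.ofReal (Ψ.growth r) / β)) (𝓝[<] 1) (𝓝 ⊤) := by
    simpa only [Ψ.eval_top, Function.comp_def] using (Ψ.continuous_eval.tendsto ⊤).comp hdiv
  have hbound : Tendsto (fun r => 2 / Ψ.eval (ENNReal.ofReal (Ψ.growth r) / β)) (𝓝[<] 1)
      (𝓝 0) := by
    simpa only [ENNReal.div_top] using
      ENNReal.Tendsto.const_div heval (Or.inr ENNReal.ofNat_ne_top)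
  filter_upwards [hdiv.eventually_const_le ENNReal.coe_lt_top,
    hbound.eventually_le_const (pos_iff_ne_zero.2 hτ), Ico_mem_nhdsLT (zero_lt_one' ℝ)]
    with r hlarge hsmall hr a ρ hρ
  refine (modular_bump_le a hr ?_ hρ).trans hsmall
  refine (hx₀ _ hlarge).trans_eq ?_
  rw [ENNReal.mul_div_cancel hβ0 ENNReal.coe_ne_top, ofReal_growth, Ψ.eval_inv]

/-- The factor by which adding a `k`-th term to a sum of size at most `b` can multiply the modular
of that term, as long as it exceeds `2⁻ᵏ⁻¹`. -/
def sparseWeight (Ψ : OrliczFunction) (β : ℝ≥0) (k : ℕ) (b : ℝ≥0∞) : ℝ≥0∞ :=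
  Ψ.eval (b / β) / Ψ.eval (2⁻¹ ^ (k + 1) / β) + 1

theorem eval_half_pow_div_ne_zero (k : ℕ) : Ψ.eval (2⁻¹ ^ k / β) ≠ 0 :=
  Ψ.eval_ne_zero (ENNReal.div_ne_zero.2 ⟨pow_ne_zero _ (by simp), ENNReal.coe_ne_top⟩)

theorem sparseWeight_ne_top (hβ : 0 < β) (k : ℕ) {b : ℝ≥0∞} (hb : b ≠ ⊤) :
    Ψ.sparseWeight β k b ≠ ⊤ :=
  ENNReal.add_ne_top.2 ⟨ENNReal.div_ne_top (Ψ.eval_ne_top (ENNReal.div_ne_top hb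
    (ENNReal.coe_ne_zero.2 hβ.ne'))) (eval_half_pow_div_ne_zero _), ENNReal.one_ne_top⟩

theorem eval_add_div_le (hβ : 0 < β) {k : ℕ} {b x σ : ℝ≥0∞} (hx : 2⁻¹ ^ (k + 1) ≤ x)
    (hσ : σ ≤ b) : Ψ.eval ((σ + x) / (2 * β)) ≤ Ψ.eval (x / β) * Ψ.sparseWeight β k b := by
  have two_mul_div (y : ℝ≥0∞) : 2 * (y / (2 * β)) = y / β := by
    rw [← mul_div_assoc, ENNReal.mul_div_mul_left _ _ two_ne_zero ENNReal.ofNat_ne_top]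
  set q := Ψ.eval (2⁻¹ ^ (k + 1) / β) with hq
  have hq_top : q ≠ ⊤ := Ψ.eval_ne_top
    (ENNReal.div_ne_top (ENNReal.pow_ne_top (by simp)) (ENNReal.coe_ne_zero.2 hβ.ne'))
  calc Ψ.eval ((σ + x) / (2 * β)) ≤ Ψ.eval (σ / β) + Ψ.eval (x / β) := by
        rw [ENNReal.add_div, ← two_mul_div σ, ← two_mul_div x]
        exact Ψ.eval_add_le _ _
    _ ≤ Ψ.eval (b / β) + Ψ.eval (x / β) := by
        gcongr
        exact Ψ.eval_mono (ENNReal.div_le_div_right hσ _)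
    _ = q * (Ψ.eval (b / β) / q) + Ψ.eval (x / β) := by
        rw [ENNReal.mul_div_cancel (eval_half_pow_div_ne_zero _) hq_top]
    _ ≤ Ψ.eval (x / β) * (Ψ.eval (b / β) / q) + Ψ.eval (x / β) := by
        gcongr
        exact Ψ.eval_mono (ENNReal.div_le_div_right hx _)
    _ = Ψ.eval (x / β) * Ψ.sparseWeight β k b := by rw [sparseWeight, ← hq, mul_add, mul_one]

theorem half_pow_succ_add_half_pow_succ (k : ℕ) :
    (2⁻¹ : ℝ≥0∞) ^ (k + 1) + 2⁻¹ ^ (k + 1) = 2⁻¹ ^ k := by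
  rw [pow_succ, ← mul_add, ENNReal.inv_two_add_inv_two, mul_one]

/-- In the induction only the last term exceeding its threshold `2⁻ᵏ⁻¹` costs something: the later
terms are absorbed by the slack `2⁻ᴷ`. -/
theorem eval_sum_add_half_pow_le (hβ : 0 < β) {x c : ℕ → ℝ≥0∞} (hxc : ∀ k, x k ≤ c k) (K : ℕ) :
    Ψ.eval ((∑ k ∈ Finset.range K, x k + 2⁻¹ ^ K) / (2 * β)) ≤ Ψ.eval (1 / (2 * β)) +
      ∑ k ∈ Finset.range K,
        Ψ.eval (x k / β) * Ψ.sparseWeight β k (1 + ∑ j ∈ Finset.range k, c j) := by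
  induction K with
  | zero => simp
  | succ K ih =>
    rw [Finset.sum_range_succ, Finset.sum_range_succ]
    set σ := ∑ j ∈ Finset.range K, x j
    rcases le_total (x K) (2⁻¹ ^ (K + 1)) with h | h
    · have habsorb : σ + x K + 2⁻¹ ^ (K + 1) ≤ σ + 2⁻¹ ^ K := by
        rw [add_assoc, ← half_pow_succ_add_half_pow_succ K]
        gcongr
      refine (Ψ.eval_mono (ENNReal.div_le_div_right habsorb _)).trans (ih.trans ?_)
      gcongr
      exact le_self_add
    · have hσ : σ + 2⁻¹ ^ (K + 1) ≤ 1 + ∑ j ∈ Finset.range K, c j := by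
        rw [add_comm]
        gcongr
        · exact pow_le_one₀ zero_le (by simp)
        · exact Finset.sum_le_sum fun j _ => hxc j
      rw [add_right_comm]
      refine (eval_add_div_le hβ h hσ).trans ?_
      rw [← add_assoc]
      exact le_add_self

end OrliczFunction

theorem exists_seq_forall_sum {α M : Type*} [AddCommMonoid M] (c : α → M)
    {P : ℕ → M → α → Prop} (h : ∀ k b, ∃ x, P k b x) :
    ∃ u : ℕ → α, ∀ k, P k (∑ j ∈ Finset.range k, c (u j)) (u k) := by
  choose f hf using h
  let b : ℕ → M := fun n => Nat.rec 0 (fun k b => b + c (f k b)) n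
  have hb (k : ℕ) : ∑ j ∈ Finset.range k, c (f j (b j)) = b k := by
    induction k with
    | zero => rfl
    | succ k ih => rw [Finset.sum_range_succ, ih]
  exact ⟨fun k => f k (b k), fun k => (hb k).symm ▸ hf k (b k)⟩

namespace OrliczFunction

variable {Ψ : OrliczFunction} {β : ℝ≥0} {a : ℕ → Circle} {r : ℕ → ℝ} {φ : ℂ → ℂ}

/-- Each bump `Ψ.bump (a k) (r k)` has so small a modular, compared with the sizes of the previous
bumps, that the modulars of the partial sums `Ψ.bumpSum a r K` stay bounded. -/
structure IsSparse (Ψ : OrliczFunction) (β : ℝ≥0) (a : ℕ → Circle) (r : ℕ → ℝ) : Prop where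
  pos : 0 < β
  mem_Ico : ∀ k, r k ∈ Ico (0 : ℝ) 1
  modular_mul_sparseWeight_le : ∀ k, ∀ ρ ∈ Ico (0 : ℝ) 1,
    Ψ.modular circleMeasure β (fun t => Ψ.bump (a k) (r k) (circleMap 0 ρ t)) *
      Ψ.sparseWeight β k (1 + ∑ j ∈ Finset.range k, ENNReal.ofReal (Ψ.growth (r j))) ≤
        2⁻¹ ^ (k + 1)

theorem SatisfiesDelta2.exists_isSparse (hΨ : Ψ.SatisfiesDelta2) {Q : ℕ → Circle → ℝ → Prop}
    (hQ : ∀ k, ∃ᶠ r in 𝓝[<] (1 : ℝ), ∃ a, Q k a r) :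
    ∃ β a r, Ψ.IsSparse β a r ∧ ∀ k, Q k (a k) (r k) := by
  obtain ⟨β, hβ, hmod⟩ := hΨ.exists_modular_bump_le
  have hstep (k : ℕ) (b : ℝ≥0) : ∃ p : Circle × ℝ, (p.2 ∈ Ico (0 : ℝ) 1 ∧
      ∀ ρ ∈ Ico (0 : ℝ) 1, Ψ.modular circleMeasure β (fun t => Ψ.bump p.1 p.2 (circleMap 0 ρ t)) *
        Ψ.sparseWeight β k (1 + b) ≤ 2⁻¹ ^ (k + 1)) ∧ Q k p.1 p.2 := by
    have hW_top : Ψ.sparseWeight β k (1 + b) ≠ ⊤ := sparseWeight_ne_top hβ k (by simp)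
    have hW0 : Ψ.sparseWeight β k (1 + b) ≠ 0 := by simp [sparseWeight]
    have hτ : 2⁻¹ ^ (k + 1) / Ψ.sparseWeight β k (1 + b) ≠ 0 :=
      ENNReal.div_ne_zero.2 ⟨pow_ne_zero _ (by simp), hW_top⟩
    obtain ⟨r, ⟨a, ha⟩, hr, hr_mem⟩ :=
      ((hQ k).and_eventually ((hmod _ hτ).and (Ico_mem_nhdsLT (zero_lt_one' ℝ)))).exists
    exact ⟨(a, r), ⟨hr_mem, fun ρ hρ =>
      (ENNReal.le_div_iff_mul_le (Or.inl hW0) (Or.inl hW_top)).1 (hr a ρ hρ)⟩, ha⟩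
  obtain ⟨u, hu⟩ := exists_seq_forall_sum (fun p => (Ψ.growth p.2).toNNReal) hstep
  refine ⟨β, fun k => (u k).1, fun k => (u k).2, ⟨hβ, fun k => (hu k).1.1, fun k ρ hρ => ?_⟩,
    fun k => (hu k).2⟩
  simpa only [ENNReal.ofNNReal_finsetSum, ENNReal.ofReal] using (hu k).1.2 ρ hρ

theorem exists_isSparse_of_not_chiWindow (hΨ : Ψ.SatisfiesDelta2) (h : ¬ Ψ.ChiWindow φ) :
    ∃ A : ℝ≥0, ∃ β a r, Ψ.IsSparse β a r ∧ ∀ k : ℕ, (k : ℝ≥0∞) <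
      circleMeasure {t | ‖boundaryValue φ t - a k‖ ≤ 2 * (1 - r k)} *
        Ψ.chi A (ENNReal.ofReal (1 / (1 - r k))) := by
  simp only [ChiWindow, not_forall, not_exists, not_eventually, not_le] at h
  obtain ⟨A, -, hA⟩ := h
  refine ⟨A, hΨ.exists_isSparse (Q := fun k a r => (k : ℝ≥0∞) <
    circleMeasure {t | ‖boundaryValue φ t - a‖ ≤ 2 * (1 - r)} *
      Ψ.chi A (ENNReal.ofReal (1 / (1 - r)))) fun k => tendsto_one_sub_nhdsGT_zero.frequently ?_⟩
  simpa only [sub_sub_cancel, ENNReal.coe_natCast] using hA k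

/-- The sum of the first `K` bumps of a sequence. -/
def bumpSum (Ψ : OrliczFunction) (a : ℕ → Circle) (r : ℕ → ℝ) (K : ℕ) (z : ℂ) : ℂ :=
  ∑ k ∈ Finset.range K, Ψ.bump (a k) (r k) z

theorem differentiableOn_bumpSum (hr : ∀ k, r k ∈ Ico (0 : ℝ) 1) (K : ℕ) :
    DifferentiableOn ℂ (Ψ.bumpSum a r K) (Metric.ball 0 1) :=
  DifferentiableOn.fun_sum fun k _ => differentiableOn_bump (a k) (hr k)

theorem norm_bumpSum_le (hr : ∀ k, r k ∈ Ico (0 : ℝ) 1) (K : ℕ) {z : ℂ} (hz : ‖z‖ ≤ 1) :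
    ‖Ψ.bumpSum a r K z‖ ≤ ∑ k ∈ Finset.range K, Ψ.growth (r k) :=
  norm_sum_le_of_le _ fun k _ => norm_bump_le (a k) (hr k) hz

theorem re_bump_le_re_bumpSum (hr : ∀ k, r k ∈ Ico (0 : ℝ) 1) {k K : ℕ} (hk : k < K) {z : ℂ}
    (hz : ‖z‖ ≤ 1) : (Ψ.bump (a k) (r k) z).re ≤ (Ψ.bumpSum a r K z).re := by
  rw [bumpSum, Complex.re_sum]
  exact Finset.single_le_sum (f := fun k => (Ψ.bump (a k) (r k) z).re)
    (fun j _ => re_bump_nonneg (a j) (hr j) hz) (Finset.mem_range.2 hk)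

theorem sum_half_pow_succ_le_one (K : ℕ) : ∑ k ∈ Finset.range K, (2⁻¹ : ℝ≥0∞) ^ (k + 1) ≤ 1 := by
  refine (ENNReal.sum_le_tsum _).trans_eq ?_
  simp_rw [pow_succ]
  rw [ENNReal.tsum_mul_right, ENNReal.tsum_geometric, ENNReal.one_sub_inv_two, inv_inv,
    ENNReal.mul_inv_cancel two_ne_zero ENNReal.ofNat_ne_top]

theorem IsSparse.modular_bumpSum_le (h : Ψ.IsSparse β a r) (K : ℕ) {ρ : ℝ}
    (hρ : ρ ∈ Ico (0 : ℝ) 1) :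
    Ψ.modular circleMeasure (2 * β) (fun t => Ψ.bumpSum a r K (circleMap 0 ρ t)) ≤
      Ψ.eval (1 / (2 * β)) + 1 := by
  let x (k : ℕ) (t : ℝ) : ℝ≥0∞ := ‖Ψ.bump (a k) (r k) (circleMap 0 ρ t)‖ₑ
  let W (k : ℕ) : ℝ≥0∞ :=
    Ψ.sparseWeight β k (1 + ∑ j ∈ Finset.range k, ENNReal.ofReal (Ψ.growth (r j)))
  have hmeas (k : ℕ) : Measurable fun t => Ψ.eval (x k t / β) :=
    Ψ.measurable_eval.comp ((continuous_circle_slice (differentiableOn_bump (a k) (h.mem_Ico k))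
      hρ).measurable.enorm.div_const _)
  have hx (t : ℝ) (k : ℕ) : x k t ≤ ENNReal.ofReal (Ψ.growth (r k)) := by
    change ‖Ψ.bump _ _ _‖ₑ ≤ _
    rw [← ofReal_norm]
    exact ENNReal.ofReal_le_ofReal (norm_bump_le (a k) (h.mem_Ico k)
      (mem_ball_zero_iff.1 (circleMap_mem_unitBall hρ t)).le)
  calc Ψ.modular circleMeasure (2 * β) (fun t => Ψ.bumpSum a r K (circleMap 0 ρ t))
      ≤ ∫⁻ t, (Ψ.eval (1 / (2 * β)) + ∑ k ∈ Finset.range K, Ψ.eval (x k t / β) * W k)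
          ∂circleMeasure := lintegral_mono fun t =>
        (Ψ.eval_mono (ENNReal.div_le_div_right (le_add_right (enorm_sum_le _ _)) _)).trans
          (eval_sum_add_half_pow_le h.pos (hx t) K)
    _ = Ψ.eval (1 / (2 * β)) +
          ∑ k ∈ Finset.range K, (∫⁻ t, Ψ.eval (x k t / β) ∂circleMeasure) * W k := by
        rw [lintegral_add_left measurable_const,
          lintegral_finsetSum _ fun k _ => (hmeas k).mul_const _, lintegral_const, measure_univ,
          mul_one]
        simp only [lintegral_mul_const _ (hmeas _)]
    _ ≤ Ψ.eval (1 / (2 * β)) + ∑ k ∈ Finset.range K, 2⁻¹ ^ (k + 1) := by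
        gcongr with k
        exact h.modular_mul_sparseWeight_le k ρ hρ
    _ ≤ Ψ.eval (1 / (2 * β)) + 1 := by
        gcongr
        exact sum_half_pow_succ_le_one K

theorem IsSparse.exists_bounded_bumpSum (h : Ψ.IsSparse β a r) :
    ∃ s : ℕ → HardyOrlicz Ψ, (∃ D, ∀ K, ‖s K‖ ≤ D) ∧
      ∀ K, ∀ z ∈ Metric.ball (0 : ℂ) 1, s K z = Ψ.bumpSum a r K z := by
  have hC : (2 * β : ℝ≥0∞) ≠ 0 := mul_ne_zero two_ne_zero (ENNReal.coe_ne_zero.2 h.pos.ne')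
  have hC_top : (2 * β : ℝ≥0∞) ≠ ⊤ := ENNReal.mul_ne_top ENNReal.ofNat_ne_top ENNReal.coe_ne_top
  have hK_top : Ψ.eval (1 / (2 * β)) + 1 ≠ ⊤ := ENNReal.add_ne_top.2
    ⟨Ψ.eval_ne_top (ENNReal.div_ne_top ENNReal.one_ne_top hC), ENNReal.one_ne_top⟩
  refine ⟨fun K => HardyOrlicz.ofModular (differentiableOn_bumpSum h.mem_Ico K) hC hC_top
    le_add_self hK_top fun ρ hρ => h.modular_bumpSum_le K hρ,
    ⟨((Ψ.eval (1 / (2 * β)) + 1) * (2 * β)).toReal, fun K => ?_⟩,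
    fun K z hz => HardyOrlicz.ofModular_apply _ _ _ _ _ _ hz⟩
  rw [← toReal_enorm]
  exact ENNReal.toReal_mono (ENNReal.mul_ne_top hK_top hC_top)
    (HardyOrlicz.enorm_ofModular_le _ _ _ _ _ _)

end OrliczFunction

/-! ### Weakly compact composition operators -/

theorem IsWeaklyCompactOperator.exists_forall_mem_of_convex {E F : Type*} [NormedAddCommGroup E]
    [NormedSpace ℂ E] [NormedAddCommGroup F] [NormedSpace ℂ F] {T : E →L[ℂ] F}
    (hT : IsWeaklyCompactOperator T) {x : ℕ → E} (hx : ∃ D, ∀ n, ‖x n‖ ≤ D) :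
    ∃ g : F, ∀ s : Set F, Convex ℝ s → IsClosed s → (∀ᶠ n in atTop, T (x n) ∈ s) → g ∈ s := by
  obtain ⟨D, hD⟩ := hx
  set c : ℝ := max D 1
  have hc : 0 < c := zero_lt_one.trans_le (le_max_right _ _)
  have hball (n : ℕ) : c⁻¹ • x n ∈ Metric.closedBall (0 : E) 1 := by
    rw [mem_closedBall_zero_iff, norm_smul, Real.norm_of_nonneg (inv_nonneg.2 hc.le),
      inv_mul_le_iff₀ hc, mul_one]
    exact (hD n).trans (le_max_left _ _)
  have hmem (n : ℕ) : toWeakSpace ℂ F (T (c⁻¹ • x n)) ∈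
      closure (toWeakSpace ℂ F '' (T '' Metric.closedBall 0 1)) :=
    subset_closure (mem_image_of_mem _ (mem_image_of_mem _ (hball n)))
  obtain ⟨y, -, hy⟩ := IsCompact.exists_mapClusterPt (f := atTop) hT
    (u := fun n => toWeakSpace ℂ F (T (c⁻¹ • x n)))
    (le_principal_iff.2 (mem_map.2 (Eventually.of_forall hmem)))
  refine ⟨c • (toWeakSpace ℂ F).symm y, fun s hs hsc hev => ?_⟩
  let s' : Set F := (fun g => c • g) ⁻¹' s
  have hs'_convex : Convex ℝ s' := hs.smul_preimage c
  have hs'_closed : IsClosed s' := hsc.preimage (continuous_const_smul c)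
  have hclosed : IsClosed (toWeakSpace ℂ F '' s') := by
    rw [← hs'_closed.closure_eq, hs'_convex.toWeakSpace_closure ℂ]
    exact isClosed_closure
  have hev' : ∀ᶠ n in atTop, toWeakSpace ℂ F (T (c⁻¹ • x n)) ∈ toWeakSpace ℂ F '' s' :=
    hev.mono fun n hn => mem_image_of_mem _ (by
      rwa [mem_preimage, ← T.map_smul_of_tower, smul_inv_smul₀ hc.ne'])
  obtain ⟨g, hg, rfl⟩ := hclosed.mem_of_mapClusterPt hy hev'
  rwa [LinearEquiv.symm_apply_apply]

namespace HardyOrlicz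

variable {Ψ : OrliczFunction}

/-- The bounded analytic functions `H^∞`, as a subspace of `H^Ψ`. -/
def boundedFunctions (Ψ : OrliczFunction) : Submodule ℂ (HardyOrlicz Ψ) where
  carrier := {f | ∃ M, ∀ z ∈ Metric.ball (0 : ℂ) 1, ‖f z‖ ≤ M}
  zero_mem' := ⟨0, fun _ _ => norm_zero.le⟩
  add_mem' := fun ⟨M, hM⟩ ⟨N, hN⟩ => ⟨M + N, fun z hz => norm_add_le_of_le (hM z hz) (hN z hz)⟩
  smul_mem' := fun c _ ⟨M, hM⟩ => ⟨‖c‖ * M, fun z hz => by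
    rw [smul_apply, norm_mul]
    gcongr
    exact hM z hz⟩

theorem exists_modular_slice_le_of_mem_closure {g : HardyOrlicz Ψ}
    (hg : g ∈ (boundedFunctions Ψ).topologicalClosure) {C : ℝ≥0∞} (hC : C ≠ 0) :
    ∃ K ≠ ⊤, ∀ ρ ∈ Ico (0 : ℝ) 1, Ψ.modular circleMeasure C (fun t => g (circleMap 0 ρ t)) ≤ K := by
  have hC2 : C / 2 ≠ 0 := (ENNReal.half_pos hC).ne'
  obtain ⟨b, ⟨M, hM⟩, hgb⟩ := EMetric.mem_closure_iff.1 hg (C / 2) (ENNReal.half_pos hC)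
  rw [edist_eq_enorm_sub] at hgb
  refine ⟨2⁻¹ * 1 + 2⁻¹ * Ψ.eval (ENNReal.ofReal M / (C / 2)), ?_, fun ρ hρ => ?_⟩
  · have hM_top : Ψ.eval (ENNReal.ofReal M / (C / 2)) ≠ ⊤ :=
      Ψ.eval_ne_top (ENNReal.div_ne_top ENNReal.ofReal_ne_top hC2)
    finiteness
  · have slice_eq : (fun t => g (circleMap 0 ρ t)) =
        (fun t => (g - b) (circleMap 0 ρ t)) - fun t => -b (circleMap 0 ρ t) := funext fun t => by
      rw [Pi.sub_apply, sub_apply, sub_neg_eq_add, sub_add_cancel]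
    have hmeas : AEStronglyMeasurable (fun t => (g - b) (circleMap 0 ρ t)) circleMeasure :=
      (continuous_circle_slice (g - b).differentiableOn hρ).aestronglyMeasurable
    have hb : Ψ.modular circleMeasure (C / 2) (fun t => -b (circleMap 0 ρ t)) ≤
        Ψ.eval (ENNReal.ofReal M / (C / 2)) := by
      refine (lintegral_mono fun t => Ψ.eval_mono (ENNReal.div_le_div_right ?_ _)).trans_eq
        ((lintegral_const _).trans (by rw [measure_univ, mul_one]))
      rw [enorm_neg, ← ofReal_norm]
      exact ENNReal.ofReal_le_ofReal (hM _ (circleMap_mem_unitBall hρ t))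
    have hsub := Ψ.modular_sub_le hmeas (C / 2) (g := fun t => -b (circleMap 0 ρ t))
    rw [ENNReal.mul_div_cancel two_ne_zero ENNReal.ofNat_ne_top, ← slice_eq] at hsub
    refine hsub.trans ?_
    gcongr
    exact modular_slice_le_one hgb hρ

end HardyOrlicz

namespace OrliczFunction

open HardyOrlicz

variable {Ψ : OrliczFunction} {φ : ℂ → ℂ}

theorem measure_window_mul_chi_le_of_re_bump_le (hφ : DifferentiableOn ℂ φ (Metric.ball 0 1))
    (hmaps : MapsTo φ (Metric.ball 0 1) (Metric.ball 0 1)) {a : Circle} {r : ℝ}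
    (hr : r ∈ Ico (0 : ℝ) 1) {A : ℝ≥0} {g : ℂ → ℂ} {K : ℝ≥0∞}
    (hK : ∀ ρ ∈ Ico (0 : ℝ) 1,
      Ψ.modular circleMeasure (9 * A)⁻¹ (fun t => g (circleMap 0 ρ t)) ≤ K)
    (hg : ∀ z ∈ Metric.ball (0 : ℂ) 1, (Ψ.bump a r (φ z)).re ≤ ‖g z‖) :
    circleMeasure {t | ‖boundaryValue φ t - a‖ ≤ 2 * (1 - r)} *
      Ψ.chi A (ENNReal.ofReal (1 / (1 - r))) ≤ K := by
  have hcont : ContinuousOn (fun w => ((Ψ.bump a r w).re : ℂ)) (Metric.closedBall 0 1) :=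
    (Complex.continuous_ofReal.comp Complex.continuous_re).comp_continuousOn
      (continuousOn_bump a hr)
  have hC : ((9 * A : ℝ≥0∞)⁻¹) ≠ 0 :=
    ENNReal.inv_ne_zero.2 (ENNReal.mul_ne_top ENNReal.ofNat_ne_top ENNReal.coe_ne_top)
  refine measure_boundaryValue_mul_eval_le (E := {w | ‖w - a‖ ≤ 2 * (1 - r)}) hφ hmaps hcont hC
    (fun ρ hρ => ?_) fun w hwa hw => ?_
  · refine le_trans (lintegral_mono fun t => ?_) (hK ρ hρ)
    have hz := circleMap_mem_unitBall hρ t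
    refine Ψ.eval_mono (ENNReal.div_le_div_right (enorm_le_iff_norm_le.2 ?_) _)
    rw [Complex.norm_of_nonneg (re_bump_nonneg a hr (mem_ball_zero_iff.1 (hmaps hz)).le)]
    exact hg _ hz
  · rw [← Ψ.ofReal_growth, div_eq_mul_inv, inv_inv, ← ofReal_norm,
      Complex.norm_of_nonneg (re_bump_nonneg a hr hw)]
    calc A * ENNReal.ofReal (Ψ.growth r) ≤ A * ENNReal.ofReal (9 * (Ψ.bump a r w).re) := by
          gcongr
          exact growth_le_nine_mul_re_bump hr hw hwa
      _ = ENNReal.ofReal (Ψ.bump a r w).re * (9 * A) := by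
          rw [ENNReal.ofReal_mul (by norm_num), ENNReal.ofReal_ofNat]
          ring

theorem IsSparse.exists_re_bump_le {β : ℝ≥0} {a : ℕ → Circle} {r : ℕ → ℝ}
    (h : Ψ.IsSparse β a r) (hφ : DifferentiableOn ℂ φ (Metric.ball 0 1))
    (hmaps : MapsTo φ (Metric.ball 0 1) (Metric.ball 0 1))
    (hC : IsWeaklyCompactOperator (compCLM (Ψ := Ψ) hφ hmaps)) :
    ∃ g ∈ (boundedFunctions Ψ).topologicalClosure,
      ∀ k, ∀ z ∈ Metric.ball (0 : ℂ) 1, (Ψ.bump (a k) (r k) (φ z)).re ≤ (g z).re := by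
  obtain ⟨s, hs_bdd, hs⟩ := h.exists_bounded_bumpSum
  have hval (K : ℕ) {z : ℂ} (hz : z ∈ Metric.ball (0 : ℂ) 1) :
      compCLM hφ hmaps (s K) z = Ψ.bumpSum a r K (φ z) := by
    rw [compCLM_apply hφ hmaps _ hz, hs K _ (hmaps hz)]
  have hle {z : ℂ} (hz : z ∈ Metric.ball (0 : ℂ) 1) : ‖φ z‖ ≤ 1 :=
    (mem_ball_zero_iff.1 (hmaps hz)).le
  obtain ⟨g, hg⟩ := hC.exists_forall_mem_of_convex hs_bdd
  refine ⟨g, hg _ (((boundedFunctions Ψ).topologicalClosure.restrictScalars ℝ).convex)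
    (Submodule.isClosed_topologicalClosure _) (Eventually.of_forall fun K =>
      Submodule.le_topologicalClosure _ ⟨∑ k ∈ Finset.range K, Ψ.growth (r k), fun z hz => ?_⟩),
    fun k z hz => ?_⟩
  · rw [hval K hz]
    exact norm_bumpSum_le h.mem_Ico K (hle hz)
  · let ℓ : HardyOrlicz Ψ →L[ℝ] ℝ := Complex.reCLM.comp ((evalCLM Ψ z hz).restrictScalars ℝ)
    refine hg {f | (Ψ.bump (a k) (r k) (φ z)).re ≤ ℓ f}
      (convex_halfSpace_ge ℓ.isLinear _) (isClosed_le continuous_const ℓ.continuous) ?_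
    filter_upwards [eventually_gt_atTop k] with K hK
    change _ ≤ (compCLM hφ hmaps (s K) z).re
    rw [hval K hz]
    exact re_bump_le_re_bumpSum h.mem_Ico hK (hle hz)

theorem ChiWindow.of_isWeaklyCompactOperator (hΨ : Ψ.SatisfiesDelta2)
    (hφ : DifferentiableOn ℂ φ (Metric.ball 0 1))
    (hmaps : MapsTo φ (Metric.ball 0 1) (Metric.ball 0 1))
    (hC : IsWeaklyCompactOperator (compCLM (Ψ := Ψ) hφ hmaps)) : Ψ.ChiWindow φ := by
  by_contra hW
  obtain ⟨A, β, a, r, hsparse, hlarge⟩ := exists_isSparse_of_not_chiWindow hΨ hW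
  obtain ⟨g, hg, hre⟩ := hsparse.exists_re_bump_le hφ hmaps hC
  obtain ⟨K, hK_top, hK⟩ := exists_modular_slice_le_of_mem_closure hg (C := (9 * A)⁻¹)
    (ENNReal.inv_ne_zero.2 (ENNReal.mul_ne_top ENNReal.ofNat_ne_top ENNReal.coe_ne_top))
  obtain ⟨k, hk⟩ := ENNReal.exists_nat_gt hK_top
  have hle := measure_window_mul_chi_le_of_re_bump_le hφ hmaps (hsparse.mem_Ico k) hK
    fun z hz => (hre k z hz).trans (Complex.re_le_norm _)
  exact ((hk.trans (hlarge k)).trans_le hle).false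

end OrliczFunction

end

theorem mainTheorem1 (Ψ : OrliczFunction) (hΨ : Ψ.SatisfiesDelta2) (φ : ℂ → ℂ)
    (hφ : DifferentiableOn ℂ φ (Metric.ball 0 1))
    (hmaps : MapsTo φ (Metric.ball 0 1) (Metric.ball 0 1)) :
    ∃ C : HardyOrlicz Ψ →L[ℂ] HardyOrlicz Ψ,
      (∀ f : HardyOrlicz Ψ, ∀ z ∈ Metric.ball (0 : ℂ) 1, C f z = f (φ z)) ∧
      List.TFAE [
        OrderBoundedIntoMorseTransue C,
        IsCompactOperator C,
        IsWeaklyCompactOperator C,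
        MemMorseTransue Ψ (fun t => Ψ.inv (1 / (1 - ‖boundaryValue φ t‖ₑ))),
        ∀ B : ℝ≥0, 0 < B →
          Integrable (fun t => Ψ.chi B (1 / (1 - ‖boundaryValue φ t‖ₑ))) circleMeasure,
        ∀ A : ℝ≥0, 0 < A →
          (fun s : ℝ => circleMeasure.real {t | 1 - ‖boundaryValue φ t‖ < s}) =O[𝓝[>] 0]
            fun s : ℝ => 1 / (Ψ.chi A (ENNReal.ofReal (1 / s))).toReal,
        (fun r : ℝ => ⨆ a : Circle, ‖C (uElem Ψ a r)‖) =o[𝓝[<] 1]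
          fun r : ℝ => 1 / (Ψ.inv (ENNReal.ofReal (1 / (1 - r)))).toReal] := by
  have hR := aemeasurable_invBoundaryDist hφ hmaps
  have htail (h : Ψ.ChiTail circleMeasure (invBoundaryDist φ)) := h.chiIntegrable hΨ hR
  have hwindow (h : Ψ.ChiWindow φ) := htail (h.chiTail hΨ hφ hmaps)
  have hinv : MemMorseTransue Ψ (fun t => Ψ.inv (1 / (1 - ‖boundaryValue φ t‖ₑ))) ↔
      Ψ.ChiIntegrable circleMeasure (invBoundaryDist φ) := OrliczFunction.memMorseTransue_inv_iff hR
  refine ⟨HardyOrlicz.compCLM hφ hmaps, fun f z hz => HardyOrlicz.compCLM_apply hφ hmaps f hz, ?_⟩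
  rw [hinv]
  tfae_have 1 ↔ 4 := ⟨.of_orderBounded hφ hmaps, fun h => h.orderBounded hφ hmaps⟩
  tfae_have 4 ↔ 5 := (OrliczFunction.integrable_chi_iff hR).symm
  tfae_have 4 ↔ 6 := Iff.trans ⟨fun h => h.chiTail hR, htail⟩ OrliczFunction.isBigO_tail_iff.symm
  tfae_have 4 → 2 := fun h => h.isCompactOperator hφ hmaps
  tfae_have 2 → 3 := isWeaklyCompactOperator_of_isCompactOperator
  tfae_have 3 → 4 := fun h => hwindow (.of_isWeaklyCompactOperator hΨ hφ hmaps h)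
  tfae_have 4 → 7 := fun h => h.isLittleO hφ hmaps
  tfae_have 7 → 4 := fun h => hwindow (.of_isLittleO hφ hmaps h)
  tfae_finish
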